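/- Let $\Omega=(0,\infty)\times\mathbb R$ and let $H=-\partial_x^2+(-i\partial_y-x)^2$ be the self-adjoint operator in $L^2(\Omega)$ with Dirichlet condition at $x=0$ (the Friedrichs extension from $C_0^\infty(\Omega)$). For $k\in\mathbb R$ let $\mathfrak h(k)=-\partial_x^2+(x-k)^2$ be the Dirichlet operator in $L^2(0,\infty)$ (the Friedrichs extension from $C_0^\infty(0,\infty)$), let $\lambda_1(k)\le\lambda_2(k)\le\dots$ be its eigenvalues, and for each $m\ge1$ let $u_m(\cdot,k)$ be an $L^2$-normalized eigenfunction of $\mathfrak h(k)$ for $\lambda_m(k)$. For $\varphi\in L^2(\Omega)$ let $\hat\varphi(x,k)=\frac1{\sqrt{2\pi}}\int_{\mathbb R}e^{-iky}\varphi(x,y)\,dy$ be its partial Fourier transform and $\varphi_m(k)=\langle\hat\varphi(\cdot,k),u_m(\cdot,k)\rangle_{L^2(0,\infty)}$ its $m$-th generalized Fourier coefficient. Put $E_n=2n-1$. The bulk space $X^{\rm b}_{n,\delta}$ is the set of all $\varphi\in L^2(\Omega)$ with $\mathbb P_{(E_n,E_n+\delta)}\varphi=\varphi$, where $\mathbb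 P_I$ is the spectral projection of $H$ on $I$, and $\varphi_m=0$ almost everywhere for every $m\ne n$. The current operator is the commutator $J_y=-i[H,y]=-2(-i\partial_y-x)$, acting in the sense of distributions on all $\varphi\in L^2(\Omega)$ with $(-i\partial_y-x)\varphi\in L^2(\Omega)$. **Theorem.** For every integer $n\ge1$ there are constants $\mu_n>0$ and $\delta_n>0$, depending only on $n$, such that for every $\delta\in(0,\delta_n)$ every $\varphi\in X^{\rm b}_{n,\delta}$ belongs to the domain of $J_y$ and $$\left|\langle J_y\varphi,\varphi\rangle\right|\le\left(2\delta\sqrt{|\log\delta|}+\mu_n\,\frac{\delta\,\log|\log\delta|}{\sqrt{|\log\delta|}}\right)\|\varphi\|_{L^2(\Omega)}^2 .$$ -/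

import Mathlib

open MeasureTheory Set Complex
open scoped InnerProductSpace ContDiff ENNReal

noncomputable section

namespace HalfPlaneHall

/-! ### Abstract operators -/

section Abstract

variable {X Y : Type*} [NormedAddCommGroup X] [InnerProductSpace ℂ X]
  [NormedAddCommGroup Y] [InnerProductSpace ℂ Y]

/-- Let `G ⊆ X × Y` be the graph of a densely defined operator `T`. This is the graph of the
operator `A` associated with the closure of the quadratic form `ψ ↦ ‖T ψ‖²` (the Friedrichs
construction, `A = T* T̄`): `A φ = f` iff `φ` lies in the domain of the closed form and
`⟨T ψ, T φ⟩ = ⟨ψ, f⟩` for every `ψ` in the form core. -/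
def formGraph (G : Submodule ℂ (X × Y)) : Submodule ℂ (X × X) where
  carrier := {p | ∃ g : Y, (p.1, g) ∈ G.topologicalClosure ∧
    ∀ q ∈ G, ⟪q.2, g⟫_ℂ = ⟪q.1, p.2⟫_ℂ}
  add_mem' := by
    rintro p p' ⟨g, hg, h⟩ ⟨g', hg', h'⟩
    refine ⟨g + g', ?_, fun q hq => ?_⟩
    · exact G.topologicalClosure.add_mem hg hg'
    · simp only [inner_add_right, Prod.snd_add, h q hq, h' q hq]
  zero_mem' := ⟨0, G.topologicalClosure.zero_mem, fun q _ => by simp⟩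
  smul_mem' := by
    rintro c p ⟨g, hg, h⟩
    refine ⟨c • g, G.topologicalClosure.smul_mem c hg, fun q hq => ?_⟩
    simp only [inner_smul_right, Prod.smul_snd, h q hq]

/-- The operator associated with the closure of the form `‖T ·‖²`, where `G` is the graph
of `T`. -/
def formOperator (G : Submodule ℂ (X × Y)) : X →ₗ.[ℂ] X := (formGraph G).toLinearPMap

/-- The relation `formGraph G` is single valued as soon as `T` is densely defined. -/
theorem formGraph_single_valued (G : Submodule ℂ (X × Y))
    (hG : ∀ f : X, (∀ q ∈ G, ⟪q.1, f⟫_ℂ = 0) → f = 0) :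
    ∀ p ∈ formGraph G, p.1 = 0 → p.2 = 0 := by
  rintro ⟨φ, f⟩ ⟨g, hg, h⟩ hφ
  simp only at hφ h hg
  subst hφ
  have hcl : ∀ q ∈ G.topologicalClosure, ⟪q.2, g⟫_ℂ = ⟪q.1, f⟫_ℂ := by
    intro q hq
    have hclosed : IsClosed {q : X × Y | ⟪q.2, g⟫_ℂ = ⟪q.1, f⟫_ℂ} :=
      isClosed_eq (by fun_prop) (by fun_prop)
    exact closure_minimal (fun q hq => h q hq) hclosed hq
  have hg0 : g = 0 := by
    have := hcl _ hg
    simpa using this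
  subst hg0
  exact hG f fun q hq => by simpa using (h q hq).symm

/-- The spectral resolution of a (self-adjoint) operator `A`: a projection-valued Borel measure
`proj` on `ℝ` with `A = ∫ t d(proj t)`. For each vector `φ`, `measure φ` is the finite Borel
measure `B ↦ ⟨φ, proj B φ⟩ = ‖proj B φ‖²`; its being a measure is the countable additivity
of `proj`. -/
structure SpectralResolution [CompleteSpace X] (A : X →ₗ.[ℂ] X) where
  proj : Set ℝ → (X →L[ℂ] X)
  measure : X → Measure ℝ
  isStarProjection : ∀ B, MeasurableSet B → IsStarProjection (proj B)
  proj_univ : proj univ = 1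
  proj_inter : ∀ B C, MeasurableSet B → MeasurableSet C → proj (B ∩ C) = proj B * proj C
  measure_apply : ∀ φ B, MeasurableSet B → measure φ B = ENNReal.ofReal (‖proj B φ‖ ^ 2)
  mem_domain_iff : ∀ φ, φ ∈ A.domain ↔ ∫⁻ t, ENNReal.ofReal (t ^ 2) ∂(measure φ) < ⊤
  inner_apply : ∀ φ : A.domain, ⟪(φ : X), A φ⟫_ℂ = ((∫ t, t ∂(measure (φ : X)) : ℝ) : ℂ)

/-- The energy of the state `φ` is concentrated in `I`: the spectral projection of `A` on `I`
fixes `φ`. -/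
def EnergyConcentrated [CompleteSpace X] (A : X →ₗ.[ℂ] X) (I : Set ℝ) (φ : X) : Prop :=
  ∃ S : SpectralResolution A, S.proj I φ = φ

/-- `u` is an `L²`-normalized eigenvector of `A` for the eigenvalue `t`. -/
def IsNormalizedEigenvector (A : X →ₗ.[ℂ] X) (t : ℝ) (u : X) : Prop :=
  ‖u‖ = 1 ∧ ∃ h : u ∈ A.domain, A ⟨u, h⟩ = (t : ℂ) • u

/-- The `m`-th eigenvalue (`m ≥ 1`) of `A` in non-decreasing order, counted with multiplicity:
the least `t` for which there are `m` linearly independent eigenvectors with eigenvalues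
at most `t`. -/
def nthEigenvalue (A : X →ₗ.[ℂ] X) (m : ℕ) : ℝ :=
  sInf {t : ℝ | ∃ v : Fin m → X, LinearIndependent ℂ v ∧
    ∀ i, ∃ s ≤ t, IsNormalizedEigenvector A s (v i)}

end Abstract

/-! ### Function spaces -/

/-- The half-plane `Ω = (0, ∞) × ℝ`, with points `(x, y)`. -/
def halfPlane : Set (ℝ × ℝ) := {p | 0 < p.1}

/-- `L²(Ω)`. -/
abbrev L2Plane : Type := Lp ℂ 2 ((volume : Measure (ℝ × ℝ)).restrict halfPlane)

/-- `L²(0, ∞)`. -/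
abbrev L2HalfLine : Type := Lp ℂ 2 ((volume : Measure ℝ).restrict (Ioi 0))

/-- `ψ ∈ C₀^∞(U)`, complex valued. -/
structure IsTest {E : Type*} [NormedAddCommGroup E] [NormedSpace ℝ E] (U : Set E)
    (ψ : E → ℂ) : Prop where
  contDiff : ContDiff ℝ ∞ ψ
  hasCompactSupport : HasCompactSupport ψ
  tsupport_subset : tsupport ψ ⊆ U

namespace IsTest

variable {E : Type*} [NormedAddCommGroup E] [NormedSpace ℝ E] {U : Set E} {ψ ψ' : E → ℂ}

theorem zero : IsTest U (0 : E → ℂ) :=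
  ⟨contDiff_const, HasCompactSupport.zero, by simp⟩

theorem add (h : IsTest U ψ) (h' : IsTest U ψ') : IsTest U (ψ + ψ') :=
  ⟨h.contDiff.add h'.contDiff, h.hasCompactSupport.add h'.hasCompactSupport,
    (tsupport_add ψ ψ').trans (union_subset h.tsupport_subset h'.tsupport_subset)⟩

theorem const_smul (c : ℂ) (h : IsTest U ψ) : IsTest U (c • ψ) :=
  ⟨h.contDiff.const_smul c, h.hasCompactSupport.mono (Function.support_const_smul_subset c ψ),
    (closure_mono (Function.support_const_smul_subset c ψ)).trans h.tsupport_subset⟩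

theorem differentiable (h : IsTest U ψ) : Differentiable ℝ ψ :=
  h.contDiff.differentiable (by simp)

/-- Test functions on an open set are total in `L²`. -/
theorem eq_zero_of_inner [FiniteDimensional ℝ E] [MeasurableSpace E] [BorelSpace E]
    {μ : Measure E} (hU : IsOpen U) (f : Lp ℂ 2 (μ.restrict U)) [IsFiniteMeasureOnCompacts μ]
    (hf : ∀ ψ, IsTest U ψ → ∀ a : Lp ℂ 2 (μ.restrict U), a =ᵐ[μ.restrict U] ψ → ⟪a, f⟫_ℂ = 0) :
    f = 0 := by
  have hloc : LocallyIntegrable f (μ.restrict U) := (Lp.memLp f).locallyIntegrable (by norm_num)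
  have key : ∀ᵐ x ∂(μ.restrict U), f x = 0 := by
    have h := hU.ae_eq_zero_of_integral_contDiff_smul_eq_zero (μ := μ) (f := f)
      (locallyIntegrableOn_of_locallyIntegrable_restrict hloc) (fun g hg hgc hgs => by
        let ψ : E → ℂ := fun x => (g x : ℂ)
        have hsupp : Function.support ψ = Function.support g := by
          ext x; simp [ψ]
        have hψ : IsTest U ψ :=
          ⟨ofRealCLM.contDiff.comp hg, by
            unfold HasCompactSupport tsupport; rw [hsupp]; exact hgc, by
            unfold tsupport; rw [hsupp]; exact hgs⟩
        have hm : MemLp ψ 2 (μ.restrict U) :=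
          hψ.contDiff.continuous.memLp_of_hasCompactSupport hψ.hasCompactSupport
        have h0 := hf ψ hψ (hm.toLp ψ) hm.coeFn_toLp
        rw [L2.inner_def] at h0
        have h1 : ∫ x, g x • f x ∂(μ.restrict U) = 0 := by
          rw [← h0]
          refine integral_congr_ae ?_
          filter_upwards [hm.coeFn_toLp] with x hx
          simp [hx, ψ, mul_comm]
        rw [setIntegral_eq_integral_of_forall_compl_eq_zero] at h1
        · exact h1
        · intro x hx
          have : g x = 0 := by
            by_contra hne
            exact hx (hgs (subset_tsupport g hne))
          simp [this])
    exact (ae_restrict_iff' hU.measurableSet).2 h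
  exact (Lp.eq_zero_iff_ae_eq_zero).2 key

end IsTest

theorem isOpen_halfPlane : IsOpen halfPlane := isOpen_lt continuous_const continuous_fst

/-! ### The Hamiltonian and the current on the half-plane -/

/-- `∂ₓ ψ`. -/
def dx (ψ : ℝ × ℝ → ℂ) (p : ℝ × ℝ) : ℂ := fderiv ℝ ψ p (1, 0)

/-- `(-i ∂_y - x) ψ`. -/
def kin (ψ : ℝ × ℝ → ℂ) (p : ℝ × ℝ) : ℂ := -I * fderiv ℝ ψ p (0, 1) - (p.1 : ℂ) * ψ p

/-- The graph of `ψ ↦ (∂ₓ ψ, (-i ∂_y - x) ψ)` on `C₀^∞(Ω)`. -/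
def planeCore : Submodule ℂ (L2Plane × WithLp 2 (L2Plane × L2Plane)) where
  carrier := {p | ∃ ψ : ℝ × ℝ → ℂ, IsTest halfPlane ψ ∧
    p.1 =ᵐ[volume.restrict halfPlane] ψ ∧
    p.2.fst =ᵐ[volume.restrict halfPlane] dx ψ ∧
    p.2.snd =ᵐ[volume.restrict halfPlane] kin ψ}
  add_mem' := by
    rintro p p' ⟨ψ, hψ, h1, h2, h3⟩ ⟨ψ', hψ', h1', h2', h3'⟩
    refine ⟨ψ + ψ', hψ.add hψ', ?_, ?_, ?_⟩
    · exact (Lp.coeFn_add _ _).trans (h1.add h1')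
    · filter_upwards [Lp.coeFn_add p.2.fst p'.2.fst, h2, h2'] with x e e1 e2
      simp only [Prod.snd_add, WithLp.add_fst, e, Pi.add_apply, e1, e2, dx,
        fderiv_add (hψ.differentiable x) (hψ'.differentiable x), add_apply]
    · filter_upwards [Lp.coeFn_add p.2.snd p'.2.snd, h3, h3'] with x e e1 e2
      simp only [Prod.snd_add, WithLp.add_snd, e, Pi.add_apply, e1, e2, kin,
        fderiv_add (hψ.differentiable x) (hψ'.differentiable x), add_apply]
      ring
  zero_mem' := by
    refine ⟨0, IsTest.zero, ?_, ?_, ?_⟩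
    · exact Lp.coeFn_zero _ _ _
    · refine (Lp.coeFn_zero _ _ _).trans (Filter.Eventually.of_forall fun x => ?_)
      simp [dx]
    · refine (Lp.coeFn_zero _ _ _).trans (Filter.Eventually.of_forall fun x => ?_)
      simp [kin]
  smul_mem' := by
    rintro c p ⟨ψ, hψ, h1, h2, h3⟩
    refine ⟨c • ψ, hψ.const_smul c, ?_, ?_, ?_⟩
    · exact (Lp.coeFn_smul _ _).trans (h1.const_smul c)
    · filter_upwards [Lp.coeFn_smul c p.2.fst, h2] with x e e1
      simp only [Prod.smul_snd, WithLp.smul_fst, e, Pi.smul_apply, e1, dx,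
        fderiv_const_smul (hψ.differentiable x), smul_apply]
    · filter_upwards [Lp.coeFn_smul c p.2.snd, h3] with x e e1
      simp only [Prod.smul_snd, WithLp.smul_snd, e, Pi.smul_apply, e1, kin,
        fderiv_const_smul (hψ.differentiable x), smul_apply, smul_eq_mul]
      ring

/-- The Dirichlet Hamiltonian `H = -∂ₓ² + (-i ∂_y - x)²` in `L²(Ω)`. -/
def hamiltonian : L2Plane →ₗ.[ℂ] L2Plane := formOperator planeCore

/-- The graph of `φ ↦ (-i ∂_y - x) φ`, taken in the sense of distributions on `Ω`, on its
maximal domain in `L²(Ω)`. -/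
def kinGraph : Submodule ℂ (L2Plane × L2Plane) where
  carrier := {p | ∀ ψ, IsTest halfPlane ψ → ∀ a b : L2Plane,
    a =ᵐ[volume.restrict halfPlane] ψ → b =ᵐ[volume.restrict halfPlane] kin ψ →
    ⟪a, p.2⟫_ℂ = ⟪b, p.1⟫_ℂ}
  add_mem' := by
    intro p p' h h' ψ hψ a b ha hb
    simp only [Prod.fst_add, Prod.snd_add, inner_add_right, h ψ hψ a b ha hb, h' ψ hψ a b ha hb]
  zero_mem' := by intro ψ hψ a b ha hb; simp
  smul_mem' := by
    intro c p h ψ hψ a b ha hb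
    simp only [Prod.smul_fst, Prod.smul_snd, inner_smul_right, h ψ hψ a b ha hb]

/-- The current operator `J_y = -i [H, y] = -2 (-i ∂_y - x)`. -/
def currentOperator : L2Plane →ₗ.[ℂ] L2Plane := (-2 : ℂ) • kinGraph.toLinearPMap

/-- The commutator behind the formula for the current: since multiplication by `y` commutes with
`∂ₓ`, `[H, y]` is the commutator of `(-i ∂_y - x)²` with `y`, and `-i [H, y] = -2 (-i ∂_y - x)`. -/
theorem commutator_eq {ψ : ℝ × ℝ → ℂ} (hψ : IsTest halfPlane ψ) (p : ℝ × ℝ) :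
    -I * (kin (kin (fun q => (q.2 : ℂ) * ψ q)) p - (p.2 : ℂ) * kin (kin ψ) p)
      = -2 * kin ψ p := by
  have hy : ∀ q : ℝ × ℝ,
      HasFDerivAt (fun q : ℝ × ℝ => (q.2 : ℂ)) (ofRealCLM.comp (.snd ℝ ℝ ℝ)) q := fun q =>
    (ofRealCLM.comp (.snd ℝ ℝ ℝ)).hasFDerivAt
  have step : ∀ χ : ℝ × ℝ → ℂ, Differentiable ℝ χ →
      kin (fun q => (q.2 : ℂ) * χ q) = fun q => (q.2 : ℂ) * kin χ q + -I * χ q := by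
    intro χ hχ
    funext q
    have h3 : fderiv ℝ (fun q : ℝ × ℝ => (q.2 : ℂ) * χ q) q = _ :=
      ((hy q).mul (hχ q).hasFDerivAt).fderiv
    simp only [kin, h3]
    simp
    ring
  have hd : Differentiable ℝ ψ := hψ.differentiable
  have hk : Differentiable ℝ (kin ψ) := by
    have h1 : Differentiable ℝ (fun q => fderiv ℝ ψ q) :=
      (hψ.contDiff.fderiv_right (m := 1) (by norm_cast)).differentiable (by simp)
    have h2 : Differentiable ℝ (fun q : ℝ × ℝ => (q.1 : ℂ)) :=
      (ofRealCLM.comp (.fst ℝ ℝ ℝ)).differentiable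
    unfold kin
    fun_prop
  have hyk : Differentiable ℝ (fun q : ℝ × ℝ => (q.2 : ℂ) * kin ψ q) := fun q =>
    ((hy q).differentiableAt).mul (hk q)
  have hadd : kin (fun q => (q.2 : ℂ) * kin ψ q + -I * ψ q) p =
      kin (fun q => (q.2 : ℂ) * kin ψ q) p + -I * kin ψ p := by
    have h3 : fderiv ℝ (fun q : ℝ × ℝ => (q.2 : ℂ) * kin ψ q + -I * ψ q) p = _ :=
      (((hyk p).hasFDerivAt).add ((hd p).hasFDerivAt.const_mul (-I))).fderiv
    have h4 : ∀ χ : ℝ × ℝ → ℂ,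
        kin χ p = -I * fderiv ℝ χ p (0, 1) - (p.1 : ℂ) * χ p := fun _ => rfl
    rw [h4, h4 (fun q => (q.2 : ℂ) * kin ψ q), h3, h4 ψ]
    simp
    ring
  rw [step ψ hd, hadd, step _ hk]
  linear_combination (2 * kin ψ p) * I_mul_I

/-! ### The fiber operators and the Fourier decomposition -/

/-- The graph of `u ↦ (u', (x - k) u)` on `C₀^∞(0, ∞)`. -/
def fiberCore (k : ℝ) : Submodule ℂ (L2HalfLine × WithLp 2 (L2HalfLine × L2HalfLine)) where
  carrier := {p | ∃ ψ : ℝ → ℂ, IsTest (Ioi 0) ψ ∧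
    p.1 =ᵐ[volume.restrict (Ioi 0)] ψ ∧
    p.2.fst =ᵐ[volume.restrict (Ioi 0)] deriv ψ ∧
    p.2.snd =ᵐ[volume.restrict (Ioi 0)] fun x => ((x - k : ℝ) : ℂ) * ψ x}
  add_mem' := by
    rintro p p' ⟨ψ, hψ, h1, h2, h3⟩ ⟨ψ', hψ', h1', h2', h3'⟩
    refine ⟨ψ + ψ', hψ.add hψ', ?_, ?_, ?_⟩
    · exact (Lp.coeFn_add _ _).trans (h1.add h1')
    · filter_upwards [Lp.coeFn_add p.2.fst p'.2.fst, h2, h2'] with x e e1 e2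
      simp only [Prod.snd_add, WithLp.add_fst, e, Pi.add_apply, e1, e2,
        deriv_add (hψ.differentiable x) (hψ'.differentiable x)]
    · filter_upwards [Lp.coeFn_add p.2.snd p'.2.snd, h3, h3'] with x e e1 e2
      simp only [Prod.snd_add, WithLp.add_snd, e, Pi.add_apply, e1, e2]
      ring
  zero_mem' := by
    refine ⟨0, IsTest.zero, ?_, ?_, ?_⟩
    · exact Lp.coeFn_zero _ _ _
    · refine (Lp.coeFn_zero _ _ _).trans (Filter.Eventually.of_forall fun x => ?_)
      simp
    · refine (Lp.coeFn_zero _ _ _).trans (Filter.Eventually.of_forall fun x => ?_)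
      simp
  smul_mem' := by
    rintro c p ⟨ψ, hψ, h1, h2, h3⟩
    refine ⟨c • ψ, hψ.const_smul c, ?_, ?_, ?_⟩
    · exact (Lp.coeFn_smul _ _).trans (h1.const_smul c)
    · filter_upwards [Lp.coeFn_smul c p.2.fst, h2] with x e e1
      simp only [Prod.smul_snd, WithLp.smul_fst, e, Pi.smul_apply, e1,
        deriv_const_smul _ (hψ.differentiable x)]
    · filter_upwards [Lp.coeFn_smul c p.2.snd, h3] with x e e1
      simp only [Prod.smul_snd, WithLp.smul_snd, e, Pi.smul_apply, e1, smul_eq_mul]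
      ring

/-- The fiber operator `h(k) = -∂ₓ² + (x - k)²` in `L²(0, ∞)` with Dirichlet condition
at `x = 0`. -/
def fiberOperator (k : ℝ) : L2HalfLine →ₗ.[ℂ] L2HalfLine := formOperator (fiberCore k)

/-- The band function `λ_m(k)`: the `m`-th eigenvalue of `h(k)`, `m ≥ 1`. -/
def bandFunction (m : ℕ) (k : ℝ) : ℝ := nthEigenvalue (fiberOperator k) m

/-- `u m k` is, for all `m ≥ 1` and `k`, a normalized eigenfunction of `h(k)` associated
with `λ_m(k)`. -/
def IsEigenfunctionFamily (u : ℕ → ℝ → L2HalfLine) : Prop :=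
  ∀ m, 1 ≤ m → ∀ k, IsNormalizedEigenvector (fiberOperator k) (bandFunction m k) (u m k)

/-- The graph of the partial Fourier transform on `C₀^∞(Ω)`:
`(x, k) ↦ (2π)^(-1/2) ∫ e^(-i k y) ψ(x, y) dy`. -/
def partialFourierCore : Set (L2Plane × L2Plane) :=
  {p | ∃ ψ : ℝ × ℝ → ℂ, IsTest halfPlane ψ ∧
    p.1 =ᵐ[volume.restrict halfPlane] ψ ∧
    p.2 =ᵐ[volume.restrict halfPlane] fun q =>
      ((Real.sqrt (2 * Real.pi))⁻¹ : ℂ) * ∫ y : ℝ, exp (-I * (q.2 : ℂ) * (y : ℂ)) * ψ (q.1, y)}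

/-- `φhat = F_y φ`: the partial Fourier transform in `y`, extended by continuity from `C₀^∞(Ω)`
to `L²(Ω)`. -/
def IsPartialFourierTransform (φ φhat : L2Plane) : Prop :=
  (φ, φhat) ∈ closure partialFourierCore

/-- `⟨φhat(·, k), v⟩` in `L²(0, ∞)`, linear in the first entry; the generalized Fourier coefficient
`φ_m(k)` is the case `φhat = F_y φ`, `v = u_m(·, k)`. -/
def fourierCoeff (φhat : L2Plane) (v : L2HalfLine) (k : ℝ) : ℂ :=
  ∫ x in Ioi (0 : ℝ), φhat (x, k) * (starRingEnd ℂ) (v x)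

/-- The Landau level `E_n = 2 n - 1`. -/
def landauLevel (n : ℕ) : ℝ := 2 * n - 1

/-- The bulk space: states with energy in `(E_n, E_n + δ)` all of whose generalized Fourier
coefficients vanish, except for the `n`-th one. -/
def bulkSpace (u : ℕ → ℝ → L2HalfLine) (n : ℕ) (δ : ℝ) : Set L2Plane :=
  {φ | EnergyConcentrated hamiltonian (Ioo (landauLevel n) (landauLevel n + δ)) φ ∧
    ∃ φhat, IsPartialFourierTransform φ φhat ∧
      ∀ m, 1 ≤ m → m ≠ n → ∀ᵐ k : ℝ, fourierCoeff φhat (u m k) k = 0}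

/-! ### The relations used above are graphs of operators -/

theorem hamiltonian_graph : hamiltonian.graph = formGraph planeCore := by
  refine Submodule.toLinearPMap_graph_eq _ (formGraph_single_valued _ fun f hf => ?_)
  refine IsTest.eq_zero_of_inner isOpen_halfPlane f fun ψ hψ a ha => ?_
  have h1 : MemLp (dx ψ) 2 (volume.restrict halfPlane) := by
    refine Continuous.memLp_of_hasCompactSupport ?_ ?_
    · exact (hψ.contDiff.continuous_fderiv (by simp)).clm_apply continuous_const
    · exact hψ.hasCompactSupport.fderiv_apply ℝ (1, 0)
  have h2 : MemLp (kin ψ) 2 (volume.restrict halfPlane) := by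
    refine Continuous.memLp_of_hasCompactSupport ?_ ?_
    · have := (hψ.contDiff.continuous_fderiv (by simp)).clm_apply
        (continuous_const (y := ((0 : ℝ), (1 : ℝ))))
      have := hψ.contDiff.continuous
      unfold kin
      fun_prop
    · exact ((hψ.hasCompactSupport.fderiv_apply ℝ (0, 1)).mul_left (f := fun _ => -I)).sub
        (hψ.hasCompactSupport.mul_left (f := fun p : ℝ × ℝ => (p.1 : ℂ)))
  exact hf (a, WithLp.toLp 2 (h1.toLp _, h2.toLp _))
    ⟨ψ, hψ, ha, h1.coeFn_toLp, h2.coeFn_toLp⟩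

theorem fiberOperator_graph (k : ℝ) : (fiberOperator k).graph = formGraph (fiberCore k) := by
  refine Submodule.toLinearPMap_graph_eq _ (formGraph_single_valued _ fun f hf => ?_)
  refine IsTest.eq_zero_of_inner isOpen_Ioi f fun ψ hψ a ha => ?_
  have h1 : MemLp (deriv ψ) 2 (volume.restrict (Ioi (0 : ℝ))) :=
    (hψ.contDiff.continuous_deriv (by simp)).memLp_of_hasCompactSupport hψ.hasCompactSupport.deriv
  have h2 : MemLp (fun x => ((x - k : ℝ) : ℂ) * ψ x) 2 (volume.restrict (Ioi (0 : ℝ))) := by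
    refine Continuous.memLp_of_hasCompactSupport ?_ ?_
    · have := hψ.contDiff.continuous
      fun_prop
    · exact hψ.hasCompactSupport.mul_left (f := fun x : ℝ => ((x - k : ℝ) : ℂ))
  exact hf (a, WithLp.toLp 2 (h1.toLp _, h2.toLp _))
    ⟨ψ, hψ, ha, h1.coeFn_toLp, h2.coeFn_toLp⟩

theorem kinGraph_toLinearPMap_graph : kinGraph.toLinearPMap.graph = kinGraph := by
  refine Submodule.toLinearPMap_graph_eq _ ?_
  rintro ⟨φ, g⟩ h hφ
  simp only at hφ
  subst hφ
  refine IsTest.eq_zero_of_inner isOpen_halfPlane g fun ψ hψ a ha => ?_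
  have h2 : MemLp (kin ψ) 2 (volume.restrict halfPlane) := by
    refine Continuous.memLp_of_hasCompactSupport ?_ ?_
    · have := (hψ.contDiff.continuous_fderiv (by simp)).clm_apply
        (continuous_const (y := ((0 : ℝ), (1 : ℝ))))
      have := hψ.contDiff.continuous
      unfold kin
      fun_prop
    · exact ((hψ.hasCompactSupport.fderiv_apply ℝ (0, 1)).mul_left (f := fun _ => -I)).sub
        (hψ.hasCompactSupport.mul_left (f := fun p : ℝ × ℝ => (p.1 : ℂ)))
  simpa using h ψ hψ a (h2.toLp _) ha h2.coeFn_toLp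

end HalfPlaneHall

end

/-!
The partial Fourier transform in `y` turns the closed form of `H` into the direct integral of the
closed forms of the fiber operators `h(k)` (`exists_fiber_decomposition`), and
`-i ∂_y - x` into multiplication by `k - x`. A state `φ` of the bulk space has a transform whose
slices are `φhat(·, k) = c(k) u_n(·, k)`, because the eigenfunctions of `h(k)` are complete
(`IsEigenfunctionFamily.eq_smul_of_inner`). Hence `⟨φ, J_y φ⟩` is the integral of `|c(k)|²` times the
current `2 ∫ (x - k) |u_n(x, k)|² dx` of the fiber, whereas the energy condition says that the
integral of `|c(k)|² (λ_n(k) - E_n)` is at most `δ ‖φ‖²`. If the current of the fiber is at most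
`A + B (λ_n(k) - E_n)` for all `k`, it follows that the current of `φ` is at most
`(A + B δ) ‖φ‖²` (`IsEigenfunctionFamily.exists_norm_inner_currentOperator_le`). It remains to find
such `A` and `B` with `A + B δ = 2 δ √|log δ|` up to the error term
(`IsEigenfunctionFamily.exists_fiberCurrent_le_add`).

The current of the fiber is bounded as follows. By the Feynman-Hellmann identity it equals
`|u_n'(0, k)|²`. Green's formula between `u_n` and the normalized eigenfunction `ψ` of the
oscillator on the whole line with energy `E_n` reads
`u_n'(0, k) ψ(0) = (λ_n(k) - E_n) ∫_0^∞ u_n ψ`, so that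
`current · ψ(0)² ≤ (λ_n(k) - E_n)²` (`IsEigenfunctionFamily.fiberCurrent_bounds`). In the opposite
direction, the trial functions `ψ_j - ψ_j(0) e^(-k x)`, `j < n`, built from the Hermite functions
`ψ_j`, give `λ_n(k) - E_n ≤ (2 k + O(1 / k)) ψ(0)²` as `k → ∞` (`eventually_formBound`). Together,
the current is at most `(2 k + O(1 / k)) (λ_n(k) - E_n)`, and also at most a power of `k` times
`e^(-k²)`. The first bound is used for `k² ≤ |log δ| + O(log |log δ|)`, where the factor `2 k` is
`2 √|log δ|` up to the error term, and the second one beyond this threshold, where it is absorbed by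
the error term. For `k` bounded from above, `λ_n(k) - E_n` is bounded from below by monotonicity of
`λ_n`, and the current is at most `1 + λ_n(k)`.

The spectral theory of `h(k)` rests on the min-max principle for the operator of a closed form with
compactly embedded domain (`exists_eigenvectors_of_form_le`, `eq_zero_of_inner_eigenvector`).
Compactness and the bound `λ_n(k) ≥ E_n` both come from the gap of the oscillator: a test function
orthogonal to `m` explicit functions has energy at least `2 m + 1` (`oscillator_gap`), by induction
along the ladder of creation operators. Eigenvectors are classical solutions by elliptic regularity
in one dimension (`exists_isDirichletSolution`), so the eigenvalues are simple.
-/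

open MeasureTheory Set Complex
open scoped InnerProductSpace ContDiff ENNReal

noncomputable section

namespace HalfPlaneHall

/-! ### The operator of a closed form: resolvent and min-max principle -/

section FormOperator

variable {X Y : Type*} [NormedAddCommGroup X] [InnerProductSpace ℂ X]
  [NormedAddCommGroup Y] [InnerProductSpace ℂ Y]

/-- The domain of the closed form `‖T ·‖²`, where `G` is the graph of `T`, realised as the closure
of the graph in the Hilbert sum `X ⊕ Y`; thus it carries the form norm. -/
def formDomain (G : Submodule ℂ (X × Y)) : Submodule ℂ (WithLp 2 (X × Y)) :=
  G.topologicalClosure.comap (WithLp.linearEquiv 2 ℂ (X × Y)).toLinearMap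

theorem mem_formDomain {G : Submodule ℂ (X × Y)} {z : WithLp 2 (X × Y)} :
    z ∈ formDomain G ↔ (z.fst, z.snd) ∈ G.topologicalClosure := Iff.rfl

theorem isClosed_formDomain (G : Submodule ℂ (X × Y)) :
    IsClosed (formDomain G : Set (WithLp 2 (X × Y))) :=
  G.isClosed_topologicalClosure.preimage (WithLp.prod_continuous_ofLp 2 X Y)

/-- The embedding of the form domain into the underlying Hilbert space. -/
def formEmbedding (G : Submodule ℂ (X × Y)) : formDomain G →L[ℂ] X :=
  (WithLp.fstL 2 ℂ X Y) ∘L (formDomain G).subtypeL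

@[simp] theorem formEmbedding_apply (G : Submodule ℂ (X × Y)) (z : formDomain G) :
    formEmbedding G z = (z : WithLp 2 (X × Y)).fst := rfl

/-- The defining relation of `formGraph` extends from the form core to the form domain. -/
theorem inner_eq_of_mem_topologicalClosure {G : Submodule ℂ (X × Y)} {g : Y} {f : X}
    (h : ∀ q ∈ G, ⟪q.2, g⟫_ℂ = ⟪q.1, f⟫_ℂ) {q : X × Y} (hq : q ∈ G.topologicalClosure) :
    ⟪q.2, g⟫_ℂ = ⟪q.1, f⟫_ℂ := by
  have hclosed : IsClosed {q : X × Y | ⟪q.2, g⟫_ℂ = ⟪q.1, f⟫_ℂ} :=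
    isClosed_eq (by fun_prop) (by fun_prop)
  exact closure_minimal (fun q hq => h q hq) hclosed hq

theorem isNormalizedEigenvector_iff {G : Submodule ℂ (X × Y)}
    (hG : (formOperator G).graph = formGraph G) {t : ℝ} {u : X} :
    IsNormalizedEigenvector (formOperator G) t u ↔
      ‖u‖ = 1 ∧ (u, (t : ℂ) • u) ∈ formGraph G := by
  rw [IsNormalizedEigenvector, ← hG, LinearPMap.mem_graph_iff]
  refine and_congr_right fun _ => ⟨fun ⟨h, e⟩ => ⟨⟨u, h⟩, rfl, e⟩, ?_⟩
  rintro ⟨⟨v, hv⟩, e1, e2⟩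
  simp only at e1 e2
  subst e1
  exact ⟨hv, e2⟩

variable [CompleteSpace X] [CompleteSpace Y]

instance (G : Submodule ℂ (X × Y)) : CompleteSpace (formDomain G) :=
  (isClosed_formDomain G).completeSpace_coe

/-- The resolvent `(A + 1)⁻¹` of the operator `A` of the closed form. With `j` the embedding of
the form domain, Riesz' representation theorem says that it is `j j*`. -/
def formResolvent (G : Submodule ℂ (X × Y)) : X →L[ℂ] X :=
  formEmbedding G ∘L (formEmbedding G).adjoint

theorem inner_adjoint_formEmbedding (G : Submodule ℂ (X × Y)) (z : formDomain G) (f : X) :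
    ⟪(z : WithLp 2 (X × Y)).fst, (((formEmbedding G).adjoint f : formDomain G) :
        WithLp 2 (X × Y)).fst⟫_ℂ
      + ⟪(z : WithLp 2 (X × Y)).snd, (((formEmbedding G).adjoint f : formDomain G) :
        WithLp 2 (X × Y)).snd⟫_ℂ = ⟪(z : WithLp 2 (X × Y)).fst, f⟫_ℂ := by
  have h : ⟪z, (formEmbedding G).adjoint f⟫_ℂ = ⟪formEmbedding G z, f⟫_ℂ :=
    ContinuousLinearMap.adjoint_inner_right _ _ _
  rw [Submodule.coe_inner, WithLp.prod_inner_apply] at h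
  exact h

theorem mem_formGraph_iff {G : Submodule ℂ (X × Y)} {φ f : X} :
    (φ, f) ∈ formGraph G ↔ formResolvent G (φ + f) = φ := by
  constructor
  · rintro ⟨g, hg, h⟩
    let z : formDomain G := ⟨WithLp.toLp 2 (φ, g), hg⟩
    have hz : (formEmbedding G).adjoint (φ + f) = z := by
      refine ext_inner_left ℂ fun w => ?_
      rw [ContinuousLinearMap.adjoint_inner_right, Submodule.coe_inner, WithLp.prod_inner_apply,
        formEmbedding_apply, inner_add_right]
      have := inner_eq_of_mem_topologicalClosure h (mem_formDomain.1 w.2)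
      simp only at this
      rw [← this]
      rfl
    change formEmbedding G ((formEmbedding G).adjoint (φ + f)) = φ
    rw [hz]
    rfl
  · intro h
    have h1 : (((formEmbedding G).adjoint (φ + f) : formDomain G) : WithLp 2 (X × Y)).fst = φ := h
    refine ⟨(((formEmbedding G).adjoint (φ + f) : formDomain G) : WithLp 2 (X × Y)).snd, ?_, ?_⟩
    · have := ((formEmbedding G).adjoint (φ + f)).2
      rw [mem_formDomain, h1] at this
      exact this
    · intro q hq
      have := inner_adjoint_formEmbedding G
        ⟨WithLp.toLp 2 q, G.le_topologicalClosure hq⟩ (φ + f)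
      rw [h1, inner_add_right] at this
      exact add_left_cancel this

theorem formResolvent_apply_of_eigenvector {G : Submodule ℂ (X × Y)} {t : ℝ} {u : X} :
    (u, (t : ℂ) • u) ∈ formGraph G ↔ ((1 + t : ℝ) : ℂ) • formResolvent G u = u := by
  rw [mem_formGraph_iff, ← map_smul]
  congr! 2
  push_cast
  rw [add_smul, one_smul]

theorem inner_formResolvent_self (G : Submodule ℂ (X × Y)) (w : X) :
    ⟪w, formResolvent G w⟫_ℂ = ((‖(formEmbedding G).adjoint w‖ ^ 2 : ℝ) : ℂ) := by
  change ⟪w, formEmbedding G ((formEmbedding G).adjoint w)⟫_ℂ = _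
  rw [← ContinuousLinearMap.adjoint_inner_left, inner_self_eq_norm_sq_to_K]
  norm_cast

theorem isSymmetric_formResolvent (G : Submodule ℂ (X × Y)) :
    (formResolvent G : X →ₗ[ℂ] X).IsSymmetric := by
  intro x y
  change ⟪formEmbedding G ((formEmbedding G).adjoint x), y⟫_ℂ =
    ⟪x, formEmbedding G ((formEmbedding G).adjoint y)⟫_ℂ
  rw [← ContinuousLinearMap.adjoint_inner_left, ← ContinuousLinearMap.adjoint_inner_right]

theorem isCompactOperator_formResolvent {G : Submodule ℂ (X × Y)}
    (hG : IsCompactOperator (formEmbedding G)) : IsCompactOperator (formResolvent G) :=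
  hG.comp_clm _

theorem exists_real_eigenvalue {G : Submodule ℂ (X × Y)} {μ : ℂ} {e : X} (he : e ≠ 0)
    (h : formResolvent G e = μ • e) : ∃ r : ℝ, 0 ≤ r ∧ μ = r := by
  refine ⟨‖(formEmbedding G).adjoint e‖ ^ 2 / ‖e‖ ^ 2, by positivity, ?_⟩
  have h1 := inner_formResolvent_self G e
  rw [h, inner_smul_right, inner_self_eq_norm_sq_to_K] at h1
  have : (‖e‖ : ℂ) ≠ 0 := by simpa using he
  push_cast at h1 ⊢
  rw [eq_div_iff (pow_ne_zero 2 this)]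
  exact h1

/-- A positive eigenvalue `r` of the resolvent is the eigenvalue `r⁻¹ - 1` of the operator. -/
theorem mem_formGraph_of_formResolvent_eq {G : Submodule ℂ (X × Y)} {r : ℝ} {e : X} (hr : 0 < r)
    (h : formResolvent G e = (r : ℂ) • e) : (e, ((r⁻¹ - 1 : ℝ) : ℂ) • e) ∈ formGraph G := by
  rw [formResolvent_apply_of_eigenvector, h, smul_smul]
  have : (1 + (r⁻¹ - 1)) * r = 1 := by field_simp; ring
  rw [← Complex.ofReal_mul, this]
  simp

/-- On the orthogonal complement of all eigenvectors with eigenvalue above `r`, the compact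
resolvent is bounded by `r`. -/
theorem norm_formResolvent_le {G : Submodule ℂ (X × Y)}
    (hG : IsCompactOperator (formEmbedding G)) {r : ℝ} (hr : 0 < r) {w : X}
    (hw : ∀ e : X, ‖e‖ = 1 → (∃ s : ℝ, r < s ∧ formResolvent G e = (s : ℂ) • e) → ⟪e, w⟫_ℂ = 0) :
    ‖formResolvent G w‖ ≤ r * ‖w‖ := by
  set R := formResolvent G with hR
  let V : Submodule ℂ X := Submodule.span ℂ
    {e | ‖e‖ = 1 ∧ ∃ s : ℝ, r < s ∧ R e = (s : ℂ) • e}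
  have hV : ∀ v, v ∈ Vᗮ ↔ ∀ e ∈ {e | ‖e‖ = 1 ∧ ∃ s : ℝ, r < s ∧ R e = (s : ℂ) • e},
      ⟪e, v⟫_ℂ = 0 := by
    intro v
    rw [Submodule.mem_orthogonal]
    refine ⟨fun h e he => h e (Submodule.subset_span he), fun h e he => ?_⟩
    induction he using Submodule.span_induction with
    | mem x hx => exact h x hx
    | zero => simp
    | add x y _ _ hx hy => rw [inner_add_left, hx, hy, add_zero]
    | smul c x _ hx => rw [inner_smul_left, hx, mul_zero]
  have hinv : ∀ v ∈ Vᗮ, (R : X →ₗ[ℂ] X) v ∈ Vᗮ := by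
    intro v hv
    rw [hV] at hv ⊢
    rintro e he
    have := isSymmetric_formResolvent G e v
    rw [← hR] at this
    obtain ⟨h1, s, hs, h2⟩ := id he
    rw [← this]
    change ⟪R e, v⟫_ℂ = 0
    rw [h2, inner_smul_left, hv e he, mul_zero]
  let S : Vᗮ →L[ℂ] Vᗮ := R.restrict hinv
  have hSc : IsCompactOperator S := (isCompactOperator_formResolvent hG).restrict' hinv
  have hSs : (S : Vᗮ →ₗ[ℂ] Vᗮ).IsSymmetric :=
    (isSymmetric_formResolvent G).restrict_invariant hinv
  have hSn : ‖S‖ ≤ r := by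
    have h1 := S.spectralRadius_eq_nnnorm hSs.isSelfAdjoint
    have h2 : spectralRadius ℂ S ≤ ENNReal.ofReal r := by
      refine iSup₂_le fun μ hμ => ?_
      by_cases h0 : μ = 0
      · simp [h0]
      have he := (hSc.hasEigenvalue_iff_mem_spectrum h0).2 hμ
      obtain ⟨⟨e, heV⟩, he⟩ := he.exists_hasEigenvector
      have he1 : R e = μ • e := congrArg Subtype.val he.apply_eq_smul
      have he0 : e ≠ 0 := fun h => he.2 (by simpa using h)
      obtain ⟨s, hs0, rfl⟩ := exists_real_eigenvalue he0 he1
      have hs : s ≤ r := by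
        by_contra! hlt
        have hen : ‖e‖ ≠ 0 := by simpa using he0
        have := (hV e).1 heV (((‖e‖⁻¹ : ℝ) : ℂ) • e)
          ⟨by rw [norm_smul]; simp [hen], s, hlt, by
            rw [map_smul, he1, smul_comm]⟩
        rw [inner_smul_left, mul_eq_zero, inner_self_eq_zero] at this
        rcases this with h | h
        · simp [he0] at h
        · exact he0 h
      rw [ENNReal.le_ofReal_iff_toReal_le (by simp) hr.le]
      simpa [abs_of_nonneg hs0] using hs
    rw [h1] at h2
    have := ENNReal.toReal_mono (by simp) h2
    simpa [ENNReal.toReal_ofReal hr.le] using this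
  have hwV : w ∈ Vᗮ := (hV w).2 fun e he => hw e he.1 he.2
  have := S.le_of_opNorm_le hSn ⟨w, hwV⟩
  exact this

/-- The **min-max principle**, upper bound: if the form is at most `Λ` on an `n`-dimensional
subspace, then there are `n` independent eigenvectors with eigenvalues essentially at most `Λ`. -/
theorem exists_eigenvectors_of_form_le {G : Submodule ℂ (X × Y)}
    (hgr : (formOperator G).graph = formGraph G)
    (hG : IsCompactOperator (formEmbedding G)) {n : ℕ} {Λ Λ' : ℝ} (h0 : 0 ≤ Λ) (hΛ : Λ < Λ')
    (W : Submodule ℂ (WithLp 2 (X × Y))) (hW : W ≤ formDomain G) [FiniteDimensional ℂ W]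
    (hn : Module.finrank ℂ W = n) (hle : ∀ z ∈ W, ‖z.snd‖ ^ 2 ≤ Λ * ‖z.fst‖ ^ 2) :
    ∃ v : Fin n → X, LinearIndependent ℂ v ∧
      ∀ i, ∃ s ≤ Λ', IsNormalizedEigenvector (formOperator G) s (v i) := by
  set r : ℝ := (1 + Λ')⁻¹ with hr
  have hr0 : 0 < r := by rw [hr]; exact inv_pos.2 (by linarith)
  let S : Set X := {e | ‖e‖ = 1 ∧ ∃ s : ℝ, r < s ∧ formResolvent G e = (s : ℂ) • e}
  have hS : ∀ e ∈ S, ∃ s ≤ Λ', IsNormalizedEigenvector (formOperator G) s e := by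
    rintro e ⟨he, s, hs, h⟩
    refine ⟨s⁻¹ - 1, ?_, (isNormalizedEigenvector_iff hgr).2
      ⟨he, mem_formGraph_of_formResolvent_eq (hr0.trans hs) h⟩⟩
    have : s⁻¹ ≤ r⁻¹ := inv_anti₀ hr0 hs.le
    rw [hr, inv_inv] at this
    linarith
  obtain ⟨b, hbS, hspan, hli⟩ := exists_linearIndependent ℂ S
  by_cases hb : ∃ f : Fin n → b, Function.Injective f
  · obtain ⟨f, hf⟩ := hb
    exact ⟨fun i => f i, hli.comp f hf, fun i => hS _ (hbS (f i).2)⟩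
  exfalso
  have hfin : Finite b := by
    by_contra hinf
    rw [not_finite_iff_infinite] at hinf
    exact hb ⟨fun i => Infinite.natEmbedding b i, fun i j h => by simpa [Fin.ext_iff] using h⟩
  have := Fintype.ofFinite b
  have hcard : Fintype.card b < n := by
    by_contra! hle
    exact hb ⟨fun i => (Fintype.equivFin b).symm (Fin.castLE hle i), fun i j h => by
      simpa using h⟩
  let V := Submodule.span ℂ b
  have hVfin : FiniteDimensional ℂ V := FiniteDimensional.span_of_finite ℂ (Set.toFinite b)
  have hVrank : Module.finrank ℂ V < n := by
    refine lt_of_le_of_lt ?_ hcard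
    have := finrank_span_le_card (R := ℂ) b
    rwa [Set.toFinset_card] at this
  let L : W →ₗ[ℂ] V := V.orthogonalProjectionOnto.toLinearMap ∘ₗ
    (WithLp.fstₗ 2 ℂ X Y) ∘ₗ W.subtype
  obtain ⟨⟨z, hzW⟩, hzk, hz0⟩ := Submodule.exists_mem_ne_zero_of_ne_bot
    (LinearMap.ker_ne_bot_of_finrank_lt (f := L) (hn ▸ hVrank))
  set w := z.fst with hw
  have hwV : w ∈ Vᗮ := by
    have : V.orthogonalProjectionOnto w = 0 := hzk
    rwa [Submodule.orthogonalProjectionOnto_eq_zero_iff] at this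
  have hle' := hle z hzW
  have hw0 : w ≠ 0 := by
    intro h
    rw [← hw, h, norm_zero] at hle'
    have h2 : z.snd = 0 := by
      have : ‖z.snd‖ ^ 2 ≤ 0 := by simpa using hle'
      simpa using le_antisymm this (by positivity)
    apply hz0
    ext
    exact WithLp.ofLp_injective 2 (Prod.ext h h2)
  have hRw := norm_formResolvent_le hG hr0 (w := w) fun e he hs =>
    (Submodule.mem_orthogonal _ _).1 hwV e (by
      change e ∈ Submodule.span ℂ b
      rw [hspan]
      exact Submodule.subset_span ⟨he, hs⟩)
  let zz : formDomain G := ⟨z, hW hzW⟩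
  -- Cauchy-Schwarz in the form domain: `‖w‖² = ⟨z, j* w⟩` with `‖j* w‖² = ⟨w, R w⟩`
  have h1 : ‖w‖ ^ 2 ≤ ‖zz‖ * ‖(formEmbedding G).adjoint w‖ := by
    have := norm_inner_le_norm (𝕜 := ℂ) zz ((formEmbedding G).adjoint w)
    rw [ContinuousLinearMap.adjoint_inner_right] at this
    have h2 : formEmbedding G zz = w := rfl
    rw [h2, inner_self_eq_norm_sq_to_K] at this
    simpa using this
  have h2 : ‖(formEmbedding G).adjoint w‖ ^ 2 ≤ r * ‖w‖ ^ 2 := by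
    have h := inner_formResolvent_self G w
    have h3 := norm_inner_le_norm (𝕜 := ℂ) w (formResolvent G w)
    rw [h, Complex.norm_real, Real.norm_of_nonneg (by positivity)] at h3
    nlinarith [norm_nonneg w]
  have h3 : ‖zz‖ ^ 2 ≤ (1 + Λ) * ‖w‖ ^ 2 := by
    have : ‖zz‖ ^ 2 = ‖z.fst‖ ^ 2 + ‖z.snd‖ ^ 2 := WithLp.prod_norm_sq_eq_of_L2 z
    rw [this]
    linarith
  have hwp : 0 < ‖w‖ ^ 2 := by positivity
  have h4 : (‖w‖ ^ 2) ^ 2 ≤ ((1 + Λ) * ‖w‖ ^ 2) * (r * ‖w‖ ^ 2) := by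
    calc (‖w‖ ^ 2) ^ 2 ≤ (‖zz‖ * ‖(formEmbedding G).adjoint w‖) ^ 2 := by gcongr
      _ = ‖zz‖ ^ 2 * ‖(formEmbedding G).adjoint w‖ ^ 2 := by ring
      _ ≤ _ := by gcongr
  have h5 : (1 + Λ) * r < 1 := by
    rw [hr, ← div_eq_mul_inv, div_lt_one (by linarith)]
    linarith
  nlinarith [mul_pos hwp hwp]

/-- The eigenvectors of the operator of a form with compact embedding are total. -/
theorem eq_zero_of_inner_eigenvector {G : Submodule ℂ (X × Y)}
    (hd : ∀ f : X, (∀ q ∈ G, ⟪q.1, f⟫_ℂ = 0) → f = 0)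
    (hG : IsCompactOperator (formEmbedding G)) {f : X}
    (hf : ∀ (e : X) (t : ℝ), ‖e‖ = 1 → (e, (t : ℂ) • e) ∈ formGraph G → ⟪e, f⟫_ℂ = 0) :
    f = 0 := by
  have hsp := (formResolvent G).orthogonalComplement_iSup_eigenspaces_eq_bot
    (isCompactOperator_formResolvent hG) (isSymmetric_formResolvent G)
  rw [← Submodule.mem_bot ℂ, ← hsp, ← Submodule.iInf_orthogonal, Submodule.mem_iInf]
  intro μ
  rw [Submodule.mem_orthogonal]
  intro e he
  by_cases he0 : e = 0
  · simp [he0]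
  have he1 : formResolvent G e = μ • e := Module.End.mem_eigenspace_iff.1 he
  obtain ⟨r, hr, rfl⟩ := exists_real_eigenvalue he0 he1
  rcases hr.eq_or_lt with rfl | hr
  · exfalso
    have : (0, e) ∈ formGraph G := by
      rw [mem_formGraph_iff, zero_add, he1]
      simp
    exact he0 (formGraph_single_valued G hd _ this rfl)
  · have hen : ‖e‖ ≠ 0 := by simpa using he0
    have := hf (((‖e‖⁻¹ : ℝ) : ℂ) • e) (r⁻¹ - 1) (by rw [norm_smul]; simp [hen]) (by
      have := (formGraph G).smul_mem ((‖e‖⁻¹ : ℝ) : ℂ) (mem_formGraph_of_formResolvent_eq hr he1)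
      rwa [Prod.smul_mk, smul_comm] at this)
    rw [inner_smul_left, mul_eq_zero] at this
    rcases this with h | h
    · simp [he0] at h
    · exact h

/-- A bounded operator which is small on subspaces of finite codimension is compact. -/
theorem isCompactOperator_of_finite_codim {A B : Type*} [NormedAddCommGroup A]
    [InnerProductSpace ℂ A] [NormedAddCommGroup B] [InnerProductSpace ℂ B] [CompleteSpace B]
    (T : A →L[ℂ] B)
    (h : ∀ η : ℝ, 0 < η → ∃ F : Submodule ℂ A, FiniteDimensional ℂ F ∧
      ∀ z ∈ Fᗮ, ‖T z‖ ≤ η * ‖z‖) :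
    IsCompactOperator T := by
  have key : ∀ η : ℝ, 0 < η → ∃ K : A →L[ℂ] B, IsCompactOperator K ∧ ‖T - K‖ ≤ η := by
    intro η hη
    obtain ⟨F, hF, hv⟩ := h η hη
    refine ⟨T ∘L F.subtypeL ∘L F.orthogonalProjectionOnto, ?_, ?_⟩
    · have : ProperSpace F := FiniteDimensional.proper ℂ F
      have : IsCompactOperator (T ∘L F.subtypeL) :=
        isCompactOperator_of_locallyCompactSpace_rng (T ∘L F.subtypeL)
      exact this.comp_clm F.orthogonalProjectionOnto
    · refine ContinuousLinearMap.opNorm_le_bound _ hη.le fun z => ?_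
      have h1 := hv _ (F.sub_starProjection_mem_orthogonal z)
      have h3 := Fᗮ.norm_starProjection_apply_le z
      rw [Submodule.starProjection_orthogonal_val] at h3
      rw [map_sub] at h1
      exact h1.trans (by gcongr)
  choose K hK hKn using fun m : ℕ => key (1 / (m + 1)) (by positivity)
  refine isCompactOperator_of_tendsto (l := Filter.atTop) (F := K) ?_
    (Filter.Eventually.of_forall hK)
  refine tendsto_iff_norm_sub_tendsto_zero.2 ?_
  refine squeeze_zero (fun _ => norm_nonneg _) (fun m => ?_) tendsto_one_div_add_atTop_nhds_zero_nat
  rw [norm_sub_rev]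
  exact hKn m

/-- A form which is large on the complement of finitely many vectors has a compactly embedded
domain. -/
theorem isCompactOperator_formEmbedding {G : Submodule ℂ (X × Y)}
    (h : ∀ η : ℝ, 0 < η → ∃ (N : ℕ) (v : Fin N → X), ∀ z ∈ formDomain G,
      (∀ i, ⟪v i, z.fst⟫_ℂ = 0) → ‖z.fst‖ ≤ η * ‖z‖) :
    IsCompactOperator (formEmbedding G) := by
  refine isCompactOperator_of_finite_codim _ fun η hη => ?_
  obtain ⟨N, v, hv⟩ := h η hη
  refine ⟨Submodule.span ℂ (Set.range fun i => (formEmbedding G).adjoint (v i)),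
    FiniteDimensional.span_of_finite ℂ (Set.finite_range _), fun z hz => ?_⟩
  refine hv z z.2 fun i => ?_
  have := (Submodule.mem_orthogonal _ _).1 hz _ (Submodule.subset_span ⟨i, rfl⟩)
  rwa [ContinuousLinearMap.adjoint_inner_left] at this

end FormOperator

/-! ### Test functions on intervals -/

namespace IsTest

variable {U : Set ℝ} {ψ g : ℝ → ℂ}

theorem continuous {E : Type*} [NormedAddCommGroup E] [NormedSpace ℝ E] {U : Set E} {ψ : E → ℂ}
    (h : IsTest U ψ) : Continuous ψ := h.contDiff.continuous

theorem continuous_deriv (h : IsTest U ψ) : Continuous (deriv ψ) :=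
  h.contDiff.continuous_deriv (by simp)

theorem hasDerivAt (h : IsTest U ψ) (x : ℝ) : HasDerivAt ψ (deriv ψ x) x :=
  (h.differentiable x).hasDerivAt

theorem mono {E : Type*} [NormedAddCommGroup E] [NormedSpace ℝ E] {U V : Set E} {ψ : E → ℂ}
    (hUV : U ⊆ V) (h : IsTest U ψ) : IsTest V ψ :=
  ⟨h.contDiff, h.hasCompactSupport, h.tsupport_subset.trans hUV⟩

theorem mul_left {E : Type*} [NormedAddCommGroup E] [NormedSpace ℝ E] {U : Set E} {ψ : E → ℂ}
    (h : IsTest U ψ) {c : E → ℂ} (hc : ContDiff ℝ ∞ c) : IsTest U (fun x => c x * ψ x) :=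
  ⟨hc.mul h.contDiff, h.hasCompactSupport.mul_left,
    (tsupport_mul_subset_right (f := c) (g := ψ)).trans h.tsupport_subset⟩

theorem deriv (h : IsTest U ψ) : IsTest U (deriv ψ) :=
  ⟨(contDiff_infty_iff_deriv.1 h.contDiff).2, h.hasCompactSupport.deriv,
    tsupport_deriv_subset.trans h.tsupport_subset⟩

theorem eq_zero_of_notMem {E : Type*} [NormedAddCommGroup E] [NormedSpace ℝ E] {U : Set E}
    {ψ : E → ℂ} (h : IsTest U ψ) {x : E} (hx : x ∉ U) : ψ x = 0 := by
  by_contra h0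
  exact hx (h.tsupport_subset (subset_tsupport ψ h0))

/-- A test function with vanishing integral has a primitive which is a test function. -/
theorem exists_primitive (hU : U.OrdConnected) (hg : IsTest U g) (h0 : ∫ x, g x = 0) :
    ∃ P, IsTest U P ∧ ∀ x, HasDerivAt P (g x) x := by
  by_cases hne : (tsupport g).Nonempty
  swap
  · have hz : g = 0 := tsupport_eq_empty_iff.1 (Set.not_nonempty_iff_eq_empty.1 hne)
    exact ⟨0, IsTest.zero, fun x => by simp [hz]⟩
  have hK : IsCompact (tsupport g) := hg.hasCompactSupport
  set a := sInf (tsupport g)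
  set b := sSup (tsupport g)
  have ha : a ∈ tsupport g := hK.sInf_mem hne
  have hb : b ∈ tsupport g := hK.sSup_mem hne
  have hsub : Icc a b ⊆ U := hU.out (hg.tsupport_subset ha) (hg.tsupport_subset hb)
  have hout : ∀ x, x ∉ Icc a b → g x = 0 := by
    intro x hx
    by_contra h
    have hx' : x ∈ tsupport g := subset_tsupport g h
    exact hx ⟨csInf_le hK.bddBelow hx', le_csSup hK.bddAbove hx'⟩
  have hd : ∀ x, HasDerivAt (fun x => ∫ t in a..x, g t) (g x) x := fun x =>
    intervalIntegral.integral_hasDerivAt_right (hg.continuous.intervalIntegrable _ _)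
      (hg.continuous.stronglyMeasurableAtFilter _ _) hg.continuous.continuousAt
  have hsupp : Function.support (fun x => ∫ t in a..x, g t) ⊆ Icc a b := by
    intro x hx
    by_contra hxn
    apply hx
    rcases not_and_or.1 hxn with h | h
    · push Not at h
      change ∫ t in a..x, g t = 0
      rw [intervalIntegral.integral_symm, intervalIntegral.integral_of_le h.le,
        integral_Ioc_eq_integral_Ioo, setIntegral_eq_zero_of_forall_eq_zero, neg_zero]
      exact fun t ht => hout t fun h' => absurd h'.1 (not_le.2 ht.2)
    · push Not at h
      have hab : a ≤ b := csInf_le_csSup hne hK.bddBelow hK.bddAbove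
      change ∫ t in a..x, g t = 0
      rw [intervalIntegral.integral_of_le (hab.trans h.le), ← integral_Icc_eq_integral_Ioc,
        setIntegral_eq_integral_of_forall_compl_eq_zero, h0]
      exact fun t ht => hout t fun h' => ht ⟨h'.1, h'.2.trans h.le⟩
  have hts : tsupport (fun x => ∫ t in a..x, g t) ⊆ Icc a b :=
    closure_minimal hsupp isClosed_Icc
  refine ⟨_, ⟨?_, ?_, hts.trans hsub⟩, hd⟩
  · rw [contDiff_infty_iff_deriv]
    refine ⟨fun x => (hd x).differentiableAt, ?_⟩
    have : _root_.deriv (fun x => ∫ t in a..x, g t) = g := funext fun x => (hd x).deriv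
    rw [this]
    exact hg.contDiff
  · exact isCompact_Icc.of_isClosed_subset isClosed_closure hts

end IsTest

/-! ### The spectral gap of the harmonic oscillator -/

/-- The Gaussian `e^(-(x - k)² / 2)`, the ground state of the oscillator centred at `k`. -/
def gauss (k x : ℝ) : ℝ := Real.exp (-(x - k) ^ 2 / 2)

theorem hasDerivAt_gauss (k x : ℝ) : HasDerivAt (gauss k) (-(x - k) * gauss k x) x := by
  have h : HasDerivAt (fun x : ℝ => -(x - k) ^ 2 / 2) (-(x - k)) x := by
    have := ((((hasDerivAt_id' x).sub_const k).fun_pow 2).fun_neg).div_const 2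
    refine this.congr_deriv ?_
    norm_num
    ring
  have := h.exp
  rw [mul_comm] at this
  exact this

theorem contDiff_gauss (k : ℝ) : ContDiff ℝ ∞ (gauss k) := by
  unfold gauss
  fun_prop

theorem gauss_pos (k x : ℝ) : 0 < gauss k x := Real.exp_pos _

theorem integral_eq_zero_of_hasDerivAt_of_hasCompactSupport {F : Type*} [NormedAddCommGroup F]
    [NormedSpace ℝ F] [CompleteSpace F] {f f' : ℝ → F} (hd : ∀ x, HasDerivAt f (f' x) x)
    (hf' : Continuous f') (hf : HasCompactSupport f) : ∫ x, f' x = 0 := by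
  have hc : Continuous f := continuous_iff_continuousAt.2 fun x => (hd x).continuousAt
  have he : f' = deriv f := funext fun x => (hd x).deriv.symm
  refine integral_eq_zero_of_hasDerivAt_of_integrable hd ?_ (hc.integrable_of_hasCompactSupport hf)
  exact hf'.integrable_of_hasCompactSupport (he ▸ hf.deriv)

/-- `∫ |∓w' + X w|² = ∫ (|w'|² + X² |w|²) ± ∫ |w|²` with `X = x - k`. -/
theorem integral_norm_ladder_sq {w : ℝ → ℂ} (hw : IsTest univ w) (k : ℝ) (σ : ℝ) (hσ : σ ^ 2 = 1) :
    ∫ x, ‖(σ : ℝ) • deriv w x + (x - k) • w x‖ ^ 2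
      = (∫ x, (‖deriv w x‖ ^ 2 + (x - k) ^ 2 * ‖w x‖ ^ 2)) - σ * ∫ x, ‖w x‖ ^ 2 := by
  have hc := hw.continuous
  have hc' := hw.continuous_deriv
  have hs := hw.hasCompactSupport
  have hs' := hw.deriv.hasCompactSupport
  have i1 : Integrable fun x => ‖deriv w x‖ ^ 2 + (x - k) ^ 2 * ‖w x‖ ^ 2 := by
    refine Continuous.integrable_of_hasCompactSupport (by fun_prop) ?_
    exact (hs'.comp_left (g := fun z : ℂ => ‖z‖ ^ 2) (by simp)).add
      ((hs.comp_left (g := fun z : ℂ => ‖z‖ ^ 2) (by simp)).mul_left)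
  have i2 : Integrable fun x => ‖w x‖ ^ 2 :=
    Continuous.integrable_of_hasCompactSupport (by fun_prop)
      (hs.comp_left (g := fun z : ℂ => ‖z‖ ^ 2) (by simp))
  have hsw : HasCompactSupport fun x => (x - k) * ‖w x‖ ^ 2 :=
    (hs.comp_left (g := fun z : ℂ => ‖z‖ ^ 2) (by simp)).mul_left
  have h0 : ∫ x, (‖w x‖ ^ 2 + (x - k) * (2 * ⟪w x, deriv w x⟫_ℝ)) = 0 := by
    refine integral_eq_zero_of_hasDerivAt_of_hasCompactSupport
      (f := fun x => (x - k) * ‖w x‖ ^ 2) (fun x => ?_) (by fun_prop) hsw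
    have := ((hasDerivAt_id' x).sub_const k).fun_mul (hw.hasDerivAt x).norm_sq
    refine this.congr_deriv ?_
    rw [one_mul]
  have i3 : Integrable fun x => (‖w x‖ ^ 2 + (x - k) * (2 * ⟪w x, deriv w x⟫_ℝ)) := by
    refine Continuous.integrable_of_hasCompactSupport (by fun_prop) ?_
    refine HasCompactSupport.add (hs.comp_left (g := fun z : ℂ => ‖z‖ ^ 2) (by simp)) ?_
    refine HasCompactSupport.mul_left ?_
    refine hs.mono fun x hx h => hx ?_
    have h' : w x = 0 := h
    simp [h']
  have : ∀ x, ‖(σ : ℝ) • deriv w x + (x - k) • w x‖ ^ 2 =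
      (‖deriv w x‖ ^ 2 + (x - k) ^ 2 * ‖w x‖ ^ 2) - σ * ‖w x‖ ^ 2
        + σ * (‖w x‖ ^ 2 + (x - k) * (2 * ⟪w x, deriv w x⟫_ℝ)) := by
    intro x
    rw [norm_add_sq_real, norm_smul, norm_smul, mul_pow, mul_pow, Real.norm_eq_abs,
      Real.norm_eq_abs, sq_abs, sq_abs, hσ, real_inner_smul_left, real_inner_smul_right,
      real_inner_comm (w x)]
    ring
  simp_rw [this]
  have i4 : Integrable fun x => (‖deriv w x‖ ^ 2 + (x - k) ^ 2 * ‖w x‖ ^ 2) - σ * ‖w x‖ ^ 2 :=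
    i1.sub (i2.const_mul _)
  rw [integral_add i4 (i3.const_mul _), integral_sub i1 (i2.const_mul _),
    integral_const_mul, integral_const_mul, h0]
  ring

/-- A test function orthogonal to the Gaussian is in the range of the creation operator
`-d/dx + X` on test functions. -/
theorem exists_creation_eq {w : ℝ → ℂ} (hw : IsTest univ w) (k : ℝ)
    (h0 : ∫ x, gauss k x • w x = 0) :
    ∃ s, IsTest univ s ∧ ∀ x, w x = -deriv s x + (x - k) • s x := by
  have hg : IsTest univ fun x => (gauss k x : ℂ) * w x :=
    hw.mul_left (ofRealCLM.contDiff.comp (contDiff_gauss k))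
  obtain ⟨P, hP, hPd⟩ := hg.exists_primitive ordConnected_univ (by simpa using h0)
  have hgi : ContDiff ℝ ∞ fun x => -(((gauss k x)⁻¹ : ℝ) : ℂ) :=
    (ofRealCLM.contDiff.comp ((contDiff_gauss k).inv fun x => (gauss_pos k x).ne')).neg
  refine ⟨_, hP.mul_left hgi, fun x => ?_⟩
  have hG : gauss k x ≠ 0 := (gauss_pos k x).ne'
  have h1 := ((((hasDerivAt_gauss k x).fun_inv hG).ofReal_comp).fun_neg).fun_mul (hPd x)
  rw [h1.deriv]
  have hG' : (gauss k x : ℂ) ≠ 0 := by exact_mod_cast hG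
  simp only [Complex.real_smul]
  push_cast
  field_simp
  ring

theorem hasDerivAt_pow_mul_gauss (k : ℝ) (i : ℕ) (x : ℝ) :
    HasDerivAt (fun x => (x - k) ^ (i + 1) * gauss k x)
      (((i : ℝ) + 1) * (x - k) ^ i * gauss k x - (x - k) * ((x - k) ^ (i + 1) * gauss k x))
      x := by
  have h := (((hasDerivAt_id' x).sub_const k).fun_pow (i + 1)).fun_mul (hasDerivAt_gauss k x)
  refine h.congr_deriv ?_
  rw [Nat.add_sub_cancel]
  push_cast
  ring

theorem integral_smul_eq_zero_of_creation {k : ℝ} {s w : ℝ → ℂ} (hs : IsTest univ s)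
    (hwc : HasCompactSupport w) (hw : Continuous w)
    (hws : ∀ x, w x = -deriv s x + (x - k) • s x) {i : ℕ}
    (h : ∫ x, ((x - k) ^ (i + 1) * gauss k x) • w x = 0) :
    ∫ x, ((x - k) ^ i * gauss k x) • s x = 0 := by
  have hgc : Continuous (gauss k) := (contDiff_gauss k).continuous
  have hsc := hs.continuous
  have hss := hs.hasCompactSupport
  have i1 : Integrable fun x => (((i : ℝ) + 1) * (x - k) ^ i * gauss k x) • s x :=
    Continuous.integrable_of_hasCompactSupport (by fun_prop)
      (hss.smul_left (f := fun x => ((i : ℝ) + 1) * (x - k) ^ i * gauss k x))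
  have i2 : Integrable fun x => ((x - k) ^ (i + 1) * gauss k x) • w x :=
    Continuous.integrable_of_hasCompactSupport (by fun_prop)
      (hwc.smul_left (f := fun x => (x - k) ^ (i + 1) * gauss k x))
  -- integrate `(X^(i+1) G s)'`, which is `(i+1) X^i G s` minus `X^(i+1) G (a* s)`
  have h2 : ∫ x, ((((i : ℝ) + 1) * (x - k) ^ i * gauss k x) • s x
      - ((x - k) ^ (i + 1) * gauss k x) • w x) = 0 := by
    refine integral_eq_zero_of_hasDerivAt_of_hasCompactSupport
      (f := fun x => ((x - k) ^ (i + 1) * gauss k x) • s x) (fun x => ?_) (by fun_prop)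
      (hss.smul_left (f := fun x => (x - k) ^ (i + 1) * gauss k x))
    have h3 := (hasDerivAt_pow_mul_gauss k i x).fun_smul (hs.hasDerivAt x)
    convert h3 using 1
    rw [hws]
    module
  rw [integral_sub i1 i2, h, sub_zero] at h2
  have h4 : ∀ x, (((i : ℝ) + 1) * (x - k) ^ i * gauss k x) • s x
      = ((i : ℝ) + 1) • (((x - k) ^ i * gauss k x) • s x) := fun x => by
    rw [smul_smul, mul_assoc]
  simp_rw [h4] at h2
  rw [integral_smul, smul_eq_zero] at h2
  exact h2.resolve_left (Nat.cast_add_one_ne_zero i)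

/-- If a test function is orthogonal to the first `m` excited states `p(X) e^(-X²/2)`,
`deg p < m`, then its oscillator energy is at least `2 m + 1`. The reason is the ladder structure:
the function is `a* s`, and `s` satisfies the hypothesis for `m - 1`. -/
theorem oscillator_gap (k : ℝ) (m : ℕ) : ∀ w : ℝ → ℂ, IsTest univ w →
    (∀ i < m, ∫ x, ((x - k) ^ i * gauss k x) • w x = 0) →
    (2 * m + 1) * ∫ x, ‖w x‖ ^ 2 ≤ ∫ x, (‖deriv w x‖ ^ 2 + (x - k) ^ 2 * ‖w x‖ ^ 2) := by
  induction m with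
  | zero =>
    intro w hw _
    have h := integral_norm_ladder_sq hw k 1 (by norm_num)
    have h1 : 0 ≤ ∫ x, ‖(1 : ℝ) • deriv w x + (x - k) • w x‖ ^ 2 :=
      integral_nonneg fun x => by positivity
    simp only [CharP.cast_eq_zero, mul_zero, zero_add, one_mul] at h ⊢
    linarith
  | succ m ih =>
    intro w hw h
    obtain ⟨s, hs, hws⟩ := exists_creation_eq hw k (by simpa using h 0 (Nat.succ_pos m))
    have hsc := hs.continuous
    have hsc' := hs.continuous_deriv
    have hss := hs.hasCompactSupport
    have hwc := hw.continuous
    have hwc' := hw.continuous_deriv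
    have hwc'' := hw.hasCompactSupport
    have horth : ∀ i < m, ∫ x, ((x - k) ^ i * gauss k x) • s x = 0 := fun i hi =>
      integral_smul_eq_zero_of_creation hs hw.hasCompactSupport hwc hws (h (i + 1) (by omega))
    clear h
    have hs1 := ih s hs horth
    have hs2 := integral_norm_ladder_sq hs k (-1) (by norm_num)
    have hw1 := integral_norm_ladder_sq hw k 1 (by norm_num)
    have hnw : ∀ x, ‖(-1 : ℝ) • deriv s x + (x - k) • s x‖ ^ 2 = ‖w x‖ ^ 2 := fun x => by
      rw [hws]; simp
    simp_rw [hnw] at hs2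
    set c : ℝ := 2 * (m + 1) with hc
    have hc0 : 0 < c := by positivity
    have hle : c * ∫ x, ‖s x‖ ^ 2 ≤ ∫ x, ‖w x‖ ^ 2 := by linarith
    have hsq : HasCompactSupport fun x => ‖s x‖ ^ 2 :=
      hss.comp_left (g := fun z : ℂ => ‖z‖ ^ 2) (by simp)
    have i1 : Integrable fun x => ‖s x‖ ^ 2 :=
      Continuous.integrable_of_hasCompactSupport (by fun_prop) hsq
    have i0 : Integrable fun x => ‖w x‖ ^ 2 :=
      Continuous.integrable_of_hasCompactSupport (by fun_prop)
        (hwc''.comp_left (g := fun z : ℂ => ‖z‖ ^ 2) (by simp))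
    have i2 : Integrable fun x => ‖(1 : ℝ) • deriv w x + (x - k) • w x‖ ^ 2 := by
      refine Continuous.integrable_of_hasCompactSupport (by fun_prop) ?_
      refine HasCompactSupport.comp_left (g := fun z : ℂ => ‖z‖ ^ 2) ?_ (by simp)
      exact (hw.deriv.hasCompactSupport.smul_left (f := fun _ => (1 : ℝ))).add
        (hwc''.smul_left (f := fun x => x - k))
    have hsw : HasCompactSupport fun x => ⟪s x, w x⟫_ℝ :=
      hss.mono fun x hx h => hx (by
        have h' : s x = 0 := h
        simp [h'])
    have h5 : ∫ x, (⟪s x, deriv w x⟫_ℝ + ⟪deriv s x, w x⟫_ℝ) = 0 :=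
      integral_eq_zero_of_hasDerivAt_of_hasCompactSupport
        (f := fun x => ⟪s x, w x⟫_ℝ) (fun x => (hs.hasDerivAt x).inner ℝ (hw.hasDerivAt x))
        (by fun_prop) hsw
    have i5 : Integrable fun x => ⟪s x, deriv w x⟫_ℝ + ⟪deriv s x, w x⟫_ℝ := by
      refine Continuous.integrable_of_hasCompactSupport (by fun_prop) (HasCompactSupport.add ?_ ?_)
      · exact hss.mono fun x hx h => hx (by
          have h' : s x = 0 := h
          simp [h'])
      · exact hwc''.mono fun x hx h => hx (by
          have h' : w x = 0 := h
          simp [h'])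
    -- `|w|² = ⟨a* s, w⟩ = ⟨s, a w⟩ - ⟨s, w⟩'`, and Young's inequality for `⟨s, a w⟩`
    have h6 : ∫ x, ‖w x‖ ^ 2 ≤ ∫ x, (c / 2 * ‖s x‖ ^ 2
        + 1 / (2 * c) * ‖(1 : ℝ) • deriv w x + (x - k) • w x‖ ^ 2
        - (⟪s x, deriv w x⟫_ℝ + ⟪deriv s x, w x⟫_ℝ)) := by
      refine integral_mono i0 (((i1.const_mul _).add (i2.const_mul _)).sub i5) fun x => ?_
      have e1 : ‖w x‖ ^ 2 = ⟪s x, (1 : ℝ) • deriv w x + (x - k) • w x⟫_ℝ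
          - (⟪s x, deriv w x⟫_ℝ + ⟪deriv s x, w x⟫_ℝ) := by
        rw [← real_inner_self_eq_norm_sq]
        nth_rewrite 1 [hws]
        rw [inner_add_left, inner_neg_left, real_inner_smul_left, inner_add_right,
          real_inner_smul_right, one_mul, real_inner_smul_right]
        ring
      have e2 := real_inner_le_norm (s x) ((1 : ℝ) • deriv w x + (x - k) • w x)
      have e3 : ‖s x‖ * ‖(1 : ℝ) • deriv w x + (x - k) • w x‖ ≤ c / 2 * ‖s x‖ ^ 2
          + 1 / (2 * c) * ‖(1 : ℝ) • deriv w x + (x - k) • w x‖ ^ 2 := by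
        set A := ‖s x‖
        set B := ‖(1 : ℝ) • deriv w x + (x - k) • w x‖
        have : c / 2 * A ^ 2 + 1 / (2 * c) * B ^ 2 - A * B = (c * A - B) ^ 2 / (2 * c) := by
          field_simp
          ring
        have h7 : 0 ≤ (c * A - B) ^ 2 / (2 * c) := by positivity
        linarith
      simp only
      linarith
    have i6 : Integrable fun x => c / 2 * ‖s x‖ ^ 2
        + 1 / (2 * c) * ‖(1 : ℝ) • deriv w x + (x - k) • w x‖ ^ 2 :=
      (i1.const_mul _).add (i2.const_mul _)
    rw [integral_sub i6 i5, h5, integral_add (i1.const_mul _)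
      (i2.const_mul _), integral_const_mul, integral_const_mul, hw1] at h6
    have h8 : ∫ x, ‖w x‖ ^ 2 ≤ 1 / 2 * (∫ x, ‖w x‖ ^ 2) + 1 / (2 * c) *
        ((∫ x, (‖deriv w x‖ ^ 2 + (x - k) ^ 2 * ‖w x‖ ^ 2)) - 1 * ∫ x, ‖w x‖ ^ 2) := by
      linarith
    have h9 : c * ∫ x, ‖w x‖ ^ 2 ≤
        (∫ x, (‖deriv w x‖ ^ 2 + (x - k) ^ 2 * ‖w x‖ ^ 2)) - 1 * ∫ x, ‖w x‖ ^ 2 := by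
      set D := (∫ x, (‖deriv w x‖ ^ 2 + (x - k) ^ 2 * ‖w x‖ ^ 2)) - 1 * ∫ x, ‖w x‖ ^ 2
      have : 1 / 2 * (∫ x, ‖w x‖ ^ 2) ≤ 1 / (2 * c) * D := by linarith
      have h10 := mul_le_mul_of_nonneg_left this (by positivity : 0 ≤ 2 * c)
      have h11 : 2 * c * (1 / (2 * c) * D) = D := by field_simp
      linarith
    push_cast
    linarith

/-! ### The fiber form domain and regularity of eigenfunctions -/

theorem L2_norm_sq_eq_integral {α : Type*} [MeasurableSpace α] {μ : Measure α} (f : Lp ℂ 2 μ) :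
    ‖f‖ ^ 2 = ∫ x, ‖f x‖ ^ 2 ∂μ := by
  have h := L2.inner_def (𝕜 := ℂ) f f
  rw [inner_self_eq_norm_sq_to_K] at h
  have h2 : ∀ x, ⟪f x, f x⟫_ℂ = ((‖f x‖ ^ 2 : ℝ) : ℂ) := fun x => by
    rw [inner_self_eq_norm_sq_to_K]; norm_cast
  simp_rw [h2] at h
  rw [integral_complex_ofReal] at h
  refine Complex.ofReal_injective ?_
  rw [← h]
  push_cast
  rfl

theorem L2_norm_sq_eq_of_ae {α : Type*} [MeasurableSpace α] {μ : Measure α} {f : Lp ℂ 2 μ}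
    {g : α → ℂ} (h : f =ᵐ[μ] g) : ‖f‖ ^ 2 = ∫ x, ‖g x‖ ^ 2 ∂μ := by
  rw [L2_norm_sq_eq_integral]
  exact integral_congr_ae (h.mono fun x hx => by simp only [hx])

theorem L2_inner_eq_of_ae {α : Type*} [MeasurableSpace α] {μ : Measure α} {f g : Lp ℂ 2 μ}
    {f' g' : α → ℂ} (h : f =ᵐ[μ] f') (h' : g =ᵐ[μ] g') :
    ⟪f, g⟫_ℂ = ∫ x, (starRingEnd ℂ) (f' x) * g' x ∂μ := by
  rw [L2.inner_def]
  refine integral_congr_ae ?_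
  filter_upwards [h, h'] with x e1 e2
  rw [e1, e2, RCLike.inner_apply, mul_comm]

theorem IsTest.memLp {E : Type*} [NormedAddCommGroup E] [NormedSpace ℝ E] [MeasurableSpace E]
    [BorelSpace E] {U : Set E} {ψ : E → ℂ} (h : IsTest U ψ) (μ : Measure E)
    [IsFiniteMeasureOnCompacts μ] : MemLp ψ 2 μ :=
  h.continuous.memLp_of_hasCompactSupport h.hasCompactSupport

theorem IsTest.conj {E : Type*} [NormedAddCommGroup E] [NormedSpace ℝ E] {U : Set E} {ψ : E → ℂ}
    (h : IsTest U ψ) : IsTest U fun x => (starRingEnd ℂ) (ψ x) := by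
  have hs : Function.support (fun x => (starRingEnd ℂ) (ψ x)) = Function.support ψ := by
    ext x; simp
  refine ⟨Complex.conjCLE.contDiff.comp h.contDiff, ?_, ?_⟩
  · unfold HasCompactSupport tsupport; rw [hs]; exact h.hasCompactSupport
  · unfold tsupport; rw [hs]; exact h.tsupport_subset

theorem IsTest.mul_sub_const {U : Set ℝ} {ψ : ℝ → ℂ} (h : IsTest U ψ) (k : ℝ) :
    IsTest U fun x => ((x - k : ℝ) : ℂ) * ψ x :=
  h.mul_left (c := fun x : ℝ => ((x - k : ℝ) : ℂ))
    (ofRealCLM.contDiff.comp (contDiff_id.sub contDiff_const))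

theorem IsTest.setIntegral_eq {F : Type*} [NormedAddCommGroup F] [NormedSpace ℝ F]
    {E : Type*} [NormedAddCommGroup E] [NormedSpace ℝ E] [MeasurableSpace E] {μ : Measure E}
    {U : Set E} {ψ : E → ℂ} (h : IsTest U ψ) (f : E → F) (hf : ∀ x, ψ x = 0 → f x = 0) :
    ∫ x in U, f x ∂μ = ∫ x, f x ∂μ :=
  setIntegral_eq_integral_of_forall_compl_eq_zero fun x hx => hf x (h.eq_zero_of_notMem hx)

theorem exists_mem_fiberCore (k : ℝ) {ψ : ℝ → ℂ} (hψ : IsTest (Ioi 0) ψ) :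
    ∃ q ∈ fiberCore k, q.1 =ᵐ[volume.restrict (Ioi 0)] ψ ∧
      q.2.fst =ᵐ[volume.restrict (Ioi 0)] deriv ψ ∧
      q.2.snd =ᵐ[volume.restrict (Ioi 0)] fun x => ((x - k : ℝ) : ℂ) * ψ x := by
  have h0 := hψ.memLp (volume.restrict (Ioi 0))
  have h1 := hψ.deriv.memLp (volume.restrict (Ioi 0))
  have h2 := (hψ.mul_sub_const k).memLp (volume.restrict (Ioi 0))
  exact ⟨(h0.toLp _, WithLp.toLp 2 (h1.toLp _, h2.toLp _)),
    ⟨ψ, hψ, h0.coeFn_toLp, h1.coeFn_toLp, h2.coeFn_toLp⟩,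
    h0.coeFn_toLp, h1.coeFn_toLp, h2.coeFn_toLp⟩

theorem fiberCore_total (k : ℝ) (f : L2HalfLine) (hf : ∀ q ∈ fiberCore k, ⟪q.1, f⟫_ℂ = 0) :
    f = 0 := by
  refine IsTest.eq_zero_of_inner isOpen_Ioi f fun ψ hψ a ha => ?_
  obtain ⟨q, hq, h1, -, -⟩ := exists_mem_fiberCore k hψ
  have : a = q.1 := Lp.ext (ha.trans h1.symm)
  rw [this]
  exact hf q hq

theorem exists_tendsto_ae_of_tendsto_L2 {α : Type*} [MeasurableSpace α] {μ : Measure α}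
    {f : ℕ → Lp ℂ 2 μ} {g : Lp ℂ 2 μ} (h : Filter.Tendsto f Filter.atTop (nhds g)) :
    ∃ ns : ℕ → ℕ, StrictMono ns ∧
      ∀ᵐ x ∂μ, Filter.Tendsto (fun i => f (ns i) x) Filter.atTop (nhds (g x)) :=
  (tendstoInMeasure_of_tendsto_Lp h).exists_seq_tendsto_ae

/-- An element `(φ, (g₁, g₂))` of the closed fiber graph: `g₂ = (x - k) φ`, and `φ` is the
primitive of `g₁` vanishing at the boundary. -/
theorem fiber_closure_ae {k : ℝ} {φ : L2HalfLine} {g : WithLp 2 (L2HalfLine × L2HalfLine)}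
    (h : (φ, g) ∈ (fiberCore k).topologicalClosure) :
    (g.snd =ᵐ[volume.restrict (Ioi 0)] fun x => ((x - k : ℝ) : ℂ) * φ x) ∧
    ∀ᵐ x ∂(volume.restrict (Ioi (0 : ℝ))), φ x = ∫ t in Ioc 0 x, g.fst t := by
  obtain ⟨q, hq, hlim⟩ := mem_closure_iff_seq_limit.1 h
  choose ψ hψ h1 h2 h3 using hq
  have l1 : Filter.Tendsto (fun j => (q j).1) Filter.atTop (nhds φ) :=
    (continuous_fst.tendsto _).comp hlim
  have l2 : Filter.Tendsto (fun j => (q j).2.fst) Filter.atTop (nhds g.fst) :=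
    (((WithLp.fstL 2 ℂ L2HalfLine L2HalfLine).continuous.comp continuous_snd).tendsto _).comp hlim
  have l3 : Filter.Tendsto (fun j => (q j).2.snd) Filter.atTop (nhds g.snd) :=
    (((WithLp.sndL 2 ℂ L2HalfLine L2HalfLine).continuous.comp continuous_snd).tendsto _).comp hlim
  obtain ⟨n1, hn1, a1⟩ := exists_tendsto_ae_of_tendsto_L2 l1
  obtain ⟨n2, hn2, a2⟩ := exists_tendsto_ae_of_tendsto_L2 (l3.comp hn1.tendsto_atTop)
  have e1 := ae_all_iff.2 h1
  have e3 := ae_all_iff.2 h3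
  constructor
  · filter_upwards [a1, a2, e1, e3] with x b1 b2 c1 c3
    have b1' := b1.comp hn2.tendsto_atTop
    refine tendsto_nhds_unique b2 ?_
    have := b1'.const_mul ((x - k : ℝ) : ℂ)
    refine this.congr fun i => ?_
    simp only [Function.comp, c1, c3]
  · filter_upwards [a1, e1, ae_restrict_mem measurableSet_Ioi] with x b1 c1 hx
    refine tendsto_nhds_unique b1 ?_
    have hfin : volume.restrict (Ioi (0 : ℝ)) (Ioc 0 x) ≠ ⊤ :=
      ((Measure.restrict_apply_le _ _).trans_lt measure_Ioc_lt_top).ne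
    have hres : (volume.restrict (Ioi (0 : ℝ))).restrict (Ioc 0 x) = volume.restrict (Ioc 0 x) :=
      Measure.restrict_restrict_of_subset Ioc_subset_Ioi_self
    have hcont : Continuous fun f : L2HalfLine =>
        ⟪indicatorConstLp 2 (measurableSet_Ioc (a := (0 : ℝ)) (b := x)) hfin (1 : ℂ), f⟫_ℂ :=
      continuous_const.inner continuous_id
    have l := (hcont.tendsto g.fst).comp (l2.comp hn1.tendsto_atTop)
    simp only [L2.inner_indicatorConstLp_one, hres] at l
    refine l.congr fun i => ?_
    have e : ∫ t in Ioc 0 x, (q (n1 i)).2.fst t = ∫ t in Ioc 0 x, deriv (ψ (n1 i)) t := by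
      refine integral_congr_ae ?_
      have := ae_restrict_of_ae (s := Ioc 0 x) (h2 (n1 i))
      rwa [hres] at this
    simp only [Function.comp, e, c1]
    have hx0 : (0 : ℝ) ≤ x := le_of_lt hx
    rw [← intervalIntegral.integral_of_le hx0, intervalIntegral.integral_deriv_eq_sub
      (fun t _ => (hψ _).differentiable t) ((hψ _).continuous_deriv.intervalIntegrable _ _),
      (hψ _).eq_zero_of_notMem (by simp : (0 : ℝ) ∉ Ioi (0 : ℝ)), sub_zero]

/-- The lemma of du Bois-Reymond on the half-line. -/
theorem ae_eq_const_of_integral_deriv_mul {b : ℝ → ℂ} (hb : LocallyIntegrableOn b (Ioi 0))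
    (h : ∀ α, IsTest (Ioi 0) α → ∫ x in Ioi 0, deriv α x * b x = 0) :
    ∃ c : ℂ, ∀ᵐ x ∂(volume.restrict (Ioi (0 : ℝ))), b x = c := by
  have hint : ∀ α : ℝ → ℂ, IsTest (Ioi 0) α → IntegrableOn (fun x => α x * b x) (Ioi 0) := by
    intro α hα
    have h1 : IntegrableOn (fun x => α x * b x) (tsupport α) :=
      (hb.integrableOn_compact_subset hα.tsupport_subset hα.hasCompactSupport).continuousOn_mul
        hα.continuous.continuousOn hα.hasCompactSupport
    have h2 : Integrable (fun x => α x * b x) :=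
      (integrableOn_iff_integrable_of_support_subset fun x hx =>
        subset_tsupport α fun h0 => hx (by simp [h0])).1 h1
    exact h2.integrableOn
  -- a test function of integral one
  let f : ContDiffBump (2 : ℝ) := ⟨1 / 2, 1, by norm_num, by norm_num⟩
  let η : ℝ → ℂ := fun x => (f.normed volume x : ℂ)
  have hη : IsTest (Ioi 0) η := by
    have hs : Function.support η = Function.support (f.normed volume) := by ext x; simp [η]
    refine ⟨ofRealCLM.contDiff.comp f.contDiff_normed, ?_, ?_⟩
    · unfold HasCompactSupport tsupport; rw [hs]; exact f.hasCompactSupport_normed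
    · unfold tsupport; rw [hs]
      change tsupport (f.normed volume) ⊆ _
      rw [f.tsupport_normed_eq]
      intro x hx
      rw [Metric.mem_closedBall, Real.dist_eq] at hx
      have := (abs_le.1 hx).1
      change -(1 : ℝ) ≤ x - 2 at this
      change 0 < x
      linarith
  have hη1 : ∫ x, η x = 1 := by
    change ∫ x, ((f.normed volume x : ℝ) : ℂ) = 1
    rw [integral_complex_ofReal, f.integral_normed, ofReal_one]
  refine ⟨∫ x in Ioi 0, η x * b x, ?_⟩
  set c := ∫ x in Ioi 0, η x * b x
  have hbc : LocallyIntegrableOn (fun x => b x - c) (Ioi 0) :=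
    hb.sub ((locallyIntegrable_const c).locallyIntegrableOn _)
  have key := isOpen_Ioi.ae_eq_zero_of_integral_contDiff_smul_eq_zero (μ := volume) hbc
    fun g hg hgc hgs => by
      let ψ : ℝ → ℂ := fun x => (g x : ℂ)
      have hsupp : Function.support ψ = Function.support g := by ext x; simp [ψ]
      have hψ : IsTest (Ioi 0) ψ :=
        ⟨ofRealCLM.contDiff.comp hg, by
          unfold HasCompactSupport tsupport; rw [hsupp]; exact hgc, by
          unfold tsupport; rw [hsupp]; exact hgs⟩
      set m : ℂ := ∫ x, ψ x with hm
      have hi : ∀ χ : ℝ → ℂ, IsTest (Ioi 0) χ → Integrable χ := fun χ hχ =>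
        hχ.continuous.integrable_of_hasCompactSupport hχ.hasCompactSupport
      have hδ : IsTest (Ioi 0) (ψ + (-m) • η) := hψ.add (hη.const_smul _)
      have h0 : ∫ x, (ψ + (-m) • η) x = 0 := by
        have : ∀ x, (ψ + (-m) • η) x = ψ x + (-m) * η x := fun x => rfl
        simp_rw [this]
        rw [integral_add (hi ψ hψ) ((hi η hη).const_mul _), integral_const_mul, hη1, ← hm]
        ring
      obtain ⟨P, hP, hPd⟩ := hδ.exists_primitive ordConnected_Ioi h0
      have h1 := h P hP
      have h2 : ∀ x, deriv P x * b x = ψ x * b x - m * (η x * b x) := fun x => by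
        rw [(hPd x).deriv]
        simp only [Pi.add_apply, Pi.smul_apply, smul_eq_mul]
        ring
      simp_rw [h2] at h1
      rw [integral_sub (hint ψ hψ) ((hint η hη).const_mul _), integral_const_mul] at h1
      have h3 : ∫ x in Ioi 0, g x • (b x - c) = (∫ x in Ioi 0, ψ x * b x) - m * c := by
        have e : ∀ x, g x • (b x - c) = ψ x * b x - ψ x * c := fun x => by
          rw [Complex.real_smul]; ring
        simp_rw [e]
        rw [integral_sub (hint ψ hψ) ((hi ψ hψ).integrableOn.mul_const _), integral_mul_const,
          hψ.setIntegral_eq ψ (fun x hx => hx)]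
      rw [← setIntegral_eq_integral_of_forall_compl_eq_zero (s := Ioi 0), h3, h1]
      intro x hx
      have : g x = 0 := by
        by_contra hne
        exact hx (hgs (subset_tsupport g hne))
      simp [this]
  rw [ae_restrict_iff' measurableSet_Ioi]
  filter_upwards [key] with x hx hx0
  exact sub_eq_zero.1 (hx hx0)

/-- `Y` is a square integrable classical solution of the Dirichlet problem
`-Y'' + (x - k)² Y = t Y` on the half-line, `Y(0) = 0`, and `Z = Y'`. -/
structure IsDirichletSolution (k t : ℝ) (Y Z : ℝ → ℂ) : Prop where
  hasDerivAt : ∀ x, HasDerivAt Y (Z x) x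
  hasDerivAt_deriv : ∀ x, 0 ≤ x → HasDerivAt Z ((((x - k) ^ 2 - t : ℝ) : ℂ) * Y x) x
  zero : Y 0 = 0
  memLp : MemLp Y 2 (volume.restrict (Ioi 0))
  memLp_deriv : MemLp Z 2 (volume.restrict (Ioi 0))
  memLp_mul : MemLp (fun x => ((x - k : ℝ) : ℂ) * Y x) 2 (volume.restrict (Ioi 0))

/-- Eigenvectors of the fiber operator are classical solutions of the Dirichlet problem. -/
theorem exists_isDirichletSolution {k t : ℝ} {u : L2HalfLine}
    (hu : (u, (t : ℂ) • u) ∈ formGraph (fiberCore k)) :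
    ∃ Y Z, IsDirichletSolution k t Y Z ∧ u =ᵐ[volume.restrict (Ioi 0)] Y := by
  obtain ⟨g, hg, h⟩ := hu
  simp only at hg h
  obtain ⟨hg2, hprim⟩ := fiber_closure_ae hg
  have hg1 : MemLp ((Ioi (0 : ℝ)).indicator g.fst) 2 volume :=
    (memLp_indicator_iff_restrict measurableSet_Ioi).2 (Lp.memLp g.fst)
  have hloc : LocallyIntegrable ((Ioi (0 : ℝ)).indicator g.fst) volume :=
    hg1.locallyIntegrable (by norm_num)
  set y : ℝ → ℂ := fun x => ∫ s in (0 : ℝ)..x, (Ioi (0 : ℝ)).indicator g.fst s with hy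
  have hyc : Continuous y := intervalIntegral.continuous_primitive
    (fun a b => (hloc.integrableOn_isCompact isCompact_uIcc).intervalIntegrable) 0
  have hyu : u =ᵐ[volume.restrict (Ioi 0)] y := by
    filter_upwards [hprim, ae_restrict_mem measurableSet_Ioi] with x hx hx0
    rw [hx, hy]
    simp only
    rw [intervalIntegral.integral_of_le (le_of_lt hx0)]
    refine setIntegral_congr_fun measurableSet_Ioc fun s hs => ?_
    rw [indicator_of_mem (show s ∈ Ioi (0 : ℝ) from hs.1)]
  set d : ℝ → ℂ := fun x => (((x - k) ^ 2 - t : ℝ) : ℂ) * y x with hd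
  have hdc : Continuous d := by
    have : Continuous fun x : ℝ => (((x - k) ^ 2 - t : ℝ) : ℂ) := by fun_prop
    exact this.mul hyc
  set D : ℝ → ℂ := fun x => ∫ s in (0 : ℝ)..x, d s with hD
  have hDd : ∀ x, HasDerivAt D (d x) x := fun x =>
    intervalIntegral.integral_hasDerivAt_right (hdc.intervalIntegrable _ _)
      (hdc.stronglyMeasurableAtFilter _ _) hdc.continuousAt
  have hDc : Continuous D := continuous_iff_continuousAt.2 fun x => (hDd x).continuousAt
  have hb : LocallyIntegrableOn (fun x => g.fst x - D x) (Ioi 0) := by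
    refine LocallyIntegrableOn.sub ?_ (hDc.locallyIntegrable.locallyIntegrableOn _)
    exact locallyIntegrableOn_of_locallyIntegrable_restrict
      ((Lp.memLp g.fst).locallyIntegrable (by norm_num))
  obtain ⟨c, hc⟩ := ae_eq_const_of_integral_deriv_mul hb fun α hα => by
    obtain ⟨q, hq, h1, h2, h3⟩ := exists_mem_fiberCore k hα.conj
    have hw := h q hq
    rw [WithLp.prod_inner_apply] at hw
    have e1 := L2_inner_eq_of_ae h2 (Filter.EventuallyEq.refl _ g.fst)
    have e2 := L2_inner_eq_of_ae h3 (hg2.trans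
      (hyu.mono fun x hx => by simp only [hx] : (fun x => ((x - k : ℝ) : ℂ) * u x) =ᵐ[_]
        fun x => ((x - k : ℝ) : ℂ) * y x))
    have e3 := L2_inner_eq_of_ae h1 hyu
    rw [inner_smul_right] at hw
    change ⟪q.2.fst, g.fst⟫_ℂ + ⟪q.2.snd, g.snd⟫_ℂ = _ at hw
    rw [e1, e2, e3] at hw
    have hcd : ∀ x, deriv (fun x => (starRingEnd ℂ) (α x)) x = (starRingEnd ℂ) (deriv α x) :=
      fun x => (Complex.conjCLE.hasFDerivAt.comp_hasDerivAt x (hα.hasDerivAt x)).deriv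
    simp_rw [hcd, map_mul, Complex.conj_conj, Complex.conj_ofReal] at hw
    have hαc := hα.continuous
    have hαc' := hα.continuous_deriv
    have i1 : IntegrableOn (fun x => deriv α x * g.fst x) (Ioi 0) :=
      (hα.deriv.memLp (volume.restrict (Ioi 0))).integrable_mul (Lp.memLp g.fst)
    have i2 : Integrable (fun x => deriv α x * D x) :=
      Continuous.integrable_of_hasCompactSupport (by fun_prop)
        (hα.deriv.hasCompactSupport.mul_right)
    have i3 : Integrable (fun x => α x * d x) :=
      Continuous.integrable_of_hasCompactSupport (by fun_prop) (hα.hasCompactSupport.mul_right)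
    have hyk : Continuous fun x : ℝ => ((x - k : ℝ) : ℂ) := by fun_prop
    have i4 : Integrable (fun x => ((x - k : ℝ) : ℂ) * α x * (((x - k : ℝ) : ℂ) * y x)) :=
      Continuous.integrable_of_hasCompactSupport (by fun_prop)
        ((hα.hasCompactSupport.mul_left).mul_right)
    have i5 : Integrable (fun x => α x * y x) :=
      Continuous.integrable_of_hasCompactSupport (by fun_prop) (hα.hasCompactSupport.mul_right)
    have hpart : ∫ x, (deriv α x * D x + α x * d x) = 0 :=
      integral_eq_zero_of_hasDerivAt_of_hasCompactSupport (f := fun x => α x * D x)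
        (fun x => (hα.hasDerivAt x).fun_mul (hDd x)) (by fun_prop)
        (hα.hasCompactSupport.mul_right)
    rw [integral_add i2 i3] at hpart
    have hs1 : ∫ x in Ioi 0, deriv α x * D x = ∫ x, deriv α x * D x :=
      hα.deriv.setIntegral_eq _ fun x hx => by rw [hx, zero_mul]
    have hs2 : ∫ x in Ioi 0, α x * d x = ∫ x, α x * d x :=
      hα.setIntegral_eq _ fun x hx => by rw [hx, zero_mul]
    have hs3 : ∫ x in Ioi 0, α x * d x =
        (∫ x in Ioi 0, ((x - k : ℝ) : ℂ) * α x * (((x - k : ℝ) : ℂ) * y x))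
          - t * ∫ x in Ioi 0, α x * y x := by
      rw [← integral_const_mul, ← integral_sub i4.integrableOn (i5.const_mul _).integrableOn]
      refine integral_congr_ae (Filter.Eventually.of_forall fun x => ?_)
      simp only [hd]
      push_cast
      ring
    simp_rw [mul_sub]
    rw [integral_sub i1 i2.integrableOn, hs1]
    linear_combination hw + hs3 - hs2 - hpart
  -- the regular representatives
  set Z : ℝ → ℂ := fun x => c + D x with hZ
  have hZc : Continuous Z := by fun_prop
  have hZg : ∀ᵐ x ∂(volume.restrict (Ioi (0 : ℝ))), g.fst x = Z x := by
    filter_upwards [hc] with x hx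
    rw [hZ, ← hx]
    ring
  set Y : ℝ → ℂ := fun x => ∫ s in (0 : ℝ)..x, Z s with hY
  have hYd : ∀ x, HasDerivAt Y (Z x) x := fun x =>
    intervalIntegral.integral_hasDerivAt_right (hZc.intervalIntegrable _ _)
      (hZc.stronglyMeasurableAtFilter _ _) hZc.continuousAt
  have hYy : ∀ x, 0 ≤ x → Y x = y x := by
    intro x hx
    simp only [hY, hy]
    rw [intervalIntegral.integral_of_le hx, intervalIntegral.integral_of_le hx]
    refine integral_congr_ae ?_
    have h1 := ae_restrict_of_ae_restrict_of_subset
      (Ioc_subset_Ioi_self : Ioc (0 : ℝ) x ⊆ Ioi 0) hZg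
    filter_upwards [h1, ae_restrict_mem measurableSet_Ioc] with s h2 h3
    rw [indicator_of_mem (show s ∈ Ioi (0 : ℝ) from h3.1), h2]
  have huY : u =ᵐ[volume.restrict (Ioi 0)] Y := by
    filter_upwards [hyu, ae_restrict_mem measurableSet_Ioi] with x h1 h2
    rw [h1, hYy x (le_of_lt h2)]
  refine ⟨Y, Z, ⟨hYd, fun x hx => ?_, ?_, ?_, ?_, ?_⟩, huY⟩
  · rw [hYy x hx]
    exact (hDd x).const_add c
  · simp [hY]
  · exact (memLp_congr_ae huY).1 (Lp.memLp u)
  · exact (memLp_congr_ae hZg).1 (Lp.memLp g.fst)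
  · refine (memLp_congr_ae (hg2.trans ?_)).1 (Lp.memLp g.snd)
    filter_upwards [huY] with x hx
    rw [hx]

/-! ### Boundary identities for eigenfunctions -/

namespace IsDirichletSolution

variable {k t : ℝ} {Y Z : ℝ → ℂ}

theorem integrable_norm_sq (h : IsDirichletSolution k t Y Z) :
    IntegrableOn (fun x => ‖Y x‖ ^ 2) (Ioi 0) := h.memLp.integrable_norm_pow (by norm_num)

theorem integrable_norm_deriv_sq (h : IsDirichletSolution k t Y Z) :
    IntegrableOn (fun x => ‖Z x‖ ^ 2) (Ioi 0) := h.memLp_deriv.integrable_norm_pow (by norm_num)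

theorem integrable_sq_mul_norm_sq (h : IsDirichletSolution k t Y Z) :
    IntegrableOn (fun x => (x - k) ^ 2 * ‖Y x‖ ^ 2) (Ioi 0) := by
  refine (h.memLp_mul.integrable_norm_pow (by norm_num)).congr
    (Filter.Eventually.of_forall fun x => ?_)
  simp only [norm_mul, Complex.norm_real, mul_pow, Real.norm_eq_abs, sq_abs]

theorem integrable_mul_norm_sq (h : IsDirichletSolution k t Y Z) :
    IntegrableOn (fun x => (x - k) * ‖Y x‖ ^ 2) (Ioi 0) := by
  refine (h.integrable_norm_sq.add h.integrable_sq_mul_norm_sq).mono' ?_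
    (Filter.Eventually.of_forall fun x => ?_)
  · exact ((continuous_id.sub continuous_const).aestronglyMeasurable).mul
      h.integrable_norm_sq.aestronglyMeasurable
  · rw [norm_mul, norm_pow, norm_norm, Pi.add_apply, Real.norm_eq_abs]
    have h1 : |x - k| ≤ 1 + (x - k) ^ 2 := by
      rw [← sq_abs]; nlinarith [abs_nonneg (x - k), sq_nonneg (|x - k| - 1)]
    nlinarith [sq_nonneg ‖Y x‖]

/-- The Feynman-Hellmann identity `2 ∫ (x - k) |Y|² = |Y'(0)|²`; the left side is `-λ'(k)` when
`Y` is a normalized eigenfunction for the eigenvalue `λ(k)`. -/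
theorem two_mul_integral_eq (h : IsDirichletSolution k t Y Z) :
    2 * ∫ x in Ioi 0, (x - k) * ‖Y x‖ ^ 2 = ‖Z 0‖ ^ 2 := by
  have hd : ∀ x ∈ Ici (0 : ℝ), HasDerivAt
      (fun x => ‖Z x‖ ^ 2 - ((x - k) ^ 2 - t) * ‖Y x‖ ^ 2)
      (-2 * ((x - k) * ‖Y x‖ ^ 2)) x := by
    intro x hx
    have h1 := ((h.hasDerivAt_deriv x hx).norm_sq).fun_sub
      ((((((hasDerivAt_id' x).sub_const k).fun_pow 2).sub_const t)).fun_mul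
        (h.hasDerivAt x).norm_sq)
    refine h1.congr_deriv ?_
    rw [← Complex.real_smul, real_inner_smul_right, real_inner_comm (Z x)]
    ring
  have hi' : IntegrableOn (fun x => -2 * ((x - k) * ‖Y x‖ ^ 2)) (Ioi 0) :=
    h.integrable_mul_norm_sq.const_mul _
  have hi : IntegrableOn (fun x => ‖Z x‖ ^ 2 - ((x - k) ^ 2 - t) * ‖Y x‖ ^ 2) (Ioi 0) := by
    refine (h.integrable_norm_deriv_sq.sub (h.integrable_sq_mul_norm_sq.sub
      (h.integrable_norm_sq.const_mul t))).congr (Filter.Eventually.of_forall fun x => ?_)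
    simp only [Pi.sub_apply]
    ring
  have hl := tendsto_zero_of_hasDerivAt_of_integrableOn_Ioi
    (fun x hx => hd x (Ioi_subset_Ici_self hx)) hi' hi
  have := integral_Ioi_of_hasDerivAt_of_tendsto' hd hi' hl
  rw [integral_const_mul, h.zero] at this
  simp at this
  linarith

/-- Green's formula between the eigenfunction and another solution `ψ` of the oscillator equation
which need not satisfy the Dirichlet condition. -/
theorem deriv_zero_mul_eq (h : IsDirichletSolution k t Y Z) {E : ℝ} {ψ ψ' : ℝ → ℝ}
    (h1 : ∀ x, HasDerivAt ψ (ψ' x) x)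
    (h2 : ∀ x, HasDerivAt ψ' (((x - k) ^ 2 - E) * ψ x) x)
    (m1 : MemLp ψ 2 (volume.restrict (Ioi 0))) (m2 : MemLp ψ' 2 (volume.restrict (Ioi 0))) :
    Z 0 * ψ 0 = ((t - E : ℝ) : ℂ) * ∫ x in Ioi 0, Y x * ψ x := by
  have m1' : MemLp (fun x => (ψ x : ℂ)) 2 (volume.restrict (Ioi 0)) := m1.ofReal
  have m2' : MemLp (fun x => (ψ' x : ℂ)) 2 (volume.restrict (Ioi 0)) := m2.ofReal
  have hd : ∀ x ∈ Ici (0 : ℝ), HasDerivAt (fun x => Z x * ψ x - Y x * ψ' x)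
      (-((t - E : ℝ) : ℂ) * (Y x * ψ x)) x := by
    intro x hx
    have h3 := ((h.hasDerivAt_deriv x hx).fun_mul (h1 x).ofReal_comp).fun_sub
      ((h.hasDerivAt x).fun_mul (h2 x).ofReal_comp)
    refine h3.congr_deriv ?_
    push_cast
    ring
  have hi' : IntegrableOn (fun x => -((t - E : ℝ) : ℂ) * (Y x * ψ x)) (Ioi 0) :=
    (h.memLp.integrable_mul m1').const_mul _
  have hi : IntegrableOn (fun x => Z x * ψ x - Y x * ψ' x) (Ioi 0) :=
    (h.memLp_deriv.integrable_mul m1').sub (h.memLp.integrable_mul m2')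
  have hl := tendsto_zero_of_hasDerivAt_of_integrableOn_Ioi
    (fun x hx => hd x (Ioi_subset_Ici_self hx)) hi' hi
  have := integral_Ioi_of_hasDerivAt_of_tendsto' hd hi' hl
  rw [integral_const_mul, h.zero] at this
  linear_combination this

theorem add_smul {Y' Z' : ℝ → ℂ} (h : IsDirichletSolution k t Y Z)
    (h' : IsDirichletSolution k t Y' Z') (a b : ℂ) :
    IsDirichletSolution k t (fun x => a * Y x + b * Y' x) (fun x => a * Z x + b * Z' x) where
  hasDerivAt x := ((h.hasDerivAt x).const_mul a).add ((h'.hasDerivAt x).const_mul b)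
  hasDerivAt_deriv x hx :=
    (((h.hasDerivAt_deriv x hx).const_mul a).add
      ((h'.hasDerivAt_deriv x hx).const_mul b)).congr_deriv (by ring)
  zero := by simp [h.zero, h'.zero]
  memLp := (h.memLp.const_mul a).add (h'.memLp.const_mul b)
  memLp_deriv := (h.memLp_deriv.const_mul a).add (h'.memLp_deriv.const_mul b)
  memLp_mul := ((h.memLp_mul.const_mul a).add (h'.memLp_mul.const_mul b)).ae_eq
    (Filter.Eventually.of_forall fun x => by simp only [Pi.add_apply]; ring)

/-- Uniqueness for the initial value problem: an eigenfunction with `Y'(0) = 0` vanishes. -/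
theorem eq_zero_of_deriv_zero (h : IsDirichletSolution k t Y Z) (h0 : Z 0 = 0) :
    ∀ x, 0 ≤ x → Y x = 0 := by
  intro b hb
  let f : ℝ → ℂ × ℂ := fun x => (Y x, Z x)
  have hdf : ∀ x, 0 ≤ x → HasDerivAt f (Z x, (((x - k) ^ 2 - t : ℝ) : ℂ) * Y x) x :=
    fun x hx => (h.hasDerivAt x).prodMk (h.hasDerivAt_deriv x hx)
  obtain ⟨M, hM⟩ := isCompact_Icc.exists_bound_of_continuousOn (s := Icc (0 : ℝ) b)
    (f := fun x : ℝ => (x - k) ^ 2 - t) (by fun_prop)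
  have hK : ∀ x ∈ Ico (0 : ℝ) b,
      ‖((Z x, (((x - k) ^ 2 - t : ℝ) : ℂ) * Y x) : ℂ × ℂ)‖ ≤ max 1 M * ‖f x‖ + 0 := by
    intro x hx
    rw [add_zero, Prod.norm_def]
    refine max_le ?_ ?_
    · calc ‖Z x‖ ≤ 1 * ‖f x‖ := by rw [one_mul]; exact norm_snd_le (f x)
        _ ≤ _ := by gcongr; exact le_max_left _ _
    · have h1 : ‖Y x‖ ≤ ‖f x‖ := norm_fst_le (f x)
      have h2 := hM x ⟨hx.1, hx.2.le⟩
      simp only [norm_mul, Complex.norm_real]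
      have h3 : M ≤ max 1 M := le_max_right _ _
      gcongr
      exact h2.trans h3
  have := norm_le_gronwallBound_of_norm_deriv_right_le (f := f) (δ := 0)
    (f' := fun x => (Z x, (((x - k) ^ 2 - t : ℝ) : ℂ) * Y x)) (a := 0) (b := b) (K := max 1 M)
    (ε := 0)
    (fun x hx => (hdf x hx.1).continuousAt.continuousWithinAt)
    (fun x hx => (hdf x hx.1).hasDerivWithinAt) (by simp [f, h.zero, h0]) hK b ⟨hb, le_rfl⟩
  rw [gronwallBound_ε0_δ0] at this
  have h4 : ‖Y b‖ ≤ ‖f b‖ := norm_fst_le (f b)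
  exact norm_le_zero_iff.1 (h4.trans this)

end IsDirichletSolution

/-- The eigenvalues of the fiber operator are simple. -/
theorem fiber_eigenvalue_simple {k t : ℝ} {u v : L2HalfLine}
    (hu : (u, (t : ℂ) • u) ∈ formGraph (fiberCore k))
    (hv : (v, (t : ℂ) • v) ∈ formGraph (fiberCore k)) (hu0 : u ≠ 0) : ∃ c : ℂ, v = c • u := by
  obtain ⟨Y, Z, hY, huY⟩ := exists_isDirichletSolution hu
  obtain ⟨Y', Z', hY', hvY⟩ := exists_isDirichletSolution hv
  have hZ : Z 0 ≠ 0 := by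
    intro h0
    refine hu0 ((Lp.eq_zero_iff_ae_eq_zero).2 ?_)
    filter_upwards [huY, ae_restrict_mem measurableSet_Ioi] with x h1 h2
    rw [h1, hY.eq_zero_of_deriv_zero h0 x (le_of_lt h2)]
    rfl
  have h := (hY.add_smul hY' (-(Z' 0)) (Z 0)).eq_zero_of_deriv_zero (by ring)
  refine ⟨Z' 0 / Z 0, Lp.ext ?_⟩
  filter_upwards [huY, hvY, Lp.coeFn_smul (Z' 0 / Z 0) u, ae_restrict_mem measurableSet_Ioi]
    with x h1 h2 h3 h4
  rw [h3, Pi.smul_apply, h1, h2, smul_eq_mul]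
  have := h x (le_of_lt h4)
  field_simp
  linear_combination this

/-! ### The gap on the fiber form domain, compactness and monotonicity -/

/-- Intersecting a subspace with a closed hyperplane commutes with taking the closure. -/
theorem mem_closure_inf_ker {E : Type*} [NormedAddCommGroup E] [NormedSpace ℂ E]
    (D : Submodule ℂ E) (l : E →L[ℂ] ℂ) {x : E} (hx : x ∈ D.topologicalClosure) (h0 : l x = 0) :
    x ∈ (D ⊓ LinearMap.ker (l : E →ₗ[ℂ] ℂ)).topologicalClosure := by
  by_cases hD : D ≤ LinearMap.ker (l : E →ₗ[ℂ] ℂ)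
  · rwa [inf_eq_left.2 hD]
  · obtain ⟨d, hd, hld⟩ := Set.not_subset.1 hD
    have hld' : l d ≠ 0 := hld
    -- the projection along `d` onto the kernel preserves `D`
    let T : E → E := fun y => y - (l y / l d) • d
    have hT : Continuous T := by fun_prop
    have hTx : T x = x := by simp [T, h0]
    rw [← hTx]
    refine map_mem_closure hT hx fun y hy => ?_
    refine ⟨D.sub_mem hy (D.smul_mem _ hd), ?_⟩
    change l (y - (l y / l d) • d) = 0
    rw [map_sub, map_smul, smul_eq_mul]
    field_simp
    ring

/-- Finitely many closed linear constraints may be imposed before taking the closure. -/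
theorem mem_closure_of_forall_eq_zero {E : Type*} [NormedAddCommGroup E] [NormedSpace ℂ E]
    (l : ℕ → E →L[ℂ] ℂ) (m : ℕ) : ∀ (D : Submodule ℂ E) {x : E}, x ∈ D.topologicalClosure →
    (∀ i < m, l i x = 0) → x ∈ closure {y | y ∈ D ∧ ∀ i < m, l i y = 0} := by
  induction m with
  | zero =>
    intro D x hx _
    have h : x ∈ closure (D : Set E) := hx
    simpa using h
  | succ m ih =>
    intro D x hx h
    have h1 := mem_closure_inf_ker D (l m) hx (h m (Nat.lt_succ_self m))
    refine closure_mono ?_ (ih _ h1 fun i hi => h i (Nat.lt_succ_of_lt hi))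
    rintro y ⟨⟨hyD, hyl⟩, hy⟩
    refine ⟨hyD, fun i hi => ?_⟩
    rcases Nat.lt_succ_iff_lt_or_eq.1 hi with h2 | rfl
    · exact hy i h2
    · exact hyl

theorem norm_sq_pair {α β : Type*} [NormedAddCommGroup α] [NormedAddCommGroup β]
    (x : WithLp 2 (α × β)) : ‖x‖ ^ 2 = ‖x.fst‖ ^ 2 + ‖x.snd‖ ^ 2 :=
  WithLp.prod_norm_sq_eq_of_L2 x

/-- A polynomial times the Gaussian is square integrable. -/
theorem integrable_pow_mul_gauss_sq (k : ℝ) (i : ℕ) :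
    Integrable fun x => ((x - k) ^ i * gauss k x) ^ 2 := by
  have h := (integrable_rpow_mul_exp_neg_mul_sq (b := 1) one_pos (s := ((2 * i : ℕ) : ℝ))
    (by
      have : (0 : ℝ) ≤ ((2 * i : ℕ) : ℝ) := Nat.cast_nonneg _
      linarith)).comp_sub_right k
  refine h.congr (Filter.Eventually.of_forall fun x => ?_)
  simp only
  rw [Real.rpow_natCast, mul_pow, ← pow_mul, mul_comm i 2, gauss, ← Real.exp_nat_mul]
  congr 2
  push_cast
  ring

theorem memLp_pow_mul_gauss (k : ℝ) (i : ℕ) :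
    MemLp (fun x => (x - k) ^ i * gauss k x) 2 (volume.restrict (Ioi 0)) := by
  have hc : Continuous fun x => (x - k) ^ i * gauss k x := by
    have := (contDiff_gauss k).continuous
    fun_prop
  exact ((memLp_two_iff_integrable_sq hc.aestronglyMeasurable).2
    (integrable_pow_mul_gauss_sq k i)).restrict _

/-- The functions `(x - k)^i e^(-(x - k)² / 2)`, restricted to the half-line. -/
def hermiteVec (k : ℝ) (i : ℕ) : L2HalfLine :=
  (memLp_pow_mul_gauss k i).ofReal.toLp (fun x => (((x - k) ^ i * gauss k x : ℝ) : ℂ))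

theorem hermiteVec_ae (k : ℝ) (i : ℕ) : hermiteVec k i =ᵐ[volume.restrict (Ioi 0)]
    fun x => (((x - k) ^ i * gauss k x : ℝ) : ℂ) := MemLp.coeFn_toLp _

/-- On the complement of `m` vectors, the Dirichlet form is at least `2 m + 1`. Extended by zero, a
test function on the half-line is a test function on the line, where the gap of the oscillator
applies. -/
theorem fiber_gap (k : ℝ) (m : ℕ) {z : WithLp 2 (L2HalfLine × WithLp 2 (L2HalfLine × L2HalfLine))}
    (hz : z ∈ formDomain (fiberCore k)) (h : ∀ i < m, ⟪hermiteVec k i, z.fst⟫_ℂ = 0) :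
    (2 * m + 1) * ‖z.fst‖ ^ 2 ≤ ‖z.snd‖ ^ 2 := by
  let l : ℕ → (L2HalfLine × WithLp 2 (L2HalfLine × L2HalfLine)) →L[ℂ] ℂ :=
    fun i => (innerSL ℂ (hermiteVec k i)) ∘L ContinuousLinearMap.fst ℂ _ _
  have hcl := mem_closure_of_forall_eq_zero l m (fiberCore k) (mem_formDomain.1 hz) h
  have hclosed : IsClosed {q : L2HalfLine × WithLp 2 (L2HalfLine × L2HalfLine) |
      (2 * m + 1) * ‖q.1‖ ^ 2 ≤ ‖q.2‖ ^ 2} :=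
    isClosed_le (by fun_prop) (by fun_prop)
  refine closure_minimal ?_ hclosed hcl
  rintro q ⟨⟨ψ, hψ, h1, h2, h3⟩, hl⟩
  change (2 * m + 1) * ‖q.1‖ ^ 2 ≤ ‖q.2‖ ^ 2
  have hψ' := hψ.mono (subset_univ _)
  have hc := hψ.continuous
  have hc' := hψ.continuous_deriv
  rw [norm_sq_pair, L2_norm_sq_eq_of_ae h1, L2_norm_sq_eq_of_ae h2, L2_norm_sq_eq_of_ae h3,
    hψ.setIntegral_eq _ fun x hx => by simp [hx],
    hψ.deriv.setIntegral_eq (fun x => ‖deriv ψ x‖ ^ 2) fun x hx => by simp [hx],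
    hψ.setIntegral_eq (fun x => ‖((x - k : ℝ) : ℂ) * ψ x‖ ^ 2) fun x hx => by simp [hx]]
  have i1 : Integrable fun x => ‖deriv ψ x‖ ^ 2 :=
    Continuous.integrable_of_hasCompactSupport (by fun_prop)
      (hψ.deriv.hasCompactSupport.comp_left (g := fun z : ℂ => ‖z‖ ^ 2) (by simp))
  have e : ∀ x, ‖((x - k : ℝ) : ℂ) * ψ x‖ ^ 2 = (x - k) ^ 2 * ‖ψ x‖ ^ 2 := fun x => by
    rw [norm_mul, Complex.norm_real, mul_pow, Real.norm_eq_abs, sq_abs]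
  simp_rw [e]
  have i2 : Integrable fun x => (x - k) ^ 2 * ‖ψ x‖ ^ 2 :=
    Continuous.integrable_of_hasCompactSupport (by fun_prop)
      ((hψ.hasCompactSupport.comp_left (g := fun z : ℂ => ‖z‖ ^ 2) (by simp)).mul_left)
  rw [← integral_add i1 i2]
  refine oscillator_gap k m ψ hψ' fun i hi => ?_
  have h4 : ⟪hermiteVec k i, q.1⟫_ℂ = 0 := hl i hi
  rw [L2_inner_eq_of_ae (hermiteVec_ae k i) h1] at h4
  simp_rw [Complex.conj_ofReal] at h4
  rw [hψ.setIntegral_eq _ fun x hx => by rw [hx, mul_zero]] at h4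
  rw [← h4]
  rfl

/-- The form domain embeds compactly, because the gaps `2 m + 1` tend to infinity. -/
theorem isCompactOperator_fiber (k : ℝ) : IsCompactOperator (formEmbedding (fiberCore k)) := by
  refine isCompactOperator_formEmbedding fun η hη => ?_
  obtain ⟨N, hN⟩ := exists_nat_gt (1 / η ^ 2)
  refine ⟨N, fun i => hermiteVec k i, fun z hz h => ?_⟩
  have h1 := fiber_gap k N hz fun i hi => h ⟨i, hi⟩
  have h2 : ‖z.snd‖ ^ 2 ≤ ‖z‖ ^ 2 := by
    rw [norm_sq_pair z]; linarith [sq_nonneg ‖z.fst‖]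
  refine le_of_sq_le_sq ?_ (by positivity)
  have h3 : 1 < η ^ 2 * N := by
    rw [div_lt_iff₀ (by positivity)] at hN
    linarith
  calc ‖z.fst‖ ^ 2 ≤ (η ^ 2 * N) * ‖z.fst‖ ^ 2 := by nlinarith [sq_nonneg ‖z.fst‖]
    _ ≤ η ^ 2 * ((2 * N + 1) * ‖z.fst‖ ^ 2) := by
      rw [mul_assoc]
      have : (0 : ℝ) ≤ N := Nat.cast_nonneg N
      gcongr
      linarith
    _ ≤ η ^ 2 * ‖z‖ ^ 2 := by gcongr; exact h1.trans h2
    _ = (η * ‖z‖) ^ 2 := by ring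

/-- There is an `n`-dimensional subspace of the form domain of `h(k)` on which the form is at
most `Λ`. By the min-max principle this expresses `λ_n(k) ≤ Λ`. -/
def FormBound (k : ℝ) (n : ℕ) (Λ : ℝ) : Prop :=
  ∃ W : Submodule ℂ (WithLp 2 (L2HalfLine × WithLp 2 (L2HalfLine × L2HalfLine))),
    W ≤ formDomain (fiberCore k) ∧ FiniteDimensional ℂ W ∧ Module.finrank ℂ W = n ∧
      ∀ z ∈ W, ‖z.snd‖ ^ 2 ≤ Λ * ‖z.fst‖ ^ 2

/-- Landau levels are lower bounds for the band functions. -/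
theorem FormBound.landauLevel_le {k : ℝ} {n : ℕ} {Λ : ℝ} (h : FormBound k n Λ) (hn : 1 ≤ n) :
    landauLevel n ≤ Λ := by
  obtain ⟨W, hW, hfin, hrank, hle⟩ := h
  obtain ⟨m, rfl⟩ : ∃ m, n = m + 1 := ⟨n - 1, by omega⟩
  let L : W →ₗ[ℂ] (Fin m → ℂ) := LinearMap.pi fun i =>
    (innerSL ℂ (hermiteVec k i)).toLinearMap ∘ₗ (WithLp.fstₗ 2 ℂ _ _) ∘ₗ W.subtype
  obtain ⟨⟨z, hzW⟩, hzk, hz0⟩ := Submodule.exists_mem_ne_zero_of_ne_bot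
    (LinearMap.ker_ne_bot_of_finrank_lt (f := L) (by rw [hrank]; simp))
  have horth : ∀ i < m, ⟪hermiteVec k i, z.fst⟫_ℂ = 0 := fun i hi => congrFun hzk ⟨i, hi⟩
  have h1 := fiber_gap k m (hW hzW) horth
  have h2 := hle z hzW
  have hpos : 0 < ‖z.fst‖ ^ 2 := by
    refine lt_of_le_of_ne (by positivity) fun h0 => hz0 ?_
    rw [← h0] at h2
    have h4 : z.snd = 0 := by
      have : ‖z.snd‖ ^ 2 ≤ 0 := by simpa using h2
      simpa using le_antisymm this (by positivity)
    have h3 : z.fst = 0 := by simpa using h0.symm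
    ext
    exact WithLp.ofLp_injective 2 (Prod.ext h3 h4)
  have := le_of_mul_le_mul_right (h1.trans h2) hpos
  rw [landauLevel]
  push_cast
  linarith

theorem memLp_shift {s : ℝ} (hs : 0 ≤ s) (f : L2HalfLine) :
    MemLp ((Ioi s).indicator fun x => f (x - s)) 2 (volume.restrict (Ioi (0 : ℝ))) := by
  rw [memLp_indicator_iff_restrict measurableSet_Ioi,
    Measure.restrict_restrict_of_subset (Ioi_subset_Ioi hs)]
  have h := (measurePreserving_sub_right (volume : Measure ℝ) s).restrict_preimage
    (measurableSet_Ioi (a := (0 : ℝ)))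
  have e : (fun x : ℝ => x - s) ⁻¹' Ioi 0 = Ioi s := by ext x; simp
  rw [e] at h
  exact (Lp.memLp f).comp_measurePreserving h

theorem ae_shift {s : ℝ} {f : ℝ → ℂ} {g : ℝ → ℂ}
    (h : f =ᵐ[volume.restrict (Ioi 0)] g) :
    ((Ioi s).indicator fun x => f (x - s)) =ᵐ[volume.restrict (Ioi (0 : ℝ))]
      (Ioi s).indicator fun x => g (x - s) := by
  have hm := (measurePreserving_sub_right (volume : Measure ℝ) s).restrict_preimage
    (measurableSet_Ioi (a := (0 : ℝ)))
  have e : (fun x : ℝ => x - s) ⁻¹' Ioi 0 = Ioi s := by ext x; simp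
  rw [e] at hm
  have h1 := hm.quasiMeasurePreserving.ae h
  have h2 := (ae_restrict_iff' measurableSet_Ioi).1 h1
  refine ae_restrict_of_ae ?_
  filter_upwards [h2] with x hx
  by_cases hxs : x ∈ Ioi s
  · rw [indicator_of_mem hxs, indicator_of_mem hxs, hx hxs]
  · rw [indicator_of_notMem hxs, indicator_of_notMem hxs]

/-- Translation to the right by `s ≥ 0`, extending by zero. -/
def shiftRight {s : ℝ} (hs : 0 ≤ s) : L2HalfLine →ₗᵢ[ℂ] L2HalfLine where
  toFun f := (memLp_shift hs f).toLp _
  map_add' f g := by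
    refine Lp.ext ?_
    filter_upwards [(memLp_shift hs (f + g)).coeFn_toLp, (memLp_shift hs f).coeFn_toLp,
      (memLp_shift hs g).coeFn_toLp, Lp.coeFn_add ((memLp_shift hs f).toLp _)
        ((memLp_shift hs g).toLp _), ae_shift (s := s) (Lp.coeFn_add f g)] with x h1 h2 h3 h4 h5
    rw [h1, h4, Pi.add_apply, h2, h3, h5]
    by_cases hx : x ∈ Ioi s
    · simp only [indicator_of_mem hx, Pi.add_apply]
    · simp only [indicator_of_notMem hx, add_zero]
  map_smul' c f := by
    refine Lp.ext ?_
    filter_upwards [(memLp_shift hs (c • f)).coeFn_toLp, (memLp_shift hs f).coeFn_toLp,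
      Lp.coeFn_smul c ((memLp_shift hs f).toLp _),
      ae_shift (s := s) (Lp.coeFn_smul c f)] with x h1 h2 h4 h5
    simp only [RingHom.id_apply]
    rw [h1, h4, Pi.smul_apply, h2, h5]
    by_cases hx : x ∈ Ioi s
    · simp only [indicator_of_mem hx, Pi.smul_apply]
    · simp only [indicator_of_notMem hx, smul_zero]
  norm_map' f := by
    have h1 : ‖(memLp_shift hs f).toLp _‖ ^ 2 = ‖f‖ ^ 2 := by
      rw [L2_norm_sq_eq_of_ae (memLp_shift hs f).coeFn_toLp, L2_norm_sq_eq_integral]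
      have e : (fun x : ℝ => x - s) ⁻¹' Ioi 0 = Ioi s := by ext x; simp
      have h2 := (measurePreserving_sub_right (volume : Measure ℝ) s).setIntegral_preimage_emb
        (MeasurableEquiv.subRight s).measurableEmbedding (fun x => ‖f x‖ ^ 2) (Ioi 0)
      rw [e] at h2
      rw [← h2]
      have h3 : ∀ x, ‖(Ioi s).indicator (fun x => f (x - s)) x‖ ^ 2
          = (Ioi s).indicator (fun x => ‖f (x - s)‖ ^ 2) x := fun x => by
        by_cases hx : x ∈ Ioi s
        · simp only [indicator_of_mem hx]
        · simp only [indicator_of_notMem hx]; simp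
      simp_rw [h3]
      rw [integral_indicator measurableSet_Ioi,
        Measure.restrict_restrict_of_subset (Ioi_subset_Ioi hs)]
    exact (sq_eq_sq₀ (norm_nonneg _) (norm_nonneg _)).1 h1

theorem shiftRight_ae {s : ℝ} (hs : 0 ≤ s) (f : L2HalfLine) :
    shiftRight hs f =ᵐ[volume.restrict (Ioi 0)] (Ioi s).indicator fun x => f (x - s) :=
  (memLp_shift hs f).coeFn_toLp

/-- Translating the fiber form domains: `λ_n` is non-increasing in `k`. -/
theorem FormBound.mono {k K : ℝ} (hkK : k ≤ K) {n : ℕ} {Λ : ℝ} (h : FormBound k n Λ) :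
    FormBound K n Λ := by
  obtain ⟨W, hW, hfin, hrank, hle⟩ := h
  have hs : 0 ≤ K - k := sub_nonneg.2 hkK
  let T := shiftRight hs
  let TT : WithLp 2 (L2HalfLine × WithLp 2 (L2HalfLine × L2HalfLine)) →ₗ[ℂ]
      WithLp 2 (L2HalfLine × WithLp 2 (L2HalfLine × L2HalfLine)) :=
    { toFun := fun z => WithLp.toLp 2 (T z.fst, WithLp.toLp 2 (T z.snd.fst, T z.snd.snd))
      map_add' := fun z w => by
        simp only [WithLp.add_fst, WithLp.add_snd, map_add]
        rfl
      map_smul' := fun c z => by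
        simp only [WithLp.smul_fst, WithLp.smul_snd, map_smul]
        rfl }
  have hinj : Function.Injective TT := by
    refine (injective_iff_map_eq_zero TT).2 fun z hz => ?_
    have h1 : T z.fst = 0 := congrArg WithLp.fst hz
    have h2 : T z.snd.fst = 0 := congrArg (fun y => y.snd.fst) hz
    have h3 : T z.snd.snd = 0 := congrArg (fun y => y.snd.snd) hz
    rw [map_eq_zero_iff T T.injective] at h1 h2 h3
    exact WithLp.ofLp_injective 2 (Prod.ext h1 (WithLp.ofLp_injective 2 (Prod.ext h2 h3)))
  refine ⟨W.map TT, ?_, inferInstance, ?_, ?_⟩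
  · rintro _ ⟨z, hz, rfl⟩
    have hz' := mem_formDomain.1 (hW hz)
    rw [mem_formDomain]
    let F : L2HalfLine × WithLp 2 (L2HalfLine × L2HalfLine) →
        L2HalfLine × WithLp 2 (L2HalfLine × L2HalfLine) :=
      fun q => (T q.1, WithLp.toLp 2 (T q.2.fst, T q.2.snd))
    have hF : Continuous F := by
      refine (T.continuous.comp continuous_fst).prodMk ?_
      refine (WithLp.prod_continuous_toLp 2 _ _).comp ?_
      exact (T.continuous.comp
        ((WithLp.fstL 2 ℂ L2HalfLine L2HalfLine).continuous.comp continuous_snd)).prodMk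
        (T.continuous.comp ((WithLp.sndL 2 ℂ L2HalfLine L2HalfLine).continuous.comp continuous_snd))
    refine map_mem_closure (f := F) hF hz' ?_
    rintro q ⟨ψ, hψ, h1, h2, h3⟩
    have hψs : IsTest (Ioi (K - k)) fun x => ψ (x - (K - k)) := by
      have hts : tsupport (fun x => ψ (x - (K - k))) ⊆ (fun x => x - (K - k)) ⁻¹' tsupport ψ :=
        closure_minimal (fun x hx => subset_tsupport ψ hx)
          (isClosed_closure.preimage (by fun_prop))
      refine ⟨hψ.contDiff.comp (contDiff_id.sub contDiff_const), ?_, ?_⟩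
      · exact hψ.hasCompactSupport.comp_homeomorph (Homeomorph.subRight (K - k))
      · intro x hx
        have h4 : 0 < x - (K - k) := hψ.tsupport_subset (hts hx)
        change K - k < x
        linarith
    have hind : ∀ g : ℝ → ℂ, (∀ x, x ∉ Ioi (0 : ℝ) → g x = 0) →
        ((Ioi (K - k)).indicator fun x => g (x - (K - k))) = fun x => g (x - (K - k)) := by
      intro g hg
      funext x
      by_cases hx : x ∈ Ioi (K - k)
      · rw [indicator_of_mem hx]
      · rw [indicator_of_notMem hx, hg]
        intro h5
        apply hx
        have h6 : 0 < x - (K - k) := h5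
        change K - k < x
        linarith
    refine ⟨_, hψs.mono (Ioi_subset_Ioi hs), ?_, ?_, ?_⟩
    · refine (shiftRight_ae hs q.1).trans ((ae_shift h1).trans ?_)
      rw [hind ψ fun x hx => hψ.eq_zero_of_notMem hx]
    · refine (shiftRight_ae hs q.2.fst).trans ((ae_shift h2).trans ?_)
      rw [hind _ fun x hx => hψ.deriv.eq_zero_of_notMem hx]
      refine Filter.Eventually.of_forall fun x => ?_
      simp only
      rw [deriv_comp_sub_const]
    · refine (shiftRight_ae hs q.2.snd).trans ((ae_shift h3).trans ?_)
      rw [hind (fun x => ((x - k : ℝ) : ℂ) * ψ x) fun x hx => by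
        rw [hψ.eq_zero_of_notMem hx, mul_zero]]
      refine Filter.Eventually.of_forall fun x => ?_
      simp only
      congr 2
      ring
  · rw [← hrank]
    exact (Submodule.equivMapOfInjective TT hinj W).finrank_eq.symm
  · rintro _ ⟨z, hz, rfl⟩
    have h1 : ‖(TT z).fst‖ = ‖z.fst‖ := T.norm_map _
    have h2 : ‖(TT z).snd‖ ^ 2 = ‖z.snd‖ ^ 2 := by
      rw [norm_sq_pair, norm_sq_pair]
      change ‖T z.snd.fst‖ ^ 2 + ‖T z.snd.snd‖ ^ 2 = _
      rw [T.norm_map, T.norm_map]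
    rw [h1, h2]
    exact hle z hz

/-! ### Band functions and the min-max principle -/

/-- `t` is an upper bound for at least `m` eigenvalues of `h(k)`, counted with multiplicity. -/
def HasEigenvalues (k : ℝ) (m : ℕ) (t : ℝ) : Prop :=
  ∃ v : Fin m → L2HalfLine, LinearIndependent ℂ v ∧
    ∀ i, ∃ s ≤ t, IsNormalizedEigenvector (fiberOperator k) s (v i)

theorem bandFunction_eq (m : ℕ) (k : ℝ) : bandFunction m k = sInf {t | HasEigenvalues k m t} := rfl

theorem isNormalizedEigenvector_fiber_iff {k t : ℝ} {u : L2HalfLine} :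
    IsNormalizedEigenvector (fiberOperator k) t u ↔
      ‖u‖ = 1 ∧ (u, (t : ℂ) • u) ∈ formGraph (fiberCore k) :=
  isNormalizedEigenvector_iff (fiberOperator_graph k)

/-- Eigenvectors for different eigenvalues are orthogonal. -/
theorem inner_eq_zero_of_ne {k s t : ℝ} {u v : L2HalfLine}
    (hu : (u, (s : ℂ) • u) ∈ formGraph (fiberCore k))
    (hv : (v, (t : ℂ) • v) ∈ formGraph (fiberCore k)) (hst : s ≠ t) : ⟪u, v⟫_ℂ = 0 := by
  obtain ⟨g, hg, h⟩ := hu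
  obtain ⟨g', hg', h'⟩ := hv
  have h1 := inner_eq_of_mem_topologicalClosure h' hg
  have h2 := inner_eq_of_mem_topologicalClosure h hg'
  simp only [inner_smul_right] at h1 h2
  have h3 : (t : ℂ) * ⟪u, v⟫_ℂ = s * ⟪u, v⟫_ℂ := by
    rw [← h1, ← inner_conj_symm g g', h2, map_mul, inner_conj_symm, Complex.conj_ofReal]
  have h4 : ((t : ℂ) - s) * ⟪u, v⟫_ℂ = 0 := by linear_combination h3
  rcases mul_eq_zero.1 h4 with h5 | h5
  · exact absurd (by exact_mod_cast (sub_eq_zero.1 h5).symm) hst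
  · exact h5

/-- `m` eigenvalues below `t` provide an `m`-dimensional space on which the form is at
most `t`: since the spectrum is simple, the eigenvectors are orthonormal. -/
theorem HasEigenvalues.formBound {k : ℝ} {m : ℕ} {t : ℝ} (h : HasEigenvalues k m t) :
    FormBound k m t := by
  obtain ⟨v, hv, hs⟩ := h
  choose s hst hs using hs
  simp_rw [isNormalizedEigenvector_fiber_iff] at hs
  have hinj : ∀ i j, i ≠ j → s i ≠ s j := by
    intro i j hij e
    have hj := (hs j).2
    rw [← e] at hj
    obtain ⟨c, hc⟩ := fiber_eigenvalue_simple (hs i).2 hj (hv.ne_zero i)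
    refine hv.notMem_span_image (s := {i}) (x := j) (by simpa using hij.symm) ?_
    rw [image_singleton, hc]
    exact Submodule.smul_mem _ c (Submodule.mem_span_singleton_self _)
  have hort : Orthonormal ℂ v :=
    ⟨fun i => (hs i).1, fun i j hij => inner_eq_zero_of_ne (hs i).2 (hs j).2 (hinj i j hij)⟩
  have hs2 := fun i => (hs i).2
  choose g hg hgi using hs2
  let z : Fin m → WithLp 2 (L2HalfLine × WithLp 2 (L2HalfLine × L2HalfLine)) :=
    fun i => WithLp.toLp 2 (v i, g i)
  have hz : ∀ i, z i ∈ formDomain (fiberCore k) := fun i => hg i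
  have hzind : LinearIndependent ℂ z :=
    LinearIndependent.of_comp (WithLp.fstₗ 2 ℂ _ _) hv
  refine ⟨Submodule.span ℂ (range z), Submodule.span_le.2 ?_,
    FiniteDimensional.span_of_finite ℂ (finite_range z), ?_, ?_⟩
  · rintro _ ⟨i, rfl⟩
    exact hz i
  · rw [finrank_span_eq_card hzind, Fintype.card_fin]
  · intro w hw
    have hwd : w ∈ formDomain (fiberCore k) :=
      (Submodule.span_le.2 (by rintro _ ⟨i, rfl⟩; exact hz i)) hw
    obtain ⟨c, rfl⟩ := (Submodule.mem_span_range_iff_exists_fun ℂ).1 hw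
    set w := ∑ i, c i • z i with hwdef
    have e1 : w.fst = ∑ i, c i • v i := by
      have := map_sum (WithLp.fstₗ 2 ℂ L2HalfLine (WithLp 2 (L2HalfLine × L2HalfLine)))
        (fun i => c i • z i) Finset.univ
      exact this
    have e2 : w.snd = ∑ i, c i • g i := by
      have := map_sum (WithLp.sndₗ 2 ℂ L2HalfLine (WithLp 2 (L2HalfLine × L2HalfLine)))
        (fun i => c i • z i) Finset.univ
      exact this
    have e3 : ∀ i, ⟪w.snd, g i⟫_ℂ = s i * (starRingEnd ℂ) (c i) := fun i => by
      have h1 := inner_eq_of_mem_topologicalClosure (hgi i) (mem_formDomain.1 hwd)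
      simp only [inner_smul_right] at h1
      rw [h1, e1, hort.inner_left_fintype]
    have e4 : ‖w.fst‖ ^ 2 = ∑ i, ‖c i‖ ^ 2 := by
      have h1 : ⟪w.fst, w.fst⟫_ℂ = ∑ i, (starRingEnd ℂ) (c i) * c i := by
        rw [e1, hort.inner_sum]
      rw [inner_self_eq_norm_sq_to_K] at h1
      simp_rw [conj_mul'] at h1
      apply Complex.ofReal_injective
      push_cast
      exact h1
    have e5 : ‖w.snd‖ ^ 2 = ∑ i, s i * ‖c i‖ ^ 2 := by
      have h1 : ⟪w.snd, w.snd⟫_ℂ = ∑ i, c i * (s i * (starRingEnd ℂ) (c i)) := by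
        conv_lhs => rw [e2, inner_sum, ← e2]
        simp_rw [inner_smul_right, e3]
      rw [inner_self_eq_norm_sq_to_K] at h1
      have h2 : ∀ i, c i * (s i * (starRingEnd ℂ) (c i)) = ((s i * ‖c i‖ ^ 2 : ℝ) : ℂ) :=
        fun i => by
          push_cast
          rw [← conj_mul']
          ring
      simp_rw [h2] at h1
      apply Complex.ofReal_injective
      push_cast at h1 ⊢
      exact h1
    rw [e4, e5, Finset.mul_sum]
    exact Finset.sum_le_sum fun i _ => by gcongr; exact hst i

theorem FormBound.hasEigenvalues {k : ℝ} {m : ℕ} {t t' : ℝ} (h : FormBound k m t) (h0 : 0 ≤ t)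
    (htt' : t < t') : HasEigenvalues k m t' := by
  obtain ⟨W, hW, hfin, hrank, hle⟩ := h
  exact exists_eigenvectors_of_form_le (fiberOperator_graph k) (isCompactOperator_fiber k) h0 htt'
    W hW hrank hle

theorem one_le_landauLevel {n : ℕ} (hn : 1 ≤ n) : 1 ≤ landauLevel n := by
  have : (1 : ℝ) ≤ n := by exact_mod_cast hn
  rw [landauLevel]
  linarith

theorem bddBelow_hasEigenvalues {n : ℕ} (hn : 1 ≤ n) (k : ℝ) :
    BddBelow {t | HasEigenvalues k n t} :=
  ⟨landauLevel n, fun _ ht => (HasEigenvalues.formBound ht).landauLevel_le hn⟩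

/-- The upper bound in the min-max principle. -/
theorem FormBound.bandFunction_le {k : ℝ} {n : ℕ} {t : ℝ} (h : FormBound k n t) (hn : 1 ≤ n) :
    bandFunction n k ≤ t := by
  have h0 : 0 ≤ t := by linarith [one_le_landauLevel hn, h.landauLevel_le hn]
  refine le_of_forall_gt_imp_ge_of_dense fun t' ht' => ?_
  exact csInf_le (bddBelow_hasEigenvalues hn k) (h.hasEigenvalues h0 ht')

section Family

variable {u : ℕ → ℝ → L2HalfLine}

/-- An operator with less than `m` eigenvalues would get the junk value `λ_m = 0`, which is not an
eigenvalue of `h(k) ≥ 1`. -/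
theorem IsEigenfunctionFamily.nonempty (hu : IsEigenfunctionFamily u) {m : ℕ} (hm : 1 ≤ m)
    (k : ℝ) : {t | HasEigenvalues k m t}.Nonempty := by
  by_contra hne
  have h0 : bandFunction m k = 0 := by
    rw [bandFunction_eq, not_nonempty_iff_eq_empty.1 hne, Real.sInf_empty]
  have hm' := hu m hm k
  rw [h0] at hm'
  have h1 : HasEigenvalues k 1 0 :=
    ⟨fun _ => u m k, LinearIndependent.of_subsingleton 0 (by
      intro h2
      have := hm'.1
      rw [h2, norm_zero] at this
      exact zero_ne_one this), fun _ => ⟨0, le_rfl, hm'⟩⟩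
  linarith [h1.formBound.landauLevel_le le_rfl, one_le_landauLevel (le_refl 1)]

theorem IsEigenfunctionFamily.formBound (hu : IsEigenfunctionFamily u) {m : ℕ} (hm : 1 ≤ m)
    {k t : ℝ} (ht : bandFunction m k < t) : FormBound k m t := by
  obtain ⟨s, hs, hst⟩ := exists_lt_of_csInf_lt (hu.nonempty hm k) ht
  obtain ⟨v, hv, hs'⟩ : HasEigenvalues k m s := hs
  exact HasEigenvalues.formBound ⟨v, hv, fun i => let ⟨r, hr, h⟩ := hs' i; ⟨r, hr.trans hst.le, h⟩⟩

theorem IsEigenfunctionFamily.landauLevel_le (hu : IsEigenfunctionFamily u) {m : ℕ} (hm : 1 ≤ m)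
    (k : ℝ) : landauLevel m ≤ bandFunction m k :=
  le_of_forall_gt_imp_ge_of_dense fun _ ht => (hu.formBound hm ht).landauLevel_le hm

theorem IsEigenfunctionFamily.antitone (hu : IsEigenfunctionFamily u) {m : ℕ} (hm : 1 ≤ m) :
    Antitone (bandFunction m) := fun _ _ hkK =>
  le_of_forall_gt_imp_ge_of_dense fun _ ht => ((hu.formBound hm ht).mono hkK).bandFunction_le hm

/-- Every eigenvector of `h(k)` is a multiple of a member of the family. -/
theorem IsEigenfunctionFamily.exists_eq_smul (hu : IsEigenfunctionFamily u) {k t : ℝ}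
    {e : L2HalfLine} (he : IsNormalizedEigenvector (fiberOperator k) t e) :
    ∃ m, 1 ≤ m ∧ ∃ c : ℂ, e = c • u m k := by
  classical
  have he' := isNormalizedEigenvector_fiber_iff.1 he
  have he0 : e ≠ 0 := fun h => by
    have := he'.1
    rw [h, norm_zero] at this
    exact zero_ne_one this
  have h1 : HasEigenvalues k 1 t :=
    ⟨fun _ => e, LinearIndependent.of_subsingleton 0 he0, fun _ => ⟨t, le_rfl, he⟩⟩
  have hbound : ∀ m, HasEigenvalues k m t → m ≤ ⌈t⌉₊ := by
    intro m hm
    rcases Nat.eq_zero_or_pos m with rfl | hpos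
    · exact Nat.zero_le _
    · have h2 := hm.formBound.landauLevel_le hpos
      have h3 : (1 : ℝ) ≤ m := by exact_mod_cast hpos
      rw [landauLevel] at h2
      exact_mod_cast (show (m : ℝ) ≤ t by linarith).trans (Nat.le_ceil t)
  -- the index of `e` is the number of eigenvalues up to `t`
  let m := Nat.findGreatest (fun m => HasEigenvalues k m t) ⌈t⌉₊
  have hm1 : 1 ≤ m := Nat.le_findGreatest (hbound 1 h1) h1
  have hm : HasEigenvalues k m t :=
    Nat.findGreatest_spec (P := fun m => HasEigenvalues k m t) (hbound 1 h1) h1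
  have hsucc : ¬ HasEigenvalues k (m + 1) t := fun h =>
    absurd (Nat.le_findGreatest (P := fun m => HasEigenvalues k m t) (hbound _ h) h) (by
      change ¬ (m + 1 ≤ m)
      omega)
  have hle : bandFunction m k ≤ t := csInf_le (bddBelow_hasEigenvalues hm1 k) hm
  have heq : bandFunction m k = t := by
    refine hle.eq_of_not_lt fun hlt => hsucc ?_
    obtain ⟨s, hs, hst⟩ := exists_lt_of_csInf_lt (hu.nonempty hm1 k) hlt
    obtain ⟨v, hv, hs'⟩ : HasEigenvalues k m s := hs
    refine ⟨Fin.cons e v, ?_, ?_⟩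
    · rw [linearIndependent_finCons]
      refine ⟨hv, fun hmem => he0 ?_⟩
      have horth : ∀ w ∈ Submodule.span ℂ (range v), ⟪w, e⟫_ℂ = 0 := by
        intro w hw
        induction hw using Submodule.span_induction with
        | mem x hx =>
          obtain ⟨i, rfl⟩ := hx
          obtain ⟨r, hr, hri⟩ := hs' i
          exact inner_eq_zero_of_ne (isNormalizedEigenvector_fiber_iff.1 hri).2 he'.2
            (by linarith : r < t).ne
        | zero => simp
        | add x y _ _ hx hy => rw [inner_add_left, hx, hy, add_zero]
        | smul a x _ hx => rw [inner_smul_left, hx, mul_zero]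
      exact inner_self_eq_zero.1 (horth e hmem)
    · intro i
      refine Fin.cases ⟨t, le_rfl, he⟩ (fun i => ?_) i
      obtain ⟨r, hr, hri⟩ := hs' i
      exact ⟨r, hr.trans hst.le, hri⟩
  have hum := hu m hm1 k
  rw [heq, isNormalizedEigenvector_fiber_iff] at hum
  refine ⟨m, hm1, fiber_eigenvalue_simple hum.2 he'.2 fun h => ?_⟩
  have := hum.1
  rw [h, norm_zero] at this
  exact zero_ne_one this

/-- Completeness of the eigenfunctions: a vector orthogonal to all but one of them is a multiple
of the remaining one. -/
theorem IsEigenfunctionFamily.eq_smul_of_inner (hu : IsEigenfunctionFamily u) {n : ℕ} (hn : 1 ≤ n)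
    {k : ℝ} {f : L2HalfLine} (hf : ∀ m, 1 ≤ m → m ≠ n → ⟪u m k, f⟫_ℂ = 0) :
    ∃ c : ℂ, f = c • u n k := by
  refine ⟨⟪u n k, f⟫_ℂ, sub_eq_zero.1 ?_⟩
  have hun := isNormalizedEigenvector_fiber_iff.1 (hu n hn k)
  have hn0 : ⟪u n k, f - ⟪u n k, f⟫_ℂ • u n k⟫_ℂ = 0 := by
    rw [inner_sub_right, inner_smul_right, inner_self_eq_norm_sq_to_K, hun.1]
    simp
  refine eq_zero_of_inner_eigenvector (fiberCore_total k) (isCompactOperator_fiber k)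
    fun e t he1 he => ?_
  obtain ⟨m, hm, c, rfl⟩ := hu.exists_eq_smul (isNormalizedEigenvector_fiber_iff.2 ⟨he1, he⟩)
  have hum := isNormalizedEigenvector_fiber_iff.1 (hu m hm k)
  rw [inner_smul_left]
  refine mul_eq_zero_of_right _ ?_
  by_cases hmn : m = n
  · rw [hmn, hn0]
  by_cases hb : bandFunction m k = bandFunction n k
  · have h1 := hum.2
    rw [hb] at h1
    obtain ⟨c', hc'⟩ := fiber_eigenvalue_simple hun.2 h1 fun h => by
      have := hun.1
      rw [h, norm_zero] at this
      exact zero_ne_one this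
    rw [hc', inner_smul_left, hn0, mul_zero]
  · rw [inner_sub_right, hf m hm hmn, inner_smul_right, inner_eq_zero_of_ne hum.2 hun.2 hb,
      mul_zero, sub_zero]

end Family

/-! ### Functions vanishing at the boundary belong to the form domain -/

/-- Dominated convergence in `L²`. -/
theorem tendsto_toLp_of_dominated {α : Type*} [MeasurableSpace α] {μ : Measure α}
    {F : ℕ → α → ℂ} {f : α → ℂ} {G : α → ℝ} (hF : ∀ j, MemLp (F j) 2 μ) (hf : MemLp f 2 μ)
    (hG : MemLp G 2 μ) (hb : ∀ j, ∀ᵐ x ∂μ, ‖F j x - f x‖ ≤ G x)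
    (hlim : ∀ᵐ x ∂μ, Filter.Tendsto (fun j => F j x) Filter.atTop (nhds (f x))) :
    Filter.Tendsto (fun j => (hF j).toLp (F j)) Filter.atTop (nhds (hf.toLp f)) := by
  rw [tendsto_iff_norm_sub_tendsto_zero]
  have h1 : ∀ j, ‖(hF j).toLp (F j) - hf.toLp f‖ = Real.sqrt (∫ x, ‖F j x - f x‖ ^ 2 ∂μ) := by
    intro j
    have h := L2_norm_sq_eq_of_ae (f := (hF j).toLp (F j) - hf.toLp f) (g := fun x => F j x - f x)
      (by
        filter_upwards [Lp.coeFn_sub ((hF j).toLp (F j)) (hf.toLp f), (hF j).coeFn_toLp,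
          hf.coeFn_toLp] with x e1 e2 e3
        rw [e1, Pi.sub_apply, e2, e3])
    rw [← h, Real.sqrt_sq (norm_nonneg _)]
  simp_rw [h1]
  have h2 : Filter.Tendsto (fun j => ∫ x, ‖F j x - f x‖ ^ 2 ∂μ) Filter.atTop
      (nhds (∫ _, (0 : ℝ) ∂μ)) := by
    refine tendsto_integral_of_dominated_convergence (fun x => G x ^ 2) ?_ hG.integrable_sq ?_ ?_
    · intro j
      exact (((hF j).sub hf).aestronglyMeasurable.norm).pow 2
    · intro j
      filter_upwards [hb j] with x hx
      rw [Real.norm_of_nonneg (by positivity)]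
      exact pow_le_pow_left₀ (norm_nonneg _) hx 2
    · filter_upwards [hlim] with x hx
      have h3 := ((tendsto_iff_norm_sub_tendsto_zero.1 hx).pow 2)
      simpa using h3
  rw [integral_zero] at h2
  have h3 := (Real.continuous_sqrt.tendsto 0).comp h2
  rw [Real.sqrt_zero] at h3
  exact h3

theorem deriv_smoothTransition_eq_zero {x : ℝ} (hx : x < 0 ∨ 1 < x) :
    deriv Real.smoothTransition x = 0 := by
  rcases hx with hx | hx
  · have h : Real.smoothTransition =ᶠ[nhds x] fun _ => (0 : ℝ) := by
      filter_upwards [Iio_mem_nhds hx] with y hy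
      exact Real.smoothTransition.zero_of_nonpos (le_of_lt hy)
    rw [h.deriv_eq, deriv_const]
  · have h : Real.smoothTransition =ᶠ[nhds x] fun _ => (1 : ℝ) := by
      filter_upwards [Ioi_mem_nhds hx] with y hy
      exact Real.smoothTransition.one_of_one_le (le_of_lt hy)
    rw [h.deriv_eq, deriv_const]

theorem exists_abs_deriv_smoothTransition_le :
    ∃ M : ℝ, 0 ≤ M ∧ ∀ x, |deriv Real.smoothTransition x| ≤ M := by
  have hc : Continuous (deriv Real.smoothTransition) :=
    (Real.smoothTransition.contDiff (n := ⊤)).continuous_deriv (by simp)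
  obtain ⟨M, hM⟩ := isCompact_Icc.exists_bound_of_continuousOn (s := Icc (0 : ℝ) 1) hc.continuousOn
  refine ⟨max M 0, le_max_right _ _, fun x => ?_⟩
  by_cases hx : x ∈ Icc (0 : ℝ) 1
  · exact (hM x hx).trans (le_max_left _ _)
  · rw [deriv_smoothTransition_eq_zero, abs_zero]
    · exact le_max_right _ _
    · by_contra! h
      exact hx h

/-- A smooth cutoff which vanishes near `0` and near `∞`, and tends to `1` on `(0, ∞)`. -/
def cutoff (j : ℕ) (x : ℝ) : ℝ :=
  Real.smoothTransition ((j + 1) * x - 1) * Real.smoothTransition (j + 2 - x)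

theorem contDiff_cutoff (j : ℕ) : ContDiff ℝ ∞ (cutoff j) := by
  have h1 : ContDiff ℝ ∞ fun x : ℝ => ((j : ℝ) + 1) * x - 1 := by fun_prop
  have h2 : ContDiff ℝ ∞ fun x : ℝ => (j : ℝ) + 2 - x := by fun_prop
  exact ((Real.smoothTransition.contDiff (n := ⊤)).comp h1).mul
    ((Real.smoothTransition.contDiff (n := ⊤)).comp h2)

theorem cutoff_nonneg (j : ℕ) (x : ℝ) : 0 ≤ cutoff j x :=
  mul_nonneg (Real.smoothTransition.nonneg _) (Real.smoothTransition.nonneg _)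

theorem cutoff_le_one (j : ℕ) (x : ℝ) : cutoff j x ≤ 1 :=
  mul_le_one₀ (Real.smoothTransition.le_one _) (Real.smoothTransition.nonneg _)
    (Real.smoothTransition.le_one _)

theorem tsupport_cutoff_subset (j : ℕ) :
    tsupport (cutoff j) ⊆ Icc (1 / ((j : ℝ) + 1)) (j + 2) := by
  refine closure_minimal (fun x hx => ?_) isClosed_Icc
  have hx' : cutoff j x ≠ 0 := hx
  have hj : (0 : ℝ) < j + 1 := by positivity
  constructor
  · by_contra! h
    apply hx'
    rw [lt_div_iff₀ hj] at h
    rw [cutoff, Real.smoothTransition.zero_of_nonpos, zero_mul]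
    linarith
  · by_contra! h
    apply hx'
    rw [cutoff, Real.smoothTransition.zero_of_nonpos (x := (j : ℝ) + 2 - x), mul_zero]
    linarith

theorem hasDerivAt_cutoff (j : ℕ) (x : ℝ) : HasDerivAt (cutoff j)
    ((j + 1) * deriv Real.smoothTransition ((j + 1) * x - 1) * Real.smoothTransition (j + 2 - x)
      - Real.smoothTransition ((j + 1) * x - 1) * deriv Real.smoothTransition (j + 2 - x)) x := by
  have hσ : ∀ y, HasDerivAt Real.smoothTransition (deriv Real.smoothTransition y) y := fun y =>
    ((Real.smoothTransition.contDiff (n := ⊤)).differentiable (by simp) y).hasDerivAt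
  have h1 : HasDerivAt (fun x : ℝ => ((j : ℝ) + 1) * x - 1) (j + 1) x := by
    simpa using ((hasDerivAt_id' x).const_mul ((j : ℝ) + 1)).sub_const 1
  have h2 : HasDerivAt (fun x : ℝ => (j : ℝ) + 2 - x) (-1) x := by
    simpa using (hasDerivAt_id' x).const_sub ((j : ℝ) + 2)
  have h3 := ((hσ _).comp x h1).mul ((hσ _).comp x h2)
  exact h3.congr_deriv (by simp only [Function.comp_apply]; ring)

theorem eventually_cutoff_eq {x : ℝ} (hx : 0 < x) :
    ∀ᶠ j in Filter.atTop, cutoff j x = 1 ∧ deriv (cutoff j) x = 0 := by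
  obtain ⟨N, hN⟩ := exists_nat_gt (max (3 / x) x)
  filter_upwards [Filter.eventually_ge_atTop N] with j hj
  have hj' : (N : ℝ) ≤ j := by exact_mod_cast hj
  have h1 : 3 < (j : ℝ) * x := by
    have := (le_max_left (3 / x) x).trans_lt (hN.trans_le hj')
    rwa [div_lt_iff₀ hx] at this
  have h2 : x < j := (le_max_right (3 / x) x).trans_lt (hN.trans_le hj')
  have h3 : 1 < ((j : ℝ) + 1) * x - 1 := by nlinarith
  have h4 : 1 < (j : ℝ) + 2 - x := by linarith
  constructor
  · rw [cutoff, Real.smoothTransition.one_of_one_le h3.le,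
      Real.smoothTransition.one_of_one_le h4.le, mul_one]
  · rw [(hasDerivAt_cutoff j x).deriv, deriv_smoothTransition_eq_zero (.inr h3),
      deriv_smoothTransition_eq_zero (.inr h4)]
    ring

/-- A smooth function with `f(0) = 0` and finite energy lies in the domain of the closed form: it
is the limit of its products with cutoff functions. -/
theorem exists_mem_formDomain (k : ℝ) {f : ℝ → ℂ} (hf : ContDiff ℝ ∞ f) (h0 : f 0 = 0)
    (m0 : MemLp f 2 (volume.restrict (Ioi 0))) (m1 : MemLp (deriv f) 2 (volume.restrict (Ioi 0)))
    (m2 : MemLp (fun x => ((x - k : ℝ) : ℂ) * f x) 2 (volume.restrict (Ioi 0))) :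
    ∃ z ∈ formDomain (fiberCore k), z.fst =ᵐ[volume.restrict (Ioi 0)] f ∧
      z.snd.fst =ᵐ[volume.restrict (Ioi 0)] deriv f ∧
      z.snd.snd =ᵐ[volume.restrict (Ioi 0)] fun x => ((x - k : ℝ) : ℂ) * f x := by
  have hfd : ∀ x, HasDerivAt f (deriv f x) x := fun x =>
    (hf.differentiable (by simp) x).hasDerivAt
  have hfc : Continuous (deriv f) := hf.continuous_deriv (by simp)
  obtain ⟨M, hM0, hM⟩ := exists_abs_deriv_smoothTransition_le
  obtain ⟨B, hB⟩ := isCompact_Icc.exists_bound_of_continuousOn (s := Icc (0 : ℝ) 2) hfc.continuousOn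
  have hfB : ∀ x ∈ Icc (0 : ℝ) 2, ‖f x‖ ≤ B * x := fun x hx => by
    have := (convex_Icc (0 : ℝ) 2).norm_image_sub_le_of_norm_deriv_le
      (fun y _ => (hfd y).differentiableAt) hB (left_mem_Icc.2 zero_le_two) hx
    simpa [h0, abs_of_nonneg hx.1] using this
  have hB0 : 0 ≤ B := (norm_nonneg _).trans (hB 0 (left_mem_Icc.2 zero_le_two))
  let F : ℕ → ℝ → ℂ := fun j x => (cutoff j x : ℂ) * f x
  have hηsupp : ∀ j, tsupport (fun x => (cutoff j x : ℂ)) = tsupport (cutoff j) := fun j => by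
    unfold tsupport
    congr 1
    ext x
    simp
  have hF : ∀ j, IsTest (Ioi 0) (F j) := fun j => by
    refine ⟨(ofRealCLM.contDiff.comp (contDiff_cutoff j)).mul hf, ?_, ?_⟩
    · refine HasCompactSupport.mul_right (f := fun x => (cutoff j x : ℂ)) ?_
      unfold HasCompactSupport
      rw [hηsupp]
      exact isCompact_Icc.of_isClosed_subset isClosed_closure (tsupport_cutoff_subset j)
    · refine (tsupport_mul_subset_left (f := fun x => (cutoff j x : ℂ))).trans ?_
      rw [hηsupp]
      intro x hx
      exact lt_of_lt_of_le (by positivity) (tsupport_cutoff_subset j hx).1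
  have hdF : ∀ j x, deriv (F j) x
      = ((deriv (cutoff j) x : ℝ) : ℂ) * f x + (cutoff j x : ℂ) * deriv f x :=
    fun j x => (((hasDerivAt_cutoff j x).differentiableAt.hasDerivAt.ofReal_comp).mul (hfd x)).deriv
  have n0 := fun j => (hF j).memLp (volume.restrict (Ioi (0 : ℝ)))
  have n1 := fun j => (hF j).deriv.memLp (volume.restrict (Ioi (0 : ℝ)))
  have n2 := fun j => ((hF j).mul_sub_const k).memLp (volume.restrict (Ioi (0 : ℝ)))
  have hc1 : ∀ j x, ‖(cutoff j x : ℂ) - 1‖ ≤ 1 := fun j x => by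
    rw [← Complex.ofReal_one, ← Complex.ofReal_sub, Complex.norm_real, Real.norm_eq_abs, abs_le]
    constructor <;> linarith [cutoff_nonneg j x, cutoff_le_one j x]
  have l0 : Filter.Tendsto (fun j => (n0 j).toLp (F j)) Filter.atTop (nhds (m0.toLp f)) := by
    refine tendsto_toLp_of_dominated n0 m0 m0.norm
      (fun j => Filter.Eventually.of_forall fun x => ?_)
      ?_
    · have : F j x - f x = ((cutoff j x : ℂ) - 1) * f x := by simp only [F]; ring
      rw [this, norm_mul]
      exact mul_le_of_le_one_left (norm_nonneg _) (hc1 j x)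
    · refine (ae_restrict_iff' measurableSet_Ioi).2 (Filter.Eventually.of_forall fun x hx => ?_)
      refine tendsto_const_nhds.congr' ?_
      filter_upwards [eventually_cutoff_eq hx] with j hj
      simp [F, hj.1]
  have l2 : Filter.Tendsto (fun j => (n2 j).toLp (fun x => ((x - k : ℝ) : ℂ) * F j x)) Filter.atTop
      (nhds (m2.toLp _)) := by
    refine tendsto_toLp_of_dominated n2 m2 m2.norm
      (fun j => Filter.Eventually.of_forall fun x => ?_)
      ?_
    · have : ((x - k : ℝ) : ℂ) * F j x - ((x - k : ℝ) : ℂ) * f x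
          = ((cutoff j x : ℂ) - 1) * (((x - k : ℝ) : ℂ) * f x) := by simp only [F]; ring
      rw [this, norm_mul]
      exact mul_le_of_le_one_left (norm_nonneg _) (hc1 j x)
    · refine (ae_restrict_iff' measurableSet_Ioi).2 (Filter.Eventually.of_forall fun x hx => ?_)
      refine tendsto_const_nhds.congr' ?_
      filter_upwards [eventually_cutoff_eq hx] with j hj
      simp [F, hj.1]
  have l1 : Filter.Tendsto (fun j => (n1 j).toLp (deriv (F j))) Filter.atTop
      (nhds (m1.toLp (deriv f))) := by
    -- near the boundary `|f(x)| ≤ B x` compensates the growth of the derivative of the cutoff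
    have hind : MemLp ((Ioc (0 : ℝ) 2).indicator fun _ => 2 * B * M) 2
        (volume.restrict (Ioi (0 : ℝ))) :=
      memLp_indicator_const 2 measurableSet_Ioc _ (Or.inr (by
        rw [Measure.restrict_apply measurableSet_Ioc]
        exact ((measure_mono inter_subset_left).trans_lt (by simp)).ne))
    refine tendsto_toLp_of_dominated n1 m1 ((hind.add (m0.norm.const_mul M)).add m1.norm)
      (fun j => ?_) ?_
    · refine (ae_restrict_iff' measurableSet_Ioi).2 (Filter.Eventually.of_forall fun x hx => ?_)
      have hx : 0 < x := hx
      have hj : (1 : ℝ) ≤ j + 1 := by linarith [(Nat.cast_nonneg j : (0 : ℝ) ≤ j)]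
      have e : deriv (F j) x - deriv f x
          = ((deriv (cutoff j) x : ℝ) : ℂ) * f x + ((cutoff j x : ℂ) - 1) * deriv f x := by
        rw [hdF]; ring
      rw [e]
      refine (norm_add_le _ _).trans ?_
      simp only [Pi.add_apply]
      refine add_le_add ?_ ?_
      swap
      · rw [norm_mul]
        exact mul_le_of_le_one_left (norm_nonneg _) (hc1 j x)
      rw [norm_mul, Complex.norm_real, (hasDerivAt_cutoff j x).deriv, Real.norm_eq_abs]
      have s1 : |(j + 1) * deriv Real.smoothTransition ((j + 1) * x - 1)
            * Real.smoothTransition (j + 2 - x)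
          - Real.smoothTransition ((j + 1) * x - 1) * deriv Real.smoothTransition (j + 2 - x)|
          ≤ (j + 1) * |deriv Real.smoothTransition ((j + 1) * x - 1)| + M := by
        refine (abs_sub _ _).trans (add_le_add ?_ ?_)
        · rw [abs_mul, abs_mul, abs_of_nonneg (by linarith : (0 : ℝ) ≤ j + 1),
            abs_of_nonneg (Real.smoothTransition.nonneg _)]
          exact mul_le_of_le_one_right (by positivity) (Real.smoothTransition.le_one _)
        · rw [abs_mul, abs_of_nonneg (Real.smoothTransition.nonneg _)]
          exact (mul_le_of_le_one_left (abs_nonneg _) (Real.smoothTransition.le_one _)).trans (hM _)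
      refine (mul_le_mul_of_nonneg_right s1 (norm_nonneg _)).trans ?_
      rw [add_mul]
      refine add_le_add ?_ le_rfl
      by_cases hsmall : ((j : ℝ) + 1) * x ≤ 2
      · have hx2 : x ≤ 2 := by nlinarith
        rw [indicator_of_mem (show x ∈ Ioc (0 : ℝ) 2 from ⟨hx, hx2⟩)]
        calc ((j : ℝ) + 1) * |deriv Real.smoothTransition ((j + 1) * x - 1)| * ‖f x‖
            ≤ ((j : ℝ) + 1) * M * (B * x) := by
              gcongr
              · exact hM _
              · exact hfB x ⟨hx.le, hx2⟩
          _ = (((j : ℝ) + 1) * x) * (B * M) := by ring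
          _ ≤ 2 * (B * M) := by gcongr
          _ = 2 * B * M := by ring
      · rw [deriv_smoothTransition_eq_zero (.inr (by linarith))]
        simp only [abs_zero, mul_zero, zero_mul]
        exact indicator_nonneg (fun _ _ => by positivity) _
    · refine (ae_restrict_iff' measurableSet_Ioi).2 (Filter.Eventually.of_forall fun x hx => ?_)
      refine tendsto_const_nhds.congr' ?_
      filter_upwards [eventually_cutoff_eq hx] with j hj
      rw [hdF, hj.1, hj.2]
      simp
  refine ⟨WithLp.toLp 2 (m0.toLp f, WithLp.toLp 2 (m1.toLp _, m2.toLp _)), ?_, m0.coeFn_toLp,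
    m1.coeFn_toLp, m2.coeFn_toLp⟩
  rw [mem_formDomain]
  refine mem_closure_of_tendsto (l0.prodMk_nhds
    (((WithLp.prod_continuous_toLp 2 _ _).tendsto _).comp (l1.prodMk_nhds l2)))
    (Filter.Eventually.of_forall fun j => ?_)
  exact ⟨F j, hF j, (n0 j).coeFn_toLp, (n1 j).coeFn_toLp, (n2 j).coeFn_toLp⟩

/-! ### Hermite functions -/

open Polynomial in
/-- The Hermite polynomials, orthogonal for the weight `e^(-x²)`. -/
def hermitePoly : ℕ → ℝ[X]
  | 0 => 1
  | j + 1 => 2 * X * hermitePoly j - derivative (hermitePoly j)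

section HermitePoly

open Polynomial

theorem hermitePoly_succ (j : ℕ) :
    hermitePoly (j + 1) = 2 * X * hermitePoly j - derivative (hermitePoly j) := rfl

theorem derivative_hermitePoly_succ (j : ℕ) :
    derivative (hermitePoly (j + 1)) = 2 * ((j : ℝ[X]) + 1) * hermitePoly j := by
  induction j with
  | zero => simp [hermitePoly]
  | succ j ih =>
    have h : derivative (hermitePoly (j + 1 + 1)) =
        2 * hermitePoly (j + 1) + 2 * X * derivative (hermitePoly (j + 1))
          - derivative (derivative (hermitePoly (j + 1))) := by
      rw [hermitePoly_succ (j + 1)]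
      simp only [derivative_sub, derivative_mul, derivative_X, derivative_ofNat]
      ring
    have h2 : derivative (derivative (hermitePoly (j + 1)))
        = 2 * ((j : ℝ[X]) + 1) * derivative (hermitePoly j) := by
      rw [ih]
      simp
    rw [h, h2, ih]
    push_cast
    have h3 := hermitePoly_succ j
    linear_combination (-2 * ((j : ℝ[X]) + 1)) * h3

/-- Hermite's differential equation. -/
theorem derivative_derivative_hermitePoly (j : ℕ) :
    derivative (derivative (hermitePoly j))
      = 2 * X * derivative (hermitePoly j) - 2 * (j : ℝ[X]) * hermitePoly j := by
  have h := congrArg derivative (hermitePoly_succ j)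
  rw [derivative_hermitePoly_succ] at h
  simp only [derivative_sub, derivative_mul, derivative_X, derivative_ofNat] at h
  linear_combination h

theorem hermitePoly_ne_zero (j : ℕ) : hermitePoly j ≠ 0 := by
  induction j with
  | zero => simp [hermitePoly]
  | succ j ih =>
    intro h
    have h1 := derivative_hermitePoly_succ j
    rw [h, derivative_zero] at h1
    have h2 : (2 * ((j : ℝ[X]) + 1)) ≠ 0 := by
      have : ((2 * (j + 1) : ℕ) : ℝ[X]) ≠ 0 := by
        rw [Nat.cast_ne_zero]
        omega
      exact_mod_cast this
    exact (mul_ne_zero h2 ih) h1.symm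

end HermitePoly

/-- `p(x - k) e^(-(x - k)² / 2)`. -/
def polyGauss (p : Polynomial ℝ) (k x : ℝ) : ℝ := p.eval (x - k) * gauss k x

section PolyGauss

open Polynomial

variable (p q : ℝ[X]) (k x : ℝ)

theorem polyGauss_X_mul : polyGauss (X * p) k x = (x - k) * polyGauss p k x := by
  simp only [polyGauss, eval_mul, eval_X]; ring

theorem polyGauss_C_mul (c : ℝ) : polyGauss (C c * p) k x = c * polyGauss p k x := by
  simp only [polyGauss, eval_mul, eval_C]; ring

theorem contDiff_polyGauss : ContDiff ℝ ∞ (polyGauss p k) := by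
  have h1 : ContDiff ℝ ∞ fun x : ℝ => p.eval (x - k) :=
    (show ContDiff ℝ ∞ fun x => p.eval x by
      simpa using p.contDiff_aeval (𝕜 := ℝ) ∞).comp (contDiff_id.sub contDiff_const)
  exact h1.mul (contDiff_gauss k)

theorem hasDerivAt_polyGauss :
    HasDerivAt (polyGauss p k) (polyGauss (derivative p - X * p) k x) x := by
  have h1 : HasDerivAt (fun x : ℝ => p.eval (x - k)) ((derivative p).eval (x - k)) x :=
    (p.hasDerivAt (x - k)).comp_sub_const x k
  refine (h1.fun_mul (hasDerivAt_gauss k x)).congr_deriv ?_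
  simp only [polyGauss, eval_sub, eval_mul, eval_X]
  ring

theorem memLp_polyGauss : MemLp (polyGauss p k) 2 volume := by
  have h : polyGauss p k = fun x => ∑ i ∈ Finset.range (p.natDegree + 1),
      p.coeff i * ((x - k) ^ i * gauss k x) := by
    funext x
    rw [polyGauss, eval_eq_sum_range, Finset.sum_mul]
    exact Finset.sum_congr rfl fun i _ => by ring
  rw [h]
  refine memLp_finsetSum _ fun i _ => MemLp.const_mul ?_ _
  have hc : Continuous fun x => (x - k) ^ i * gauss k x := by
    have := (contDiff_gauss k).continuous
    fun_prop
  exact (memLp_two_iff_integrable_sq hc.aestronglyMeasurable).2 (integrable_pow_mul_gauss_sq k i)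

theorem integrable_polyGauss_mul : Integrable fun x => polyGauss p k x * polyGauss q k x :=
  (memLp_polyGauss p k).integrable_mul (memLp_polyGauss q k)

theorem integral_polyGauss_mul :
    ∫ x, polyGauss p k x * polyGauss q k x = ∫ x, polyGauss p 0 x * polyGauss q 0 x := by
  rw [← integral_sub_right_eq_self (fun x => polyGauss p 0 x * polyGauss q 0 x) k]
  simp [polyGauss, gauss]

/-- At the boundary, the oscillator functions are super-exponentially small in `k`. -/
theorem tendsto_pow_mul_polyGauss_zero (m : ℕ) :
    Filter.Tendsto (fun k => k ^ m * polyGauss p k 0) Filter.atTop (nhds 0) := by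
  have h1 : ∀ i : ℕ, Filter.Tendsto (fun k : ℝ => k ^ i * Real.exp (-k ^ 2 / 2)) Filter.atTop
      (nhds 0) := fun i => by
    refine squeeze_zero' ?_ ?_ (Real.tendsto_pow_mul_exp_neg_atTop_nhds_zero i)
    · filter_upwards [Filter.eventually_ge_atTop 0] with k hk
      positivity
    · filter_upwards [Filter.eventually_ge_atTop 2] with k hk
      have : -k ^ 2 / 2 ≤ -k := by nlinarith
      gcongr
  have h2 : (fun k : ℝ => k ^ m * polyGauss p k 0) = fun k =>
      ∑ i ∈ Finset.range (p.natDegree + 1),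
        (p.coeff i * (-1) ^ i) * (k ^ (m + i) * Real.exp (-k ^ 2 / 2)) := by
    funext k
    rw [polyGauss, eval_eq_sum_range, Finset.sum_mul, Finset.mul_sum]
    refine Finset.sum_congr rfl fun i _ => ?_
    rw [gauss, zero_sub, neg_sq, neg_pow, pow_add]
    ring
  rw [h2]
  have h3 := tendsto_finsetSum (Finset.range (p.natDegree + 1)) fun i _ =>
    (h1 (m + i)).const_mul (p.coeff i * (-1) ^ i)
  simpa using h3

theorem exists_polyGauss_zero_sq_le : ∃ (D : ℝ) (d : ℕ), 0 < D ∧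
    ∀ k, 1 ≤ k → polyGauss p k 0 ^ 2 ≤ D * k ^ d * Real.exp (-k ^ 2) := by
  refine ⟨(∑ i ∈ Finset.range (p.natDegree + 1), |p.coeff i|) ^ 2 + 1, p.natDegree * 2,
    by positivity, fun k hk => ?_⟩
  have h1 : |p.eval (-k)| ≤ (∑ i ∈ Finset.range (p.natDegree + 1), |p.coeff i|)
      * k ^ p.natDegree := by
    rw [eval_eq_sum_range, Finset.sum_mul]
    refine (Finset.abs_sum_le_sum_abs _ _).trans (Finset.sum_le_sum fun i hi => ?_)
    rw [abs_mul, abs_pow, abs_neg, abs_of_pos (by linarith : 0 < k)]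
    gcongr
    · exact Nat.lt_succ_iff.1 (Finset.mem_range.1 hi)
  have h2 : p.eval (-k) ^ 2 ≤ ((∑ i ∈ Finset.range (p.natDegree + 1), |p.coeff i|)
      * k ^ p.natDegree) ^ 2 := by
    rw [← sq_abs (p.eval (-k))]
    exact pow_le_pow_left₀ (abs_nonneg _) h1 2
  have h3 : gauss k 0 ^ 2 = Real.exp (-k ^ 2) := by
    rw [gauss, ← Real.exp_nat_mul]
    congr 1
    push_cast
    ring
  rw [polyGauss, zero_sub, mul_pow, h3]
  gcongr
  rw [mul_pow, ← pow_mul] at h2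
  refine h2.trans ?_
  gcongr
  linarith

end PolyGauss

/-- The normalized Hermite polynomials. -/
def hermiteNormPoly (j : ℕ) : Polynomial ℝ :=
  Polynomial.C (Real.sqrt (∫ x, polyGauss (hermitePoly j) 0 x * polyGauss (hermitePoly j) 0 x))⁻¹
    * hermitePoly j

/-- The `L²(ℝ)`-normalized eigenfunctions of the harmonic oscillator `-∂ₓ² + (x - k)²`, with
eigenvalues `2 j + 1`, for `j = 0, 1, 2, …`. -/
def hermiteFun (j : ℕ) (k x : ℝ) : ℝ := polyGauss (hermiteNormPoly j) k x

/-- The derivatives of the Hermite functions. -/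
def hermiteFunDeriv (j : ℕ) (k x : ℝ) : ℝ :=
  polyGauss (Polynomial.derivative (hermiteNormPoly j) - Polynomial.X * hermiteNormPoly j) k x

theorem hasDerivAt_hermiteFun (j : ℕ) (k x : ℝ) :
    HasDerivAt (hermiteFun j k) (hermiteFunDeriv j k x) x := hasDerivAt_polyGauss _ k x

theorem hasDerivAt_hermiteFunDeriv (j : ℕ) (k x : ℝ) :
    HasDerivAt (hermiteFunDeriv j k) (((x - k) ^ 2 - (2 * j + 1)) * hermiteFun j k x) x := by
  refine (hasDerivAt_polyGauss _ k x).congr_deriv ?_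
  have h := derivative_derivative_hermitePoly j
  have h2 : Polynomial.derivative (Polynomial.derivative (hermiteNormPoly j))
      = 2 * Polynomial.X * Polynomial.derivative (hermiteNormPoly j)
        - 2 * (j : Polynomial ℝ) * hermiteNormPoly j := by
    simp only [hermiteNormPoly, Polynomial.derivative_C_mul]
    rw [h]
    ring
  have h3 := congrArg (Polynomial.eval (x - k)) h2
  simp only [Polynomial.eval_sub, Polynomial.eval_mul, Polynomial.eval_X, Polynomial.eval_natCast,
    Polynomial.eval_ofNat] at h3
  simp only [polyGauss, hermiteFun, Polynomial.derivative_sub, Polynomial.derivative_mul,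
    Polynomial.derivative_X, Polynomial.eval_sub, Polynomial.eval_mul, Polynomial.eval_add,
    Polynomial.eval_X, Polynomial.eval_one, h3]
  ring

theorem contDiff_hermiteFun (j : ℕ) (k : ℝ) : ContDiff ℝ ∞ (hermiteFun j k) :=
  contDiff_polyGauss _ k

theorem memLp_hermiteFun (j : ℕ) (k : ℝ) : MemLp (hermiteFun j k) 2 volume := memLp_polyGauss _ k

theorem memLp_hermiteFunDeriv (j : ℕ) (k : ℝ) : MemLp (hermiteFunDeriv j k) 2 volume :=
  memLp_polyGauss _ k

theorem memLp_mul_hermiteFun (j : ℕ) (k : ℝ) :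
    MemLp (fun x => (x - k) * hermiteFun j k x) 2 volume := by
  have h : (fun x => (x - k) * hermiteFun j k x) =
      polyGauss (Polynomial.X * hermiteNormPoly j) k := by
    funext x
    rw [polyGauss_X_mul]
    rfl
  rw [h]
  exact memLp_polyGauss _ k

theorem integral_polyGauss_sq_pos {p : Polynomial ℝ} (hp : p ≠ 0) (k : ℝ) :
    0 < ∫ x, polyGauss p k x * polyGauss p k x := by
  have hc : Continuous (polyGauss p k) := (contDiff_polyGauss p k).continuous
  obtain ⟨y, hy⟩ : ∃ y, p.eval y ≠ 0 := by
    by_contra! h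
    exact hp (Polynomial.funext fun x => by rw [h x, Polynomial.eval_zero])
  rw [integral_pos_iff_support_of_nonneg (fun x => mul_self_nonneg _)
    (integrable_polyGauss_mul p p k)]
  refine (hc.mul hc).isOpen_support.measure_pos _ ⟨y + k, ?_⟩
  have h1 : polyGauss p k (y + k) ≠ 0 := by
    rw [polyGauss, add_sub_cancel_right]
    exact mul_ne_zero hy (gauss_pos _ _).ne'
  exact mul_ne_zero h1 h1

theorem integral_hermiteFun_mul (i j : ℕ) (k : ℝ) :
    ∫ x, hermiteFun i k x * hermiteFun j k x = if i = j then 1 else 0 := by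
  split_ifs with hij
  · subst hij
    change ∫ x, polyGauss _ k x * polyGauss _ k x = 1
    rw [integral_polyGauss_mul]
    have hpos := integral_polyGauss_sq_pos (hermitePoly_ne_zero i) 0
    simp_rw [hermiteNormPoly, polyGauss_C_mul]
    set T := ∫ x, polyGauss (hermitePoly i) 0 x * polyGauss (hermitePoly i) 0 x with hT
    have e : ∀ x, (Real.sqrt T)⁻¹ * polyGauss (hermitePoly i) 0 x
        * ((Real.sqrt T)⁻¹ * polyGauss (hermitePoly i) 0 x)
        = T⁻¹ * (polyGauss (hermitePoly i) 0 x * polyGauss (hermitePoly i) 0 x) := fun x => by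
      have : (Real.sqrt T)⁻¹ * (Real.sqrt T)⁻¹ = T⁻¹ := by
        rw [← mul_inv, Real.mul_self_sqrt hpos.le]
      rw [← this]
      ring
    simp_rw [e]
    rw [integral_const_mul, ← hT, inv_mul_cancel₀ hpos.ne']
  · -- the Wronskian of two eigenfunctions vanishes at infinity
    have h1 : ∀ x, HasDerivAt (fun x => hermiteFun i k x * hermiteFunDeriv j k x
        - hermiteFunDeriv i k x * hermiteFun j k x)
        ((2 * (i : ℝ) - 2 * j) * (hermiteFun i k x * hermiteFun j k x)) x := fun x =>
      (((hasDerivAt_hermiteFun i k x).fun_mul (hasDerivAt_hermiteFunDeriv j k x)).fun_sub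
        ((hasDerivAt_hermiteFunDeriv i k x).fun_mul (hasDerivAt_hermiteFun j k x))).congr_deriv
        (by ring)
    have h2 : Integrable fun x => hermiteFun i k x * hermiteFun j k x :=
      integrable_polyGauss_mul _ _ k
    have h3 := integral_eq_zero_of_hasDerivAt_of_integrable h1 (h2.const_mul _)
      ((integrable_polyGauss_mul _ _ k).sub (integrable_polyGauss_mul _ _ k))
    rw [integral_const_mul] at h3
    refine (mul_eq_zero.1 h3).resolve_left ?_
    rw [← mul_sub]
    exact mul_ne_zero two_ne_zero (sub_ne_zero.2 (by exact_mod_cast hij))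

/-- The Hermite functions as vectors of `L²(ℝ)`. -/
def hermiteL2 (j : ℕ) (k : ℝ) : Lp ℂ 2 (volume : Measure ℝ) :=
  (memLp_hermiteFun j k).ofReal.toLp (fun x => (hermiteFun j k x : ℂ))

theorem hermiteL2_ae (j : ℕ) (k : ℝ) :
    hermiteL2 j k =ᵐ[volume] fun x => (hermiteFun j k x : ℂ) := MemLp.coeFn_toLp _

theorem orthonormal_hermiteL2 (k : ℝ) : Orthonormal ℂ fun j => hermiteL2 j k := by
  rw [orthonormal_iff_ite]
  intro i j
  rw [L2_inner_eq_of_ae (hermiteL2_ae i k) (hermiteL2_ae j k)]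
  simp_rw [Complex.conj_ofReal, ← Complex.ofReal_mul]
  rw [integral_complex_ofReal, integral_hermiteFun_mul]
  split_ifs <;> simp

theorem hermiteNormPoly_ne_zero (j : ℕ) : hermiteNormPoly j ≠ 0 :=
  mul_ne_zero (by
    rw [Ne, Polynomial.C_eq_zero]
    exact inv_ne_zero (Real.sqrt_pos.2 (integral_polyGauss_sq_pos (hermitePoly_ne_zero j) 0)).ne')
    (hermitePoly_ne_zero j)

/-- For large `k`, the origin lies to the left of all zeros of a Hermite function. -/
theorem eventually_hermiteFun_zero_ne (j : ℕ) :
    ∀ᶠ k in Filter.atTop, hermiteFun j k 0 ≠ 0 := by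
  have hfin : {x : ℝ | (hermiteNormPoly j).IsRoot x}.Finite :=
    Polynomial.finite_setOfPred_isRoot (hermiteNormPoly_ne_zero j)
  obtain ⟨M, hM⟩ := hfin.bddBelow
  filter_upwards [Filter.eventually_gt_atTop (-M)] with k hk h
  rw [hermiteFun, polyGauss, zero_sub] at h
  have h1 : (hermiteNormPoly j).IsRoot (-k) :=
    (mul_eq_zero.1 h).resolve_right (gauss_pos k 0).ne'
  have := hM h1
  linarith

/-! ### Trial functions -/

theorem integrableOn_pow_mul_exp (i : ℕ) {b : ℝ} (hb : 0 < b) :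
    IntegrableOn (fun x : ℝ => x ^ i * Real.exp (-(b * x))) (Ioi 0) := by
  have h := integrableOn_rpow_mul_exp_neg_mul_rpow (p := 1) (s := (i : ℝ)) (b := b)
    (by linarith [(Nat.cast_nonneg i : (0 : ℝ) ≤ i)]) one_pos hb
  refine h.congr_fun (fun x _ => ?_) measurableSet_Ioi
  simp only [Real.rpow_natCast, Real.rpow_one, neg_mul]

theorem integral_pow_mul_exp (i : ℕ) {b : ℝ} (hb : 0 < b) :
    ∫ x in Ioi (0 : ℝ), x ^ i * Real.exp (-(b * x)) = (1 / b) ^ (i + 1) * i.factorial := by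
  have h := Real.integral_rpow_mul_exp_neg_mul_Ioi (a := (i : ℝ) + 1) (r := b)
    (by positivity) hb
  rw [Real.Gamma_nat_eq_factorial] at h
  rw [← Real.rpow_natCast]
  push_cast
  rw [← h]
  refine setIntegral_congr_fun measurableSet_Ioi fun x _ => ?_
  simp only [add_sub_cancel_right, Real.rpow_natCast]

theorem integrable_inner_of_memLp {α : Type*} [MeasurableSpace α] {μ : Measure α} {f g : α → ℂ}
    (hf : MemLp f 2 μ) (hg : MemLp g 2 μ) : Integrable (fun x => ⟪f x, g x⟫_ℝ) μ := by
  refine Integrable.mono' (hf.norm.integrable_mul hg.norm)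
    (hf.aestronglyMeasurable.inner hg.aestronglyMeasurable)
    (Filter.Eventually.of_forall fun x => ?_)
  exact norm_inner_le_norm _ _

theorem memLp_exp {a : ℝ} (ha : 0 < a) :
    MemLp (fun x : ℝ => Real.exp (-(a * x))) 2 (volume.restrict (Ioi 0)) := by
  refine (memLp_two_iff_integrable_sq (by fun_prop)).2 ?_
  refine (integrableOn_pow_mul_exp 0 (b := 2 * a) (by linarith)).congr
    (Filter.Eventually.of_forall fun x => ?_)
  simp only [pow_zero, one_mul]
  rw [← Real.exp_nat_mul]
  congr 1
  push_cast
  ring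

theorem memLp_mul_exp {a : ℝ} (ha : 0 < a) (κ : ℝ) :
    MemLp (fun x : ℝ => (x - κ) * Real.exp (-(a * x))) 2 (volume.restrict (Ioi 0)) := by
  have h1 : MemLp (fun x : ℝ => x * Real.exp (-(a * x))) 2 (volume.restrict (Ioi 0)) := by
    refine (memLp_two_iff_integrable_sq (by fun_prop)).2 ?_
    refine (integrableOn_pow_mul_exp 2 (b := 2 * a) (by linarith)).congr
      (Filter.Eventually.of_forall fun x => ?_)
    simp only
    rw [mul_pow, ← Real.exp_nat_mul]
    congr 2
    push_cast
    ring
  refine (h1.sub ((memLp_exp ha).const_mul κ)).ae_eq (Filter.Eventually.of_forall fun x => ?_)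
  simp only [Pi.sub_apply]
  ring

theorem integral_sq_mul_exp {a : ℝ} (ha : 0 < a) (κ E : ℝ) :
    IntegrableOn (fun x : ℝ => (a ^ 2 + (x - κ) ^ 2 - E) * Real.exp (-(a * x)) ^ 2) (Ioi 0) ∧
    ∫ x in Ioi (0 : ℝ), (a ^ 2 + (x - κ) ^ 2 - E) * Real.exp (-(a * x)) ^ 2
      = (a ^ 2 + κ ^ 2 - E) / (2 * a) - κ / (2 * a ^ 2) + 1 / (4 * a ^ 3) := by
  have h2a : 0 < 2 * a := by linarith
  have e : ∀ x : ℝ, (a ^ 2 + (x - κ) ^ 2 - E) * Real.exp (-(a * x)) ^ 2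
      = (a ^ 2 + κ ^ 2 - E) * (x ^ 0 * Real.exp (-(2 * a * x)))
        + ((-2 * κ) * (x ^ 1 * Real.exp (-(2 * a * x)))
        + x ^ 2 * Real.exp (-(2 * a * x))) := fun x => by
    have : Real.exp (-(a * x)) ^ 2 = Real.exp (-(2 * a * x)) := by
      rw [← Real.exp_nat_mul]
      congr 1
      push_cast
      ring
    rw [this]
    ring
  simp_rw [e]
  have i0 := (integrableOn_pow_mul_exp 0 h2a).const_mul (a ^ 2 + κ ^ 2 - E)
  have i1 := (integrableOn_pow_mul_exp 1 h2a).const_mul (-2 * κ)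
  have i2 := integrableOn_pow_mul_exp 2 h2a
  refine ⟨i0.add (i1.add i2), ?_⟩
  have i12 : IntegrableOn (fun x : ℝ => (-2 * κ) * (x ^ 1 * Real.exp (-(2 * a * x)))
        + x ^ 2 * Real.exp (-(2 * a * x))) (Ioi 0) := i1.add i2
  rw [integral_add i0 i12, integral_add i1 i2, integral_const_mul, integral_const_mul,
    integral_pow_mul_exp 0 h2a, integral_pow_mul_exp 1 h2a, integral_pow_mul_exp 2 h2a]
  have ha' : a ≠ 0 := ha.ne'
  norm_num [Nat.factorial]
  field_simp
  ring

/-- The energy, on the half-line, of `f = g - g(0) e^(-a x)`, where `-g'' + ((x - κ)² - E) g = t`.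
The boundary term `⟨g(0), g'(0)⟩` is antisymmetric under reflection. -/
theorem integral_trial_energy {κ a E : ℝ} (ha : 0 < a) {g g' t : ℝ → ℂ}
    (hg : ∀ x, HasDerivAt g (g' x) x)
    (hg' : ∀ x, HasDerivAt g' (((x - κ) ^ 2 - E) • g x - t x) x)
    (m0 : MemLp g 2 (volume.restrict (Ioi 0))) (m1 : MemLp g' 2 (volume.restrict (Ioi 0)))
    (m2 : MemLp (fun x => (x - κ) • g x) 2 (volume.restrict (Ioi 0)))
    (mt : MemLp t 2 (volume.restrict (Ioi 0))) :
    ∫ x in Ioi 0, (‖g' x + (a * Real.exp (-(a * x))) • g 0‖ ^ 2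
        + ((x - κ) ^ 2 - E) * ‖g x - Real.exp (-(a * x)) • g 0‖ ^ 2)
      = (∫ x in Ioi 0, ⟪g x, t x⟫_ℝ) - 2 * (∫ x in Ioi 0, ⟪Real.exp (-(a * x)) • g 0, t x⟫_ℝ)
        + ‖g 0‖ ^ 2 * ((a ^ 2 + κ ^ 2 - E) / (2 * a) - κ / (2 * a ^ 2) + 1 / (4 * a ^ 3))
        + ⟪g 0, g' 0⟫_ℝ := by
  have hρ : ∀ x, HasDerivAt (fun x : ℝ => Real.exp (-(a * x))) (-a * Real.exp (-(a * x))) x :=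
    fun x => by
      have h1 : HasDerivAt (fun x : ℝ => -(a * x)) (-a) x := by
        simpa using ((hasDerivAt_id' x).const_mul a).fun_neg
      exact h1.exp.congr_deriv (by ring)
  have mρ : MemLp (fun x => Real.exp (-(a * x)) • g 0) 2 (volume.restrict (Ioi 0)) := by
    have := (memLp_exp ha).ofReal (K := ℂ) |>.mul_const (g 0)
    exact this.ae_eq (Filter.Eventually.of_forall fun x => by simp)
  have mxρ : MemLp (fun x => (x - κ) • (Real.exp (-(a * x)) • g 0)) 2
      (volume.restrict (Ioi 0)) := by
    have := (memLp_mul_exp ha κ).ofReal (K := ℂ) |>.mul_const (g 0)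
    exact this.ae_eq (Filter.Eventually.of_forall fun x => by simp [mul_assoc])
  obtain ⟨iρ, eρ⟩ := integral_sq_mul_exp ha κ E
  -- the total derivative left after integrating by parts
  let F : ℝ → ℝ := fun x => ⟪g x, g' x⟫_ℝ - 2 * ⟪Real.exp (-(a * x)) • g 0, g' x⟫_ℝ
  let F' : ℝ → ℝ := fun x => ⟪g x, ((x - κ) ^ 2 - E) • g x - t x⟫_ℝ + ⟪g' x, g' x⟫_ℝ
    - 2 * (⟪Real.exp (-(a * x)) • g 0, ((x - κ) ^ 2 - E) • g x - t x⟫_ℝ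
      + ⟪(-a * Real.exp (-(a * x))) • g 0, g' x⟫_ℝ)
  have hF : ∀ x, HasDerivAt F (F' x) x := fun x =>
    ((hg x).inner ℝ (hg' x)).fun_sub
      ((((hρ x).smul_const (g 0)).inner ℝ (hg' x)).const_mul 2)
  have hid : ∀ x, ‖g' x + (a * Real.exp (-(a * x))) • g 0‖ ^ 2
        + ((x - κ) ^ 2 - E) * ‖g x - Real.exp (-(a * x)) • g 0‖ ^ 2
      = ⟪g x, t x⟫_ℝ - 2 * ⟪Real.exp (-(a * x)) • g 0, t x⟫_ℝ
        + ‖g 0‖ ^ 2 * ((a ^ 2 + (x - κ) ^ 2 - E) * Real.exp (-(a * x)) ^ 2) + F' x := fun x => by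
    simp only [F']
    rw [norm_add_sq_real, norm_sub_sq_real, norm_smul, norm_smul]
    simp only [inner_sub_right, inner_smul_right, inner_smul_left, conj_trivial, mul_pow,
      Real.norm_eq_abs, sq_abs, real_inner_self_eq_norm_sq]
    rw [real_inner_comm (g 0) (g' x), real_inner_comm (g 0) (g x)]
    ring
  have iI : IntegrableOn (fun x => ‖g' x + (a * Real.exp (-(a * x))) • g 0‖ ^ 2
        + ((x - κ) ^ 2 - E) * ‖g x - Real.exp (-(a * x)) • g 0‖ ^ 2) (Ioi 0) := by
    have n1 : MemLp (fun x => g' x + (a * Real.exp (-(a * x))) • g 0) 2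
        (volume.restrict (Ioi 0)) :=
      (m1.add (mρ.const_smul a)).ae_eq (Filter.Eventually.of_forall fun x => by
        simp only [Pi.add_apply, Pi.smul_apply, smul_smul])
    have n2 := (m2.sub mxρ).integrable_norm_pow (p := 2) (by norm_num)
    have n3 := (m0.sub mρ).integrable_norm_pow (p := 2) (by norm_num)
    refine ((n1.integrable_norm_pow (p := 2) (by norm_num)).add
      (n2.sub (n3.const_mul E))).congr (Filter.Eventually.of_forall fun x => ?_)
    simp only [Pi.add_apply, Pi.sub_apply]
    rw [← smul_sub, norm_smul, mul_pow, Real.norm_eq_abs, sq_abs]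
    ring
  have igt := integrable_inner_of_memLp m0 mt
  have iρt := integrable_inner_of_memLp mρ mt
  have iA : IntegrableOn (fun x => ⟪g x, t x⟫_ℝ - 2 * ⟪Real.exp (-(a * x)) • g 0, t x⟫_ℝ)
      (Ioi 0) := igt.sub (iρt.const_mul 2)
  have iB : IntegrableOn (fun x => ⟪g x, t x⟫_ℝ - 2 * ⟪Real.exp (-(a * x)) • g 0, t x⟫_ℝ
        + ‖g 0‖ ^ 2 * ((a ^ 2 + (x - κ) ^ 2 - E) * Real.exp (-(a * x)) ^ 2)) (Ioi 0) :=
    iA.add (iρ.const_mul _)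
  have iF' : IntegrableOn F' (Ioi 0) :=
    (iI.sub iB).congr (Filter.Eventually.of_forall fun x => by
      simp only [Pi.sub_apply]
      rw [hid x]
      ring)
  have iF : IntegrableOn F (Ioi 0) :=
    (integrable_inner_of_memLp m0 m1).sub ((integrable_inner_of_memLp mρ m1).const_mul 2)
  have hlim := tendsto_zero_of_hasDerivAt_of_integrableOn_Ioi (fun x _ => hF x) iF' iF
  have hint := integral_Ioi_of_hasDerivAt_of_tendsto' (a := 0) (fun x _ => hF x) iF' hlim
  have hF0 : F 0 = -⟪g 0, g' 0⟫_ℝ := by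
    simp only [F, mul_zero, neg_zero, Real.exp_zero, one_smul]
    ring
  simp_rw [hid]
  rw [integral_add iB iF', integral_add iA (iρ.const_mul _), integral_sub igt (iρt.const_mul 2),
    integral_const_mul, integral_const_mul, eρ, hint, hF0]
  ring

/-- The scalar inequality behind the trial space estimate. Here `a` and `d` are the sizes of the
components of `g` in the top level and in the lower levels, `p` and `s` the sizes of their boundary
values. -/
theorem trial_scalar_lt {n k p s a d r R N Q : ℝ} (hn : 1 ≤ n) (hk : 1 < k) (hp : 0 < p)
    (hs : 0 ≤ s) (ha : 0 ≤ a) (hd : 0 ≤ d) (hrk : r ^ 2 = 1 / k)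
    (hR : R ^ 2 = a ^ 2 + d ^ 2) (hR0 : 0 < R) (hps : p + s ≤ 1 / (4 * k ^ 2))
    (hD : (2 * k + 4 * n ^ 2 / k) * (1 + k ^ 2) * s ^ 2 ≤ 1)
    (hN : R - (a * p + s * d) * r ≤ N)
    (hQ : Q ≤ -2 * d ^ 2 + 4 * n * d * (a * p + s * d) * r + 2 * k * (a * p + s * d) ^ 2) :
    Q < (2 * k + (16 * n ^ 2 + 8) / k) * p ^ 2 * N ^ 2 := by
  obtain ⟨G, hG⟩ : ∃ G, G = a * p + s * d := ⟨_, rfl⟩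
  rw [← hG] at hN hQ
  have hk0 : 0 < k := by linarith
  obtain ⟨w, hw⟩ : ∃ w, w = 1 / k ^ 2 := ⟨_, rfl⟩
  have hw0 : 0 < w := by rw [hw]; positivity
  have hw1 : w < 1 := by
    rw [hw, div_lt_one (by positivity)]
    exact one_lt_pow₀ hk two_ne_zero
  have hkw : k ^ 2 * w = 1 := by rw [hw]; field_simp
  have hkinv : 1 / k = k * w := by rw [hw]; field_simp
  have hdiv : ∀ y : ℝ, y / k = y * (k * w) := fun y => by rw [← hkinv]; ring
  have hps' : p + s ≤ w / 4 := by
    refine hps.trans (le_of_eq ?_)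
    rw [hw]
    field_simp
  rw [hkinv] at hrk
  rw [hdiv] at hD
  rw [hdiv]
  obtain ⟨D, hDdef⟩ : ∃ D, D = 2 * k + 4 * n ^ 2 * (k * w) := ⟨_, rfl⟩
  rw [← hDdef] at hD
  clear hps hw hkinv hdiv
  have hG0 : 0 ≤ G := by rw [hG]; positivity
  have hD0 : 0 < D := by rw [hDdef]; positivity
  have h1 : 4 * n * d * G * r ≤ d ^ 2 + 4 * n ^ 2 * G ^ 2 * (k * w) := by
    rw [← hrk]
    linarith [sq_nonneg (d - 2 * n * G * r)]
  have h2 : G ^ 2 ≤ (1 + w) * (a * p) ^ 2 + (1 + k ^ 2) * (s * d) ^ 2 := by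
    have h : 0 ≤ w * (a * p - k ^ 2 * (s * d)) ^ 2 := by positivity
    have e : w * (a * p - k ^ 2 * (s * d)) ^ 2
        = w * (a * p) ^ 2 - 2 * (k ^ 2 * w) * (a * p) * (s * d)
          + (k ^ 2 * w) * k ^ 2 * (s * d) ^ 2 := by ring
    rw [e, hkw] at h
    rw [hG]
    linarith
  have h3 : Q ≤ D * (1 + w) * p ^ 2 * a ^ 2 := by
    have h4 : D * G ^ 2 ≤ D * ((1 + w) * (a * p) ^ 2 + (1 + k ^ 2) * (s * d) ^ 2) :=
      mul_le_mul_of_nonneg_left h2 hD0.le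
    have h5 : (D * (1 + k ^ 2) * s ^ 2) * d ^ 2 ≤ 1 * d ^ 2 :=
      mul_le_mul_of_nonneg_right hD (sq_nonneg d)
    have h6 : Q ≤ -d ^ 2 + D * G ^ 2 := by
      rw [hDdef]
      linarith
    linarith
  have haR : a ≤ R := abs_le_of_sq_le_sq' (by linarith [sq_nonneg d]) hR0.le |>.2
  have hdR : d ≤ R := abs_le_of_sq_le_sq' (by linarith [sq_nonneg a]) hR0.le |>.2
  have hr1 : r ≤ 1 := by
    have h : r ^ 2 ≤ 1 ^ 2 := by
      have : k * w ≤ k * (k * w) := le_mul_of_one_le_left (by positivity) hk.le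
      rw [hrk]
      linarith
    exact abs_le_of_sq_le_sq' h zero_le_one |>.2
  have h7 : R * (1 - w / 4) ≤ N := by
    have h8 : G * r ≤ R * (w / 4) := by
      calc G * r ≤ G * 1 := by gcongr
        _ = a * p + s * d := by rw [hG, mul_one]
        _ ≤ R * p + s * R := by gcongr
        _ = R * (p + s) := by ring
        _ ≤ R * (w / 4) := by gcongr
    linarith
  have h9 : R ^ 2 * (1 - w / 2) ≤ N ^ 2 := by
    have h10 : (R * (1 - w / 4)) ^ 2 ≤ N ^ 2 :=
      pow_le_pow_left₀ (mul_nonneg hR0.le (by linarith)) h7 2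
    have h12 : 0 ≤ (R * w) ^ 2 := sq_nonneg _
    linarith
  have h11 : D * (1 + w) < (2 * k + (16 * n ^ 2 + 8) * (k * w)) * (1 - w / 2) := by
    have e : (2 * k + (16 * n ^ 2 + 8) * (k * w)) * (1 - w / 2) - D * (1 + w)
        = k * w * ((12 * n ^ 2) * (1 - w) + 4 * (1 - w) + 1) := by
      rw [hDdef]; ring
    have h : 0 < k * w * ((12 * n ^ 2) * (1 - w) + 4 * (1 - w) + 1) := by
      have : 0 < 1 - w := by linarith
      positivity
    linarith
  have hpR : 0 < p ^ 2 * R ^ 2 := by positivity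
  calc Q ≤ D * (1 + w) * p ^ 2 * a ^ 2 := h3
    _ ≤ D * (1 + w) * p ^ 2 * R ^ 2 := by gcongr
    _ = D * (1 + w) * (p ^ 2 * R ^ 2) := by ring
    _ < (2 * k + (16 * n ^ 2 + 8) * (k * w)) * (1 - w / 2) * (p ^ 2 * R ^ 2) :=
      mul_lt_mul_of_pos_right h11 hpR
    _ = (2 * k + (16 * n ^ 2 + 8) * (k * w)) * p ^ 2 * (R ^ 2 * (1 - w / 2)) := by ring
    _ ≤ _ := by gcongr

/-! ### The trial space -/

/-- The trial function built from the Hermite function of index `j`: subtracting a multiple of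
`e^(-k x)` enforces the Dirichlet condition. The rate `k` is the one at which the kinetic energy of
the correction and its potential energy `∼ k²` near the boundary balance. -/
def trialFun (k : ℝ) (j : ℕ) (x : ℝ) : ℂ :=
  hermiteFun j k x - Real.exp (-(k * x)) * hermiteFun j k 0

/-- The derivative of the trial function. -/
def trialFunDeriv (k : ℝ) (j : ℕ) (x : ℝ) : ℂ :=
  hermiteFunDeriv j k x + k * Real.exp (-(k * x)) * hermiteFun j k 0

theorem hasDerivAt_trialFun (k : ℝ) (j : ℕ) (x : ℝ) :
    HasDerivAt (trialFun k j) (trialFunDeriv k j x) x := by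
  have h1 : HasDerivAt (fun x : ℝ => Real.exp (-(k * x))) (Real.exp (-(k * x)) * -k) x := by
    have h2 : HasDerivAt (fun x : ℝ => -(k * x)) (-k) x := by
      simpa using ((hasDerivAt_id' x).const_mul k).fun_neg
    exact h2.exp
  refine ((hasDerivAt_hermiteFun j k x).ofReal_comp.fun_sub
    (h1.ofReal_comp.mul_const (hermiteFun j k 0 : ℂ))).congr_deriv ?_
  rw [trialFunDeriv]
  push_cast
  ring

/-- The trial functions lie in the form domain of the fiber operator. -/
theorem exists_trial_mem_formDomain {k : ℝ} (hk : 0 < k) (j : ℕ) :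
    ∃ z ∈ formDomain (fiberCore k), z.fst =ᵐ[volume.restrict (Ioi 0)] trialFun k j ∧
      z.snd.fst =ᵐ[volume.restrict (Ioi 0)] trialFunDeriv k j ∧
      z.snd.snd =ᵐ[volume.restrict (Ioi 0)] fun x => ((x - k : ℝ) : ℂ) * trialFun k j x := by
  have hd : deriv (trialFun k j) = trialFunDeriv k j :=
    funext fun x => (hasDerivAt_trialFun k j x).deriv
  rw [← hd]
  have m0 := (memLp_exp hk).ofReal (K := ℂ) |>.mul_const (hermiteFun j k 0 : ℂ)
  have m1 := (memLp_mul_exp hk k).ofReal (K := ℂ) |>.mul_const (hermiteFun j k 0 : ℂ)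
  refine exists_mem_formDomain k ?_ (by simp [trialFun]) ?_ ?_ ?_
  · have h1 : ContDiff ℝ ∞ fun x : ℝ => Real.exp (-(k * x)) := by fun_prop
    exact (ofRealCLM.contDiff.comp (contDiff_hermiteFun j k)).sub
      ((ofRealCLM.contDiff.comp h1).mul contDiff_const)
  · exact ((memLp_hermiteFun j k).restrict _).ofReal.sub m0
  · rw [hd]
    refine (((memLp_hermiteFunDeriv j k).restrict _).ofReal (K := ℂ) |>.add
      (m0.const_mul (k : ℂ))).ae_eq (Filter.Eventually.of_forall fun x => ?_)
    simp only [Pi.add_apply, trialFunDeriv]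
    simp only [Complex.coe_algebraMap]
    ring
  · refine (((memLp_mul_hermiteFun j k).restrict _).ofReal (K := ℂ) |>.sub m1).ae_eq
      (Filter.Eventually.of_forall fun x => ?_)
    simp only [Pi.sub_apply, trialFun]
    simp only [Complex.coe_algebraMap]
    push_cast
    ring

theorem memLp_exp_abs {k : ℝ} (hk : 0 < k) :
    MemLp (fun x : ℝ => Real.exp (-(k * |x|))) 2 volume ∧
      ∫ x : ℝ, Real.exp (-(k * |x|)) ^ 2 = 1 / k := by
  have i : IntegrableOn (fun y : ℝ => Real.exp (-(k * y)) ^ 2) (Ioi 0) :=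
    (memLp_two_iff_integrable_sq (by fun_prop)).1 (memLp_exp hk)
  constructor
  · refine (memLp_two_iff_integrable_sq (by fun_prop)).2 ?_
    have h1 : IntegrableOn (fun x : ℝ => Real.exp (-(k * |x|)) ^ 2) (Ioi 0) :=
      i.congr_fun (fun x hx => by simp only [abs_of_pos (show 0 < x from hx)]) measurableSet_Ioi
    have h2 : IntegrableOn (fun x : ℝ => Real.exp (-(k * |x|)) ^ 2) (Iio 0) := by
      have h3 := ((Measure.measurePreserving_neg (volume : Measure ℝ)).integrableOn_comp_preimage
        (MeasurableEquiv.neg ℝ).measurableEmbedding).2 h1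
      have h4 : (Neg.neg : ℝ → ℝ) ⁻¹' Ioi 0 = Iio 0 := by ext x; simp
      rw [h4] at h3
      exact h3.congr_fun (fun x _ => by simp) measurableSet_Iio
    have h5 := ((integrableOn_Ici_iff_integrableOn_Ioi (by simp)).2 h1).union h2
    rwa [Ici_union_Iio, integrableOn_univ] at h5
  · change ∫ x : ℝ, (fun y : ℝ => Real.exp (-(k * y)) ^ 2) |x| = 1 / k
    rw [integral_comp_abs (f := fun y : ℝ => Real.exp (-(k * y)) ^ 2)]
    have h := integral_pow_mul_exp 0 (b := 2 * k) (by linarith)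
    have e2 : ∀ y : ℝ, Real.exp (-(k * y)) ^ 2 = y ^ 0 * Real.exp (-(2 * k * y)) := fun y => by
      rw [← Real.exp_nat_mul, pow_zero, one_mul]
      congr 1
      push_cast
      ring
    simp_rw [e2]
    rw [h]
    simp
    field_simp

/-- Splitting an integral over the line at the origin. -/
theorem integral_eq_add_comp_neg {f : ℝ → ℝ} (hf : Integrable f) :
    ∫ x, f x = (∫ x in Ioi 0, f x) + ∫ x in Ioi 0, f (-x) := by
  rw [integral_comp_neg_Ioi (f := f), neg_zero, add_comm]
  have := integral_add_compl (measurableSet_Iic (a := (0 : ℝ))) hf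
  rw [compl_Iic] at this
  exact this.symm

/-- The trial functions are extended to the whole line by means of `e^(-k |x|)`. The energy of the
extension is computed on the line, where the Hermite functions are orthogonal, and the energy to
the left of the origin, where the potential is at least `k²`, is dropped. -/
theorem trial_energy_le {k E ε : ℝ} (hk : 1 ≤ k) (hE : 1 ≤ E) (hε : E + ε ≤ k ^ 2) {g g' t : ℝ → ℂ}
    (hg : ∀ x, HasDerivAt g (g' x) x)
    (hg' : ∀ x, HasDerivAt g' (((x - k) ^ 2 - E) • g x - t x) x)
    (m0 : MemLp g 2 volume) (m1 : MemLp g' 2 volume)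
    (m2 : MemLp (fun x => (x - k) • g x) 2 volume) (mt : MemLp t 2 volume) :
    (∫ x in Ioi 0, (‖g' x + (k * Real.exp (-(k * x))) • g 0‖ ^ 2
        + ((x - k) ^ 2 - E) * ‖g x - Real.exp (-(k * x)) • g 0‖ ^ 2))
      - ε * ∫ x in Ioi 0, ‖g x - Real.exp (-(k * x)) • g 0‖ ^ 2
    ≤ (∫ x, ⟪g x, t x⟫_ℝ) - 2 * (∫ x, ⟪Real.exp (-(k * |x|)) • g 0, t x⟫_ℝ)
        + 2 * k * ‖g 0‖ ^ 2 - ε * ∫ x, ‖g x - Real.exp (-(k * |x|)) • g 0‖ ^ 2 := by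
  have hk0 : 0 < k := by linarith
  have mneg : ∀ {f : ℝ → ℂ}, MemLp f 2 volume →
      MemLp (fun x => f (-x)) 2 (volume.restrict (Ioi 0)) := fun hf =>
    (hf.comp_measurePreserving (Measure.measurePreserving_neg volume)).restrict _
  have hneg : ∀ {f : ℝ → ℂ} {f' : ℂ} {x : ℝ}, HasDerivAt f f' (-x) →
      HasDerivAt (fun x => f (-x)) (-f') x := fun {f f' x} h =>
    (h.scomp x (hasDerivAt_neg x)).congr_deriv (by simp)
  have hR := integral_trial_energy (κ := k) (E := E) hk0 hg hg' (m0.restrict _) (m1.restrict _)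
    (m2.restrict _) (mt.restrict _)
  have hL := integral_trial_energy (κ := -k) (E := E) hk0 (g := fun x => g (-x))
    (g' := fun x => -g' (-x)) (t := fun x => t (-x))
    (fun x => hneg (hg (-x)))
    (fun x => by
      have h := (hneg (hg' (-x))).fun_neg
      refine h.congr_deriv ?_
      rw [neg_neg]
      congr 2
      ring)
    (mneg m0) (mneg m1).neg ((mneg m2).neg.ae_eq (Filter.Eventually.of_forall fun x => by
      simp only [Pi.neg_apply, ← neg_smul]
      congr 1
      ring)) (mneg mt)
  simp only [neg_zero] at hL
  obtain ⟨mρ, -⟩ := memLp_exp_abs hk0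
  have mρg : MemLp (fun x => Real.exp (-(k * |x|)) • g 0) 2 volume := by
    have := mρ.ofReal (K := ℂ) |>.mul_const (g 0)
    exact this.ae_eq (Filter.Eventually.of_forall fun x => by simp)
  have mf : MemLp (fun x => g x - Real.exp (-(k * |x|)) • g 0) 2 volume := m0.sub mρg
  have s1 := integral_eq_add_comp_neg (integrable_inner_of_memLp m0 mt)
  have s2 := integral_eq_add_comp_neg (integrable_inner_of_memLp mρg mt)
  have s3 := integral_eq_add_comp_neg (mf.integrable_norm_pow (p := 2) (by norm_num))
  have c1 : ∫ x in Ioi (0 : ℝ), ⟪Real.exp (-(k * |x|)) • g 0, t x⟫_ℝ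
      = ∫ x in Ioi (0 : ℝ), ⟪Real.exp (-(k * x)) • g 0, t x⟫_ℝ :=
    setIntegral_congr_fun measurableSet_Ioi fun x hx => by
      simp only [abs_of_pos (show 0 < x from hx)]
  have c2 : ∫ x in Ioi (0 : ℝ), ⟪Real.exp (-(k * |-x|)) • g 0, t (-x)⟫_ℝ
      = ∫ x in Ioi (0 : ℝ), ⟪Real.exp (-(k * x)) • g 0, t (-x)⟫_ℝ :=
    setIntegral_congr_fun measurableSet_Ioi fun x hx => by
      simp only [abs_neg, abs_of_pos (show 0 < x from hx)]
  have c3 : ∫ x in Ioi (0 : ℝ), ‖g x - Real.exp (-(k * |x|)) • g 0‖ ^ 2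
      = ∫ x in Ioi (0 : ℝ), ‖g x - Real.exp (-(k * x)) • g 0‖ ^ 2 :=
    setIntegral_congr_fun measurableSet_Ioi fun x hx => by
      simp only [abs_of_pos (show 0 < x from hx)]
  have c4 : ∫ x in Ioi (0 : ℝ), ‖g (-x) - Real.exp (-(k * |-x|)) • g 0‖ ^ 2
      = ∫ x in Ioi (0 : ℝ), ‖g (-x) - Real.exp (-(k * x)) • g 0‖ ^ 2 :=
    setIntegral_congr_fun measurableSet_Ioi fun x hx => by
      simp only [abs_neg, abs_of_pos (show 0 < x from hx)]
  rw [c1, c2] at s2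
  rw [c3, c4] at s3
  -- the left half-line contributes a non-negative amount
  have hleft : ε * ∫ x in Ioi 0, ‖g (-x) - Real.exp (-(k * x)) • g 0‖ ^ 2 ≤
      ∫ x in Ioi 0, (‖-g' (-x) + (k * Real.exp (-(k * x))) • g 0‖ ^ 2
        + ((x - -k) ^ 2 - E) * ‖g (-x) - Real.exp (-(k * x)) • g 0‖ ^ 2) := by
    have mρ0 : MemLp (fun x => Real.exp (-(k * x)) • g 0) 2 (volume.restrict (Ioi 0)) := by
      have := (memLp_exp hk0).ofReal (K := ℂ) |>.mul_const (g 0)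
      exact this.ae_eq (Filter.Eventually.of_forall fun x => by simp)
    have mxρ0 : MemLp (fun x => (x - -k) • (Real.exp (-(k * x)) • g 0)) 2
        (volume.restrict (Ioi 0)) := by
      have := (memLp_mul_exp hk0 (-k)).ofReal (K := ℂ) |>.mul_const (g 0)
      exact this.ae_eq (Filter.Eventually.of_forall fun x => by simp [mul_assoc])
    have n0 := ((mneg m0).sub mρ0).integrable_norm_pow (p := 2) (by norm_num)
    have n2 := ((mneg m2).add mxρ0).integrable_norm_pow (p := 2) (by norm_num)
    have n1 := ((mneg m1).neg.add (mρ0.const_smul k)).integrable_norm_pow (p := 2) (by norm_num)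
    rw [← integral_const_mul]
    refine setIntegral_mono_on (n0.const_mul ε) ?_ measurableSet_Ioi fun x hx => ?_
    · refine (n1.add (n2.sub (n0.const_mul E))).congr (Filter.Eventually.of_forall fun x => ?_)
      simp only [Pi.add_apply, Pi.sub_apply, Pi.neg_apply, Pi.smul_apply, smul_smul]
      have : (-x - k) • g (-x) + ((x - -k) * Real.exp (-(k * x))) • g 0
          = (-(x - -k)) • (g (-x) - Real.exp (-(k * x)) • g 0) := by
        module
      rw [this, norm_smul, mul_pow, Real.norm_eq_abs, sq_abs]
      ring
    · have hx : 0 < x := hx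
      have h1 : ε ≤ (x - -k) ^ 2 - E := by nlinarith
      have h2 := mul_le_mul_of_nonneg_right h1
        (sq_nonneg ‖g (-x) - Real.exp (-(k * x)) • g 0‖)
      linarith [sq_nonneg ‖-g' (-x) + (k * Real.exp (-(k * x))) • g 0‖]
  have hb : (k ^ 2 + k ^ 2 - E) / (2 * k) - k / (2 * k ^ 2) + 1 / (4 * k ^ 3)
      + ((k ^ 2 + (-k) ^ 2 - E) / (2 * k) - (-k) / (2 * k ^ 2) + 1 / (4 * k ^ 3)) ≤ 2 * k := by
    have e : (k ^ 2 + k ^ 2 - E) / (2 * k) - k / (2 * k ^ 2) + 1 / (4 * k ^ 3)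
      + ((k ^ 2 + (-k) ^ 2 - E) / (2 * k) - (-k) / (2 * k ^ 2) + 1 / (4 * k ^ 3))
        = 2 * k - (E - 1 / (2 * k ^ 2)) / k := by
      field_simp
      ring
    have h1 : 1 / (2 * k ^ 2) ≤ 1 := by
      rw [div_le_one (by positivity)]
      nlinarith
    have h2 : 0 ≤ (E - 1 / (2 * k ^ 2)) / k := div_nonneg (by linarith) hk0.le
    linarith
  have hb' := mul_le_mul_of_nonneg_left hb (sq_nonneg ‖g 0‖)
  rw [inner_neg_right] at hL
  rw [s1, s2, s3]
  linarith

theorem L2_sum_smul_ae {α : Type*} [MeasurableSpace α] {μ : Measure α} {ι : Type*} [Fintype ι]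
    {f : ι → Lp ℂ 2 μ} {f' : ι → α → ℂ} (h : ∀ i, f i =ᵐ[μ] f' i) (c : ι → ℂ) :
    (∑ i, c i • f i : Lp ℂ 2 μ) =ᵐ[μ] fun x => ∑ i, c i * f' i x := by
  have h1 := Lp.coeFn_finsetSum (p := 2) (μ := μ) Finset.univ fun i => c i • f i
  have h2 : ∀ᵐ x ∂μ, ∀ i, (c i • f i : Lp ℂ 2 μ) x = c i * f' i x := by
    rw [ae_all_iff]
    intro i
    filter_upwards [Lp.coeFn_smul (c i) (f i), h i] with x e1 e2
    rw [e1, Pi.smul_apply, e2, smul_eq_mul]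
  filter_upwards [h1, h2] with x e1 e2
  rw [e1, Finset.sum_apply]
  exact Finset.sum_congr rfl fun i _ => e2 i

theorem integral_real_inner_eq {α : Type*} [MeasurableSpace α] {μ : Measure α} {f g : Lp ℂ 2 μ}
    {f' g' : α → ℂ} (h : f =ᵐ[μ] f') (h' : g =ᵐ[μ] g') :
    ∫ x, ⟪f' x, g' x⟫_ℝ ∂μ = (⟪f, g⟫_ℂ).re := by
  have hi : Integrable (fun x => (starRingEnd ℂ) (f' x) * g' x) μ := by
    refine (L2.integrable_inner (𝕜 := ℂ) f g).congr ?_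
    filter_upwards [h, h'] with x e1 e2
    rw [e1, e2, RCLike.inner_apply, mul_comm]
  rw [L2_inner_eq_of_ae h h']
  refine Eq.trans (integral_congr_ae (Filter.Eventually.of_forall fun x => ?_)) (integral_re hi)
  simp only [Complex.inner]
  rw [mul_comm]
  rfl

set_option maxHeartbeats 1000000 in
/-- The trial space spanned by the first `m + 1` trial functions bounds `λ_{m+1}(k)`. -/
theorem formBound_of_trial {m : ℕ} {k : ℝ} (hk : 1 < k) (hp : hermiteFun m k 0 ≠ 0)
    (hps : |hermiteFun m k 0| + ∑ i : Fin m, |hermiteFun i k 0| ≤ 1 / (4 * k ^ 2))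
    (hD : (2 * k + 4 * ((m : ℝ) + 1) ^ 2 / k) * (1 + k ^ 2) *
      (∑ i : Fin m, |hermiteFun i k 0|) ^ 2 ≤ 1)
    (hε : 2 * m + 1 + (2 * k + (16 * ((m : ℝ) + 1) ^ 2 + 8) / k) * |hermiteFun m k 0| ^ 2
      ≤ k ^ 2) :
    FormBound k (m + 1)
      (2 * m + 1 + (2 * k + (16 * ((m : ℝ) + 1) ^ 2 + 8) / k) * |hermiteFun m k 0| ^ 2) := by
  have hk0 : 0 < k := by linarith
  set p := |hermiteFun m k 0| with hpdef
  set s := ∑ i : Fin m, |hermiteFun i k 0| with hsdef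
  set E : ℝ := 2 * m + 1 with hEdef
  set ε := (2 * k + (16 * ((m : ℝ) + 1) ^ 2 + 8) / k) * p ^ 2 with hεdef
  choose z hz hz0 hz1 hz2 using exists_trial_mem_formDomain hk0
  have key : ∀ c : Fin (m + 1) → ℂ, c ≠ 0 →
      ‖(∑ i, c i • z i).snd‖ ^ 2 < (E + ε) * ‖(∑ i, c i • z i).fst‖ ^ 2 := by
    intro c hc
    set w := ∑ i, c i • z i with hw
    let g : ℝ → ℂ := fun x => ∑ i, c i * (hermiteFun i k x : ℂ)
    let g' : ℝ → ℂ := fun x => ∑ i, c i * (hermiteFunDeriv i k x : ℂ)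
    let e : Fin (m + 1) → ℝ := fun i => 2 * (i : ℝ) + 1 - E
    let t : ℝ → ℂ := fun x => ∑ i, ((e i : ℂ) * c i) * (hermiteFun i k x : ℂ)
    have hg : ∀ x, HasDerivAt g (g' x) x := fun x =>
      HasDerivAt.fun_sum fun i _ => (hasDerivAt_hermiteFun i k x).ofReal_comp.const_mul (c i)
    have hg' : ∀ x, HasDerivAt g' (((x - k) ^ 2 - E) • g x - t x) x := fun x => by
      refine (HasDerivAt.fun_sum (u := Finset.univ) fun (i : Fin (m + 1)) _ =>
        (hasDerivAt_hermiteFunDeriv i k x).ofReal_comp.const_mul (c i)).congr_deriv ?_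
      simp only [g, t, Finset.smul_sum, ← Finset.sum_sub_distrib, Complex.real_smul, e]
      refine Finset.sum_congr rfl fun i _ => ?_
      push_cast
      ring
    have m0 : MemLp g 2 volume := memLp_finsetSum _ fun i _ =>
      (memLp_hermiteFun i k).ofReal.const_mul (c i)
    have m1 : MemLp g' 2 volume := memLp_finsetSum _ fun i _ =>
      (memLp_hermiteFunDeriv i k).ofReal.const_mul (c i)
    have mt : MemLp t 2 volume := memLp_finsetSum _ fun i _ =>
      (memLp_hermiteFun i k).ofReal.const_mul _
    have m2 : MemLp (fun x => (x - k) • g x) 2 volume := by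
      have h : MemLp (fun x => ∑ i, c i * (((x - k) * hermiteFun i k x : ℝ) : ℂ)) 2 volume :=
        memLp_finsetSum _ fun i _ => (memLp_mul_hermiteFun i k).ofReal.const_mul (c i)
      refine h.ae_eq (Filter.Eventually.of_forall fun x => ?_)
      simp only [g, Finset.smul_sum, Complex.real_smul]
      refine Finset.sum_congr rfl fun i _ => ?_
      push_cast
      ring
    -- the three components of the trial vector
    have w0 : w.fst =ᵐ[volume.restrict (Ioi 0)]
        fun x => g x - Real.exp (-(k * x)) • g 0 := by
      have h1 : w.fst = ∑ i, c i • (z i).fst :=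
        map_sum (WithLp.fstₗ 2 ℂ L2HalfLine (WithLp 2 (L2HalfLine × L2HalfLine)))
          (fun i : Fin (m + 1) => c i • z i) Finset.univ
      rw [h1]
      refine (L2_sum_smul_ae (fun i : Fin (m + 1) => hz0 i) c).trans
        (Filter.Eventually.of_forall fun x => ?_)
      simp only [g, trialFun, Finset.smul_sum, ← Finset.sum_sub_distrib, Complex.real_smul]
      exact Finset.sum_congr rfl fun i _ => by ring
    have hsnd : w.snd = ∑ i, c i • (z i).snd :=
      map_sum (WithLp.sndₗ 2 ℂ L2HalfLine (WithLp 2 (L2HalfLine × L2HalfLine)))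
        (fun i : Fin (m + 1) => c i • z i) Finset.univ
    have w1 : w.snd.fst =ᵐ[volume.restrict (Ioi 0)]
        fun x => g' x + (k * Real.exp (-(k * x))) • g 0 := by
      have h1 : w.snd.fst = ∑ i, c i • (z i).snd.fst := by
        rw [hsnd]
        exact map_sum (WithLp.fstₗ 2 ℂ L2HalfLine L2HalfLine)
          (fun i : Fin (m + 1) => c i • (z i).snd) Finset.univ
      rw [h1]
      refine (L2_sum_smul_ae (fun i : Fin (m + 1) => hz1 i) c).trans
        (Filter.Eventually.of_forall fun x => ?_)
      simp only [g, g', trialFunDeriv, Finset.smul_sum, ← Finset.sum_add_distrib,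
        Complex.real_smul]
      refine Finset.sum_congr rfl fun i _ => ?_
      push_cast
      ring
    have w2 : w.snd.snd =ᵐ[volume.restrict (Ioi 0)]
        fun x => (x - k) • (g x - Real.exp (-(k * x)) • g 0) := by
      have h1 : w.snd.snd = ∑ i, c i • (z i).snd.snd := by
        rw [hsnd]
        exact map_sum (WithLp.sndₗ 2 ℂ L2HalfLine L2HalfLine)
          (fun i : Fin (m + 1) => c i • (z i).snd) Finset.univ
      rw [h1]
      refine (L2_sum_smul_ae (fun i : Fin (m + 1) => hz2 i) c).trans
        (Filter.Eventually.of_forall fun x => ?_)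
      simp only [g, trialFun, Finset.smul_sum, ← Finset.sum_sub_distrib, Complex.real_smul]
      refine Finset.sum_congr rfl fun i _ => ?_
      push_cast
      ring
    have hnorm : ‖w.snd‖ ^ 2 - E * ‖w.fst‖ ^ 2
        = ∫ x in Ioi 0, (‖g' x + (k * Real.exp (-(k * x))) • g 0‖ ^ 2
          + ((x - k) ^ 2 - E) * ‖g x - Real.exp (-(k * x)) • g 0‖ ^ 2) := by
      have i0 : IntegrableOn (fun x => ‖g x - Real.exp (-(k * x)) • g 0‖ ^ 2) (Ioi 0) :=
        ((memLp_congr_ae w0).1 (Lp.memLp w.fst)).integrable_norm_pow (p := 2) (by norm_num)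
      have i1 : IntegrableOn (fun x => ‖g' x + (k * Real.exp (-(k * x))) • g 0‖ ^ 2) (Ioi 0) :=
        ((memLp_congr_ae w1).1 (Lp.memLp w.snd.fst)).integrable_norm_pow (p := 2) (by norm_num)
      have i2 : IntegrableOn (fun x => ‖(x - k) • (g x - Real.exp (-(k * x)) • g 0)‖ ^ 2)
          (Ioi 0) :=
        ((memLp_congr_ae w2).1 (Lp.memLp w.snd.snd)).integrable_norm_pow (p := 2) (by norm_num)
      have i12 : IntegrableOn (fun x => ‖g' x + (k * Real.exp (-(k * x))) • g 0‖ ^ 2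
          + ‖(x - k) • (g x - Real.exp (-(k * x)) • g 0)‖ ^ 2) (Ioi 0) := i1.add i2
      rw [norm_sq_pair w.snd, L2_norm_sq_eq_of_ae w0, L2_norm_sq_eq_of_ae w1,
        L2_norm_sq_eq_of_ae w2, ← integral_add i1 i2, ← integral_const_mul,
        ← integral_sub i12 (i0.const_mul E)]
      refine integral_congr_ae (Filter.Eventually.of_forall fun x => ?_)
      simp only
      rw [norm_smul (x - k), mul_pow, Real.norm_eq_abs, sq_abs]
      ring
    have hE1 : 1 ≤ E := by
      rw [hEdef]
      linarith [(Nat.cast_nonneg m : (0 : ℝ) ≤ m)]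
    have hle := trial_energy_le hk.le hE1 hε hg hg' m0 m1 m2 mt
    rw [← hnorm, ← L2_norm_sq_eq_of_ae w0] at hle
    -- on the line, the orthonormality of the Hermite functions is available
    have hort : Orthonormal ℂ fun i : Fin (m + 1) => hermiteL2 i k :=
      (orthonormal_hermiteL2 k).comp _ Fin.val_injective
    let gv : Lp ℂ 2 (volume : Measure ℝ) := ∑ i : Fin (m + 1), c i • hermiteL2 i k
    let tv : Lp ℂ 2 (volume : Measure ℝ) := ∑ i : Fin (m + 1), ((e i : ℂ) * c i) • hermiteL2 i k
    have hgv : gv =ᵐ[volume] g := L2_sum_smul_ae (fun i : Fin (m + 1) => hermiteL2_ae i k) c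
    have htv : tv =ᵐ[volume] t := L2_sum_smul_ae (fun i : Fin (m + 1) => hermiteL2_ae i k) _
    obtain ⟨mρ, hρ⟩ := memLp_exp_abs hk0
    let ρv : Lp ℂ 2 (volume : Measure ℝ) := (mρ.ofReal (K := ℂ)).toLp _
    have hρv : ρv =ᵐ[volume] fun x => ((Real.exp (-(k * |x|)) : ℝ) : ℂ) := MemLp.coeFn_toLp _
    have hρn : ‖ρv‖ ^ 2 = 1 / k := by
      rw [L2_norm_sq_eq_of_ae hρv, ← hρ]
      simp only [Complex.norm_real, Real.norm_eq_abs, sq_abs]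
    have hρg : (g 0 • ρv : Lp ℂ 2 (volume : Measure ℝ)) =ᵐ[volume]
        fun x => Real.exp (-(k * |x|)) • g 0 := by
      filter_upwards [Lp.coeFn_smul (g 0) ρv, hρv] with x e1 e2
      rw [e1, Pi.smul_apply, e2, smul_eq_mul, Complex.real_smul, mul_comm]
    have hfv : (gv - g 0 • ρv : Lp ℂ 2 (volume : Measure ℝ)) =ᵐ[volume]
        fun x => g x - Real.exp (-(k * |x|)) • g 0 := by
      filter_upwards [Lp.coeFn_sub gv (g 0 • ρv), hgv, hρg] with x e1 e2 e3
      rw [e1, Pi.sub_apply, e2, e3]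
    rw [integral_real_inner_eq hgv htv, integral_real_inner_eq hρg htv,
      ← L2_norm_sq_eq_of_ae hfv] at hle
    have hgg : ‖gv‖ ^ 2 = ∑ i, ‖c i‖ ^ 2 := by
      have h1 : ⟪gv, gv⟫_ℂ = ∑ i, (starRingEnd ℂ) (c i) * c i := hort.inner_sum _ _ _
      rw [inner_self_eq_norm_sq_to_K] at h1
      simp_rw [conj_mul'] at h1
      apply Complex.ofReal_injective
      push_cast
      exact h1
    have hgt : (⟪gv, tv⟫_ℂ).re = ∑ i, e i * ‖c i‖ ^ 2 := by
      have h1 : ⟪gv, tv⟫_ℂ = ∑ i, (starRingEnd ℂ) (c i) * ((e i : ℂ) * c i) :=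
        hort.inner_sum _ _ _
      have h2 : ⟪gv, tv⟫_ℂ = ((∑ i, e i * ‖c i‖ ^ 2 : ℝ) : ℂ) := by
        rw [h1]
        push_cast
        refine Finset.sum_congr rfl fun i _ => ?_
        rw [← conj_mul']
        ring
      rw [h2, Complex.ofReal_re]
    have htt : ‖tv‖ ^ 2 = ∑ i, e i ^ 2 * ‖c i‖ ^ 2 := by
      have h1 : ⟪tv, tv⟫_ℂ = ∑ i, (starRingEnd ℂ) ((e i : ℂ) * c i) * ((e i : ℂ) * c i) :=
        hort.inner_sum _ _ _
      rw [inner_self_eq_norm_sq_to_K] at h1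
      simp_rw [conj_mul', norm_mul, Complex.norm_real, Real.norm_eq_abs] at h1
      apply Complex.ofReal_injective
      push_cast
      refine h1.trans (Finset.sum_congr rfl fun i _ => ?_)
      rw [← Complex.ofReal_pow, mul_pow, sq_abs]
      push_cast
      ring
    set a := ‖c (Fin.last m)‖ with ha
    set d := Real.sqrt (∑ i : Fin m, ‖c i.castSucc‖ ^ 2) with hd
    have hd2 : d ^ 2 = ∑ i : Fin m, ‖c i.castSucc‖ ^ 2 :=
      Real.sq_sqrt (Finset.sum_nonneg fun i _ => by positivity)
    have hci : ∀ i : Fin m, ‖c i.castSucc‖ ≤ d := fun i => by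
      refine Real.le_sqrt_of_sq_le ?_
      exact Finset.single_le_sum (f := fun i : Fin m => ‖c i.castSucc‖ ^ 2)
        (fun i _ => sq_nonneg _) (Finset.mem_univ i)
    have elast : e (Fin.last m) = 0 := by simp [e, hEdef]
    have ecast : ∀ i : Fin m, e i.castSucc = 2 * (i : ℝ) - 2 * m := fun i => by
      simp only [e, hEdef, Fin.val_castSucc]; ring
    have ecast2 : ∀ i : Fin m, (i : ℝ) + 1 ≤ m := fun i => by exact_mod_cast i.2
    have b1 : (⟪gv, tv⟫_ℂ).re ≤ -2 * d ^ 2 := by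
      rw [hgt, Fin.sum_univ_castSucc, elast, hd2, Finset.mul_sum, zero_mul, add_zero]
      refine Finset.sum_le_sum fun i _ => ?_
      have h1 : e i.castSucc ≤ -2 := by
        rw [ecast]
        linarith [ecast2 i]
      exact mul_le_mul_of_nonneg_right h1 (sq_nonneg _)
    have b2 : ‖tv‖ ≤ 2 * ((m : ℝ) + 1) * d := by
      refine le_of_sq_le_sq ?_ (by positivity)
      rw [htt, Fin.sum_univ_castSucc, elast, mul_pow, hd2, Finset.mul_sum]
      simp only [ne_eq, OfNat.ofNat_ne_zero, not_false_eq_true, zero_pow, zero_mul, add_zero]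
      refine Finset.sum_le_sum fun i _ => ?_
      refine mul_le_mul_of_nonneg_right ?_ (sq_nonneg _)
      rw [ecast]
      have h1 := ecast2 i
      have h2 : (0 : ℝ) ≤ (i : ℕ) := Nat.cast_nonneg _
      exact sq_le_sq' (by linarith) (by linarith)
    have b3 : ‖g 0‖ ≤ a * p + s * d := by
      simp only [g]
      rw [Fin.sum_univ_castSucc, add_comm]
      refine (norm_add_le _ _).trans (add_le_add (le_of_eq ?_) ((norm_sum_le _ _).trans ?_))
      · rw [norm_mul, Complex.norm_real, Real.norm_eq_abs, Fin.val_last]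
      · rw [hsdef, Finset.sum_mul]
        refine Finset.sum_le_sum fun i _ => ?_
        rw [norm_mul, Complex.norm_real, Real.norm_eq_abs, mul_comm, Fin.val_castSucc]
        exact mul_le_mul_of_nonneg_left (hci i) (abs_nonneg _)
    have hs0 : 0 ≤ s := Finset.sum_nonneg fun i _ => abs_nonneg _
    have hG0 : 0 ≤ a * p + s * d := (norm_nonneg _).trans b3
    have b4 : -(‖g 0‖ * ‖ρv‖ * ‖tv‖) ≤ (⟪g 0 • ρv, tv⟫_ℂ).re := by
      have h1 := norm_inner_le_norm (𝕜 := ℂ) (g 0 • ρv) tv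
      rw [norm_smul] at h1
      exact (abs_le.1 ((Complex.abs_re_le_norm _).trans h1)).1
    have b5 : ‖gv‖ - (a * p + s * d) * ‖ρv‖ ≤ ‖gv - g 0 • ρv‖ := by
      have h1 := norm_sub_norm_le gv (g 0 • ρv)
      rw [norm_smul] at h1
      have h2 := mul_le_mul_of_nonneg_right b3 (norm_nonneg ρv)
      linarith
    have hR0 : 0 < ‖gv‖ := by
      rw [norm_pos_iff]
      intro h0
      refine hc (funext fun i => ?_)
      have h1 := hgg
      rw [h0, norm_zero, zero_pow two_ne_zero] at h1
      have h2 := (Finset.sum_eq_zero_iff_of_nonneg (fun i _ => sq_nonneg ‖c i‖)).1 h1.symm i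
        (Finset.mem_univ i)
      simpa using h2
    have hlt := trial_scalar_lt (n := (m : ℝ) + 1) (Q := (⟪gv, tv⟫_ℂ).re
        - 2 * (⟪g 0 • ρv, tv⟫_ℂ).re + 2 * k * ‖g 0‖ ^ 2)
      (by linarith [(Nat.cast_nonneg m : (0 : ℝ) ≤ m)]) hk (abs_pos.2 hp) hs0 (norm_nonneg _)
      (Real.sqrt_nonneg _) hρn (R := ‖gv‖) (a := a) (d := d)
      (by rw [hgg, Fin.sum_univ_castSucc, hd2, add_comm]) hR0 hps hD b5 (by
        have h1 : ‖g 0‖ * ‖ρv‖ * ‖tv‖ ≤ (a * p + s * d) * ‖ρv‖ * (2 * ((m : ℝ) + 1) * d) :=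
          mul_le_mul (mul_le_mul_of_nonneg_right b3 (norm_nonneg _)) b2 (norm_nonneg _)
            (mul_nonneg hG0 (norm_nonneg _))
        have h2 : 2 * k * ‖g 0‖ ^ 2 ≤ 2 * k * (a * p + s * d) ^ 2 :=
          mul_le_mul_of_nonneg_left (pow_le_pow_left₀ (norm_nonneg _) b3 2) (by linarith)
        linarith)
    rw [← hpdef, ← hεdef] at hlt
    linarith
  have hzd : ∀ i : Fin (m + 1), z i ∈ formDomain (fiberCore k) := fun i => hz i
  refine ⟨Submodule.span ℂ (range fun i : Fin (m + 1) => z i), Submodule.span_le.2 ?_,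
    FiniteDimensional.span_of_finite ℂ (finite_range _), ?_, ?_⟩
  · rintro _ ⟨i, rfl⟩
    exact hz i
  · rw [finrank_span_eq_card, Fintype.card_fin]
    rw [Fintype.linearIndependent_iff]
    intro c h0
    by_contra! hne
    have h1 := key c fun h => by
      obtain ⟨i, hi⟩ := hne
      exact hi (congrFun h i)
    rw [h0] at h1
    simp at h1
  · intro w hw
    obtain ⟨c, rfl⟩ := (Submodule.mem_span_range_iff_exists_fun ℂ).1 hw
    by_cases hc : c = 0
    · simp [hc]
    · exact (key c hc).le

theorem trial_parameters {M B k p s : ℝ} (hM : 0 ≤ M) (hB : B = 16 * (M + 1) ^ 2 + 8) (hk : 1 < k)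
    (hkB : 2 * B ≤ k) (hp : 0 ≤ p) (hs : 0 ≤ s) (h : k ^ 2 * (p + s) * B ≤ 1) :
    p + s ≤ 1 / (4 * k ^ 2) ∧ (2 * k + 4 * (M + 1) ^ 2 / k) * (1 + k ^ 2) * s ^ 2 ≤ 1 ∧
      2 * M + 1 + (2 * k + B / k) * p ^ 2 ≤ k ^ 2 := by
  have hk0 : 0 < k := by linarith
  have hM2 : 1 ≤ (M + 1) ^ 2 := one_le_pow₀ (by linarith)
  have hB8 : 8 ≤ B := by linarith
  have hk2 : 1 ≤ k ^ 2 := one_le_pow₀ hk.le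
  have hkk : k ≤ k ^ 2 := by rw [sq]; exact le_mul_of_one_le_left hk0.le hk.le
  have hps : 0 ≤ k ^ 2 * (p + s) := by positivity
  refine ⟨?_, ?_, ?_⟩
  · rw [le_div_iff₀ (by positivity)]
    have : k ^ 2 * (p + s) * 4 ≤ k ^ 2 * (p + s) * B :=
      mul_le_mul_of_nonneg_left (by linarith) hps
    linarith
  · have h3 : 4 * (M + 1) ^ 2 / k ≤ 4 * (M + 1) ^ 2 * k := by
      rw [div_le_iff₀ hk0, mul_assoc]
      exact le_mul_of_one_le_right (by positivity) (by rw [← sq]; exact hk2)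
    have h4 : k ^ 2 * s * B ≤ 1 := by
      have : k ^ 2 * s * B ≤ k ^ 2 * (p + s) * B := by gcongr; linarith
      linarith
    have h5 : k ^ 3 ≤ k ^ 4 := pow_le_pow_right₀ hk.le (by norm_num)
    have h6 : 4 + 8 * (M + 1) ^ 2 ≤ B ^ 2 := by
      have : B * 8 ≤ B ^ 2 := by rw [sq]; gcongr
      linarith
    calc (2 * k + 4 * (M + 1) ^ 2 / k) * (1 + k ^ 2) * s ^ 2
        ≤ (2 * k + 4 * (M + 1) ^ 2 * k) * (k ^ 2 + k ^ 2) * s ^ 2 := by gcongr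
      _ = (4 + 8 * (M + 1) ^ 2) * (k ^ 3 * s ^ 2) := by ring
      _ ≤ B ^ 2 * (k ^ 4 * s ^ 2) := by gcongr
      _ = (k ^ 2 * s * B) ^ 2 := by ring
      _ ≤ 1 := pow_le_one₀ (by positivity) h4
  · have h3 : p ≤ 1 := by
      have h7 : p + s ≤ k ^ 2 * (p + s) := le_mul_of_one_le_left (by positivity) hk2
      have h8 : k ^ 2 * (p + s) ≤ k ^ 2 * (p + s) * B :=
        le_mul_of_one_le_right hps (by linarith)
      linarith
    have h4 : (2 * k + B / k) * p ^ 2 ≤ (2 * k + B / k) * 1 :=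
      mul_le_mul_of_nonneg_left (pow_le_one₀ hp h3) (by positivity)
    have h9 : B / k ≤ B := div_le_self (by linarith) hk.le
    have h5 : 2 * M + 1 ≤ B := by
      have : M + 1 ≤ (M + 1) ^ 2 := by
        rw [sq]; exact le_mul_of_one_le_left (by linarith) (by linarith)
      linarith
    have h10 : 16 * k ≤ k ^ 2 := by rw [sq]; gcongr; linarith
    linarith

/-- The upper bound `λ_n(k) ≤ E_n + (2 k + O(1 / k)) ψ(0)²` as `k → ∞`, where `ψ` is the Hermite
function of the level `E_n`. -/
theorem eventually_formBound (m : ℕ) : ∀ᶠ k in Filter.atTop, FormBound k (m + 1)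
    (2 * m + 1 + (2 * k + (16 * ((m : ℝ) + 1) ^ 2 + 8) / k) * |hermiteFun m k 0| ^ 2) := by
  obtain ⟨B, hB⟩ : ∃ B : ℝ, B = 16 * ((m : ℝ) + 1) ^ 2 + 8 := ⟨_, rfl⟩
  have hB8 : 8 ≤ B := by rw [hB]; linarith [sq_nonneg ((m : ℝ) + 1)]
  have hlim : Filter.Tendsto (fun k => k ^ 2 * |hermiteFun m k 0|
      + ∑ i : Fin m, k ^ 2 * |hermiteFun i k 0|) Filter.atTop (nhds 0) := by
    have h1 : ∀ j, Filter.Tendsto (fun k => k ^ 2 * |hermiteFun j k 0|) Filter.atTop (nhds 0) :=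
      fun j => by
        have h2 := (tendsto_pow_mul_polyGauss_zero (hermiteNormPoly j) 2).abs
        rw [abs_zero] at h2
        refine h2.congr fun k => ?_
        rw [abs_mul, abs_of_nonneg (sq_nonneg k)]
        rfl
    simpa using (h1 m).add (tendsto_finsetSum Finset.univ fun (i : Fin m) _ => h1 i)
  filter_upwards [eventually_hermiteFun_zero_ne m, Filter.eventually_gt_atTop 1,
    hlim.eventually_lt_const (u := 1 / B) (by positivity),
    Filter.eventually_ge_atTop (2 * B)] with k hne hk hsmall hkB
  rw [← Finset.mul_sum, ← mul_add, lt_div_iff₀ (by linarith)] at hsmall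
  obtain ⟨h1, h2, h3⟩ := trial_parameters (Nat.cast_nonneg m) hB hk hkB
    (abs_nonneg (hermiteFun m k 0)) (Finset.sum_nonneg fun (i : Fin m) _ =>
      abs_nonneg (hermiteFun i k 0)) hsmall.le
  rw [hB] at h3
  exact formBound_of_trial hk hne h1 h2 h3

/-! ### The current carried by an eigenfunction -/

theorem landauLevel_succ (m : ℕ) : landauLevel (m + 1) = 2 * m + 1 := by
  rw [landauLevel]
  push_cast
  ring

section Family

variable {u : ℕ → ℝ → L2HalfLine}

/-- The current `2 ∫ (x - k) |u_m(x, k)|² dx` carried by the eigenfunction `u_m(·, k)`; it equals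
`-λ_m'(k)`. -/
def fiberCurrent (u : ℕ → ℝ → L2HalfLine) (m : ℕ) (k : ℝ) : ℝ :=
  2 * ∫ x in Ioi (0 : ℝ), (x - k) * ‖u m k x‖ ^ 2

/-- The current is the square of the boundary derivative of the eigenfunction, which in turn is
tied to the distance to the Landau level by Green's formula with the Hermite function. -/
theorem IsEigenfunctionFamily.fiberCurrent_bounds (hu : IsEigenfunctionFamily u) (m : ℕ) (k : ℝ) :
    0 < fiberCurrent u (m + 1) k ∧
      fiberCurrent u (m + 1) k * hermiteFun m k 0 ^ 2
        ≤ (bandFunction (m + 1) k - landauLevel (m + 1)) ^ 2 ∧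
      fiberCurrent u (m + 1) k ≤ 1 + bandFunction (m + 1) k := by
  obtain ⟨h1, h2⟩ := isNormalizedEigenvector_fiber_iff.1 (hu (m + 1) (by omega) k)
  obtain ⟨Y, Z, hYZ, hY⟩ := exists_isDirichletSolution h2
  set v := u (m + 1) k with hv
  set t := bandFunction (m + 1) k with ht
  have hnorm : ∫ x in Ioi (0 : ℝ), ‖Y x‖ ^ 2 = 1 := by
    rw [← L2_norm_sq_eq_of_ae hY, h1, one_pow]
  have hcur : fiberCurrent u (m + 1) k = 2 * ∫ x in Ioi (0 : ℝ), (x - k) * ‖Y x‖ ^ 2 := by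
    rw [fiberCurrent]
    congr 1
    refine integral_congr_ae ?_
    filter_upwards [hY] with x hx
    rw [← hv, hx]
  have hcur2 := hcur.trans hYZ.two_mul_integral_eq
  refine ⟨?_, ?_, ?_⟩
  · rw [hcur2]
    have hZ : Z 0 ≠ 0 := by
      intro h0
      have h3 := hYZ.eq_zero_of_deriv_zero h0
      have h4 : ∫ x in Ioi (0 : ℝ), ‖Y x‖ ^ 2 = ∫ x in Ioi (0 : ℝ), (0 : ℝ) :=
        setIntegral_congr_fun measurableSet_Ioi fun x hx => by
          simp only [h3 x (le_of_lt hx), norm_zero]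
          norm_num
      rw [hnorm, integral_zero] at h4
      exact one_ne_zero h4
    positivity
  · have hψ := (memLp_hermiteFun m k).restrict (Ioi (0 : ℝ))
    have h3 := hYZ.deriv_zero_mul_eq (E := landauLevel (m + 1)) (hasDerivAt_hermiteFun m k)
      (fun x => by rw [landauLevel_succ]; exact hasDerivAt_hermiteFunDeriv m k x) hψ
      ((memLp_hermiteFunDeriv m k).restrict _)
    -- Cauchy-Schwarz for the overlap of the two functions
    have h4 : ‖∫ x in Ioi (0 : ℝ), Y x * hermiteFun m k x‖ ≤ 1 := by
      let ψv : L2HalfLine := (hψ.ofReal (K := ℂ)).toLp _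
      have hψv : ψv =ᵐ[volume.restrict (Ioi 0)] fun x => (hermiteFun m k x : ℂ) :=
        MemLp.coeFn_toLp _
      have h5 : ⟪ψv, v⟫_ℂ = ∫ x in Ioi (0 : ℝ), Y x * hermiteFun m k x := by
        rw [L2_inner_eq_of_ae hψv hY]
        refine integral_congr_ae (Filter.Eventually.of_forall fun x => ?_)
        simp only [Complex.conj_ofReal]
        ring
      have h6 : ‖ψv‖ ^ 2 ≤ 1 := by
        rw [L2_norm_sq_eq_of_ae hψv]
        have h7 := integral_hermiteFun_mul m m k
        rw [if_pos rfl] at h7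
        rw [← h7]
        refine le_trans (le_of_eq (integral_congr_ae (Filter.Eventually.of_forall fun x => ?_)))
          (setIntegral_le_integral (integrable_polyGauss_mul _ _ k)
            (Filter.Eventually.of_forall fun x => mul_self_nonneg _))
        simp only [Complex.norm_real, Real.norm_eq_abs, sq_abs]
        exact sq _
      have h8 : ‖ψv‖ ≤ 1 := (sq_le_one_iff₀ (norm_nonneg _)).1 h6
      rw [← h5]
      refine (norm_inner_le_norm _ _).trans ?_
      rw [h1, mul_one]
      exact h8
    have h9 := congrArg (fun z : ℂ => ‖z‖ ^ 2) h3
    simp only [norm_mul, Complex.norm_real, Real.norm_eq_abs, mul_pow, sq_abs] at h9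
    rw [hcur2, h9]
    exact mul_le_of_le_one_right (sq_nonneg _) (pow_le_one₀ (norm_nonneg _) h4)
  · obtain ⟨g, hg, h⟩ := h2
    simp only at hg h
    have h3 := inner_eq_of_mem_topologicalClosure h hg
    simp only [inner_smul_right] at h3
    rw [inner_self_eq_norm_sq_to_K, inner_self_eq_norm_sq_to_K, h1] at h3
    have h4 : ‖g‖ ^ 2 = t := by
      apply Complex.ofReal_injective
      simpa using h3
    have h5 : ∫ x in Ioi (0 : ℝ), (x - k) ^ 2 * ‖Y x‖ ^ 2 ≤ t := by
      have h6 : g.snd =ᵐ[volume.restrict (Ioi 0)] fun x => ((x - k : ℝ) : ℂ) * Y x := by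
        filter_upwards [(fiber_closure_ae hg).1, hY] with x e1 e2
        rw [e1, e2]
      have h7 := L2_norm_sq_eq_of_ae h6
      simp_rw [norm_mul, Complex.norm_real, Real.norm_eq_abs, mul_pow, sq_abs] at h7
      rw [← h7, ← h4, norm_sq_pair g]
      linarith [sq_nonneg ‖g.fst‖]
    rw [hcur, ← integral_const_mul]
    calc ∫ x in Ioi (0 : ℝ), 2 * ((x - k) * ‖Y x‖ ^ 2)
        ≤ ∫ x in Ioi (0 : ℝ), (‖Y x‖ ^ 2 + (x - k) ^ 2 * ‖Y x‖ ^ 2) := by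
          refine integral_mono (hYZ.integrable_mul_norm_sq.const_mul 2)
            (hYZ.integrable_norm_sq.add hYZ.integrable_sq_mul_norm_sq) fun x => ?_
          simp only
          have : 0 ≤ (x - k - 1) ^ 2 * ‖Y x‖ ^ 2 := by positivity
          linarith
      _ = 1 + ∫ x in Ioi (0 : ℝ), (x - k) ^ 2 * ‖Y x‖ ^ 2 := by
          rw [integral_add hYZ.integrable_norm_sq hYZ.integrable_sq_mul_norm_sq, hnorm]
      _ ≤ 1 + t := by linarith

theorem pow_mul_exp_neg_le {q : ℕ} {T t : ℝ} (h0 : 0 < T) (hT : (q : ℝ) ≤ T) (ht : T ≤ t) :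
    t ^ q * Real.exp (-t) ≤ T ^ q * Real.exp (-T) := by
  have h1 : t ≤ T * Real.exp (t / T - 1) := by
    have := Real.add_one_le_exp (t / T - 1)
    rw [sub_add_cancel, div_le_iff₀ h0] at this
    linarith
  have h2 : t ^ q ≤ T ^ q * Real.exp (t - T) := by
    calc t ^ q ≤ (T * Real.exp (t / T - 1)) ^ q := pow_le_pow_left₀ (by linarith) h1 q
      _ = T ^ q * Real.exp (q * (t / T - 1)) := by rw [mul_pow, ← Real.exp_nat_mul]
      _ ≤ T ^ q * Real.exp (t - T) := by
        gcongr
        have h3 : T * (t / T - 1) = t - T := by field_simp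
        rw [← h3]
        have : 0 ≤ t / T - 1 := by
          rw [sub_nonneg, le_div_iff₀ h0]
          linarith
        gcongr
  calc t ^ q * Real.exp (-t) ≤ T ^ q * Real.exp (t - T) * Real.exp (-t) := by gcongr
    _ = T ^ q * Real.exp (-T) := by
      rw [mul_assoc, ← Real.exp_add]
      congr 2
      ring

/-- For large wave numbers the current is controlled both by the distance to the Landau level and
by a Gaussian, with constants that do not depend on the choice of the eigenfunctions. With `ψ` the
Hermite function, the current is at most `(λ - E)² / ψ(0)²`, while `λ - E` is at most
`(2 k + b / k) ψ(0)²`; use this bound for one or for both of the factors `λ - E`. -/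
theorem IsEigenfunctionFamily.exists_fiberCurrent_le (hu : IsEigenfunctionFamily u) (m : ℕ) :
    ∃ (K b C : ℝ) (q : ℕ), 1 ≤ K ∧ 0 ≤ b ∧ 0 < C ∧ 1 ≤ q ∧ b ≤ K ^ 2 ∧
      landauLevel (m + 1) < bandFunction (m + 1) K ∧
      ∀ u, IsEigenfunctionFamily u → ∀ k, K ≤ k →
        fiberCurrent u (m + 1) k
          ≤ (2 * k + b / k) * (bandFunction (m + 1) k - landauLevel (m + 1)) ∧
        fiberCurrent u (m + 1) k ≤ C * ((k ^ 2) ^ q * Real.exp (-k ^ 2)) := by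
  obtain ⟨D, d, hD, hd⟩ := exists_polyGauss_zero_sq_le (hermiteNormPoly m)
  obtain ⟨b, hb⟩ : ∃ b : ℝ, b = 16 * ((m : ℝ) + 1) ^ 2 + 8 := ⟨_, rfl⟩
  have hb8 : 8 ≤ b := by rw [hb]; linarith [sq_nonneg ((m : ℝ) + 1)]
  obtain ⟨K, hK⟩ := Filter.eventually_atTop.1 ((eventually_formBound m).and
    ((eventually_hermiteFun_zero_ne m).and (Filter.eventually_ge_atTop b)))
  have hKb := (hK K le_rfl).2.2
  refine ⟨K, b, (2 + b) ^ 2 * D, d + 2, by linarith, by linarith, by positivity, by omega, ?_,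
    ?_, ?_⟩
  · rw [sq]
    exact hKb.trans (le_mul_of_one_le_left (by linarith) (by linarith))
  · obtain ⟨h1, h2, -⟩ := hu.fiberCurrent_bounds m K
    have h3 := hu.landauLevel_le (by omega : 1 ≤ m + 1) K
    refine lt_of_le_of_ne h3 fun h4 => ?_
    rw [← h4, sub_self, zero_pow two_ne_zero] at h2
    have h5 := (hK K le_rfl).2.1
    have : 0 < fiberCurrent u (m + 1) K * hermiteFun m K 0 ^ 2 := by positivity
    linarith
  · intro u hu k hk
    obtain ⟨hF, hne, hkb⟩ := hK k hk
    have hk1 : 1 ≤ k := by linarith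
    obtain ⟨h1, h2, -⟩ := hu.fiberCurrent_bounds m k
    have h3 := hu.landauLevel_le (by omega : 1 ≤ m + 1) k
    have h4 := hF.bandFunction_le (by omega)
    rw [sq_abs, ← hb, ← landauLevel_succ] at h4
    have hp : 0 < hermiteFun m k 0 ^ 2 := by positivity
    have hpe : hermiteFun m k 0 ^ 2 ≤ D * k ^ d * Real.exp (-k ^ 2) := hd k hk1
    generalize hermiteFun m k 0 ^ 2 = p at *
    generalize fiberCurrent u (m + 1) k = S at *
    obtain ⟨ε, hε⟩ : ∃ ε, ε = bandFunction (m + 1) k - landauLevel (m + 1) := ⟨_, rfl⟩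
    rw [← hε] at h2 ⊢
    have hε0 : 0 ≤ ε := by linarith
    have hε1 : ε ≤ (2 * k + b / k) * p := by linarith
    have h5 : S ≤ (2 * k + b / k) * ε := by
      refine le_of_mul_le_mul_right (h2.trans ?_) hp
      calc ε ^ 2 = ε * ε := sq ε
        _ ≤ ((2 * k + b / k) * p) * ε := by gcongr
        _ = _ := by ring
    refine ⟨h5, ?_⟩
    have h6 : 2 * k + b / k ≤ (2 + b) * k := by
      have : b / k ≤ b * k := by
        rw [div_le_iff₀ (by linarith), mul_assoc]
        exact le_mul_of_one_le_right (by linarith) (by nlinarith)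
      linarith
    calc S ≤ (2 * k + b / k) * ε := h5
      _ ≤ (2 * k + b / k) * ((2 * k + b / k) * p) := by gcongr
      _ ≤ ((2 + b) * k) * (((2 + b) * k) * (D * k ^ d * Real.exp (-k ^ 2))) := by gcongr
      _ = (2 + b) ^ 2 * D * (k ^ (d + 2) * Real.exp (-k ^ 2)) := by ring
      _ ≤ (2 + b) ^ 2 * D * ((k ^ 2) ^ (d + 2) * Real.exp (-k ^ 2)) := by
        gcongr
        exact le_self_pow₀ hk1 two_ne_zero

/-- The numerical part of the argument: the two bounds on the current for large `k` are played off
against each other at the threshold `k² = L + 2 q log L`, where `L = |log δ|`. -/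
theorem IsEigenfunctionFamily.exists_fiberCurrent_le_add (hu : IsEigenfunctionFamily u) (m : ℕ) :
    ∃ μ δ₀ : ℝ, 0 < μ ∧ 0 < δ₀ ∧ ∀ δ : ℝ, 0 < δ → δ < δ₀ → ∃ A B : ℝ, 0 ≤ B ∧
      A + B * δ ≤ 2 * δ * Real.sqrt |Real.log δ|
        + μ * (δ * Real.log |Real.log δ| / Real.sqrt |Real.log δ|) ∧
      ∀ u, IsEigenfunctionFamily u → ∀ k, fiberCurrent u (m + 1) k
        ≤ A + B * (bandFunction (m + 1) k - landauLevel (m + 1)) := by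
  obtain ⟨K, b, C, q, hK1, hb, hC, hq, hbK, hgap, hlarge⟩ := hu.exists_fiberCurrent_le m
  obtain ⟨E, hE⟩ : ∃ E, E = landauLevel (m + 1) := ⟨_, rfl⟩
  rw [← hE] at hgap
  simp_rw [← hE] at hlarge ⊢
  have hE1 : 1 ≤ E := by rw [hE]; exact one_le_landauLevel (by omega)
  obtain ⟨η, hη⟩ : ∃ η, η = bandFunction (m + 1) K - E := ⟨_, rfl⟩
  have hη0 : 0 < η := by linarith
  have hlog : ∀ᶠ L : ℝ in Filter.atTop, 2 * (q : ℝ) * Real.log L ≤ L := by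
    have h := Real.isLittleO_log_id_atTop.def (c := 1 / (2 * (q : ℝ) + 1)) (by positivity)
    filter_upwards [h, Filter.eventually_ge_atTop 1] with L hL hL1
    have h2 := Real.log_nonneg hL1
    rw [Real.norm_of_nonneg h2, id, Real.norm_of_nonneg (by linarith), one_div,
      inv_mul_eq_div, le_div_iff₀ (by positivity)] at hL
    nlinarith
  obtain ⟨L₀, hL₀⟩ := Filter.eventually_atTop.1 (hlog.and ((Filter.eventually_ge_atTop
    (Real.exp 1)).and ((Filter.eventually_ge_atTop (q : ℝ)).and ((Filter.eventually_ge_atTop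
    (((1 + E) / η + 1) ^ 2)).and (Filter.eventually_ge_atTop (K ^ 2))))))
  refine ⟨C * 2 ^ q + 2 * q + b, Real.exp (-L₀), by positivity, Real.exp_pos _, fun δ hδ hδ' => ?_⟩
  have hlogδ : Real.log δ < -L₀ := by
    have := Real.log_lt_log hδ hδ'
    rwa [Real.log_exp] at this
  obtain ⟨hL1, hL2, hL3, hL4, hL5⟩ := hL₀ (-Real.log δ) (by linarith)
  have hLpos : 0 < -Real.log δ := (Real.exp_pos 1).trans_le hL2
  have habs : |Real.log δ| = -Real.log δ := abs_of_neg (by linarith)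
  rw [habs]
  obtain ⟨L, hL⟩ : ∃ L, L = -Real.log δ := ⟨_, rfl⟩
  rw [← hL] at hL1 hL2 hL3 hL4 hL5 hLpos ⊢
  have hδL : δ = Real.exp (-L) := by rw [hL, neg_neg, Real.exp_log hδ]
  have hexp1 : (2 : ℝ) < Real.exp 1 := by linarith [Real.exp_one_gt_d9]
  have hLge1 : 1 ≤ L := by linarith
  have hl1 : 1 ≤ Real.log L := by
    rw [Real.le_log_iff_exp_le hLpos]
    exact hL2
  obtain ⟨l, hl⟩ : ∃ l, l = Real.log L := ⟨_, rfl⟩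
  rw [← hl] at hl1 hL1 ⊢
  obtain ⟨r, hr⟩ : ∃ r, r = Real.sqrt L := ⟨_, rfl⟩
  rw [← hr]
  have hr0 : 0 < r := by rw [hr]; exact Real.sqrt_pos.2 hLpos
  have hr2 : r ^ 2 = L := by rw [hr]; exact Real.sq_sqrt hLpos.le
  have hr1 : 1 ≤ r := by rw [hr]; exact Real.one_le_sqrt.2 hLge1
  have hq0 : (0 : ℝ) ≤ q := Nat.cast_nonneg q
  -- the threshold for `k²`: beyond it, the Gaussian bound is absorbed by the error term
  obtain ⟨T, hT⟩ : ∃ T, T = L + 2 * q * l := ⟨_, rfl⟩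
  have hql : 0 ≤ 2 * (q : ℝ) * l := by positivity
  have hLT : L ≤ T := by linarith
  have hT0 : 0 < T := by linarith
  obtain ⟨κ, hκ⟩ : ∃ κ, κ = Real.sqrt T := ⟨_, rfl⟩
  have hκ2 : κ ^ 2 = T := by rw [hκ]; exact Real.sq_sqrt hT0.le
  have hrκ : r ≤ κ := by rw [hr, hκ]; exact Real.sqrt_le_sqrt hLT
  have hκ0 : 0 < κ := by linarith
  have hκr : κ ≤ r + q * l / r := by
    rw [hκ]
    refine Real.sqrt_le_iff.2 ⟨by positivity, ?_⟩
    have h1 : (r + q * l / r) ^ 2 = r ^ 2 + 2 * q * l + (q * l / r) ^ 2 := by field_simp; ring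
    rw [h1, hr2, hT]
    linarith [sq_nonneg (q * l / r)]
  have hKκ : K ≤ κ := by
    refine le_trans ?_ hrκ
    rw [hr]
    exact Real.le_sqrt_of_sq_le hL5
  have hB0 : 0 ≤ 2 * κ + b / κ := by positivity
  refine ⟨C * 2 ^ q * (δ * l / r), 2 * κ + b / κ, hB0, ?_, ?_⟩
  · have h1 : b / κ ≤ b * l / r := by
      calc b / κ ≤ b / r := by gcongr
        _ ≤ b * l / r := by
          gcongr
          exact le_mul_of_one_le_right hb hl1
    calc C * 2 ^ q * (δ * l / r) + (2 * κ + b / κ) * δ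
        ≤ C * 2 ^ q * (δ * l / r) + (2 * (r + q * l / r) + b * l / r) * δ := by gcongr
      _ = _ := by ring
  · intro u hu k
    obtain ⟨h1, -, h3⟩ := hu.fiberCurrent_bounds m k
    have h4 := hu.landauLevel_le (by omega : 1 ≤ m + 1) k
    rw [← hE] at h4
    have hA0 : 0 ≤ C * 2 ^ q * (δ * l / r) := by positivity
    have hε0 : 0 ≤ bandFunction (m + 1) k - E := by linarith
    rcases le_total k K with hkK | hkK
    · -- bounded or negative wave numbers: the distance to the Landau level is at least `η`
      have h5 := hu.antitone (by omega : 1 ≤ m + 1) hkK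
      have h6 : η ≤ bandFunction (m + 1) k - E := by linarith
      have h7 : (1 + E) / η + 1 ≤ r := by
        rw [hr]
        exact Real.le_sqrt_of_sq_le hL4
      have h8 : 1 + E ≤ (1 + E) / η * (bandFunction (m + 1) k - E) := by
        rw [div_mul_eq_mul_div, le_div_iff₀ hη0]
        gcongr
      have h9 : ((1 + E) / η + 1) * (bandFunction (m + 1) k - E)
          ≤ (2 * κ + b / κ) * (bandFunction (m + 1) k - E) := by
        refine mul_le_mul_of_nonneg_right ?_ hε0
        have : 0 ≤ b / κ := by positivity
        linarith
      linarith
    · obtain ⟨h5, h6⟩ := hlarge u hu k hkK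
      rcases le_total k κ with hkκ | hkκ
      · have hk0 : 0 < k := by linarith
        have h7 : 2 * k + b / k ≤ 2 * κ + b / κ := by
          have h8 : b / k - b / κ ≤ κ - k := by
            have e : b / k - b / κ = (κ - k) * (b / (k * κ)) := by
              field_simp
            rw [e]
            refine mul_le_of_le_one_right (by linarith) ?_
            rw [div_le_one (by positivity)]
            refine hbK.trans ?_
            rw [sq]
            gcongr
          linarith
        have h8 := mul_le_mul_of_nonneg_right h7 hε0
        linarith
      · have h7 : T ≤ k ^ 2 := by
          rw [← hκ2]
          gcongr
        have h8 := pow_mul_exp_neg_le (q := q) hT0 (hL3.trans hLT) h7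
        have h9 : Real.exp (-T) = δ * (L ^ (2 * q))⁻¹ := by
          rw [hT, neg_add, Real.exp_add, ← hδL, Real.exp_neg, hl]
          congr 2
          rw [mul_comm, Real.exp_mul, Real.exp_log hLpos]
          exact_mod_cast Real.rpow_natCast L (2 * q)
        have h10 : T ^ q * Real.exp (-T) ≤ 2 ^ q * (δ * l / r) := by
          calc T ^ q * Real.exp (-T) ≤ (2 * L) ^ q * Real.exp (-T) := by
                gcongr
                linarith
            _ = 2 ^ q * (δ * (L ^ q)⁻¹) := by
              rw [h9, mul_pow, two_mul, pow_add]
              field_simp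
            _ ≤ 2 ^ q * (δ * (l / r)) := by
              gcongr
              have h11 : r ≤ L ^ q := by
                calc r ≤ r ^ 2 := le_self_pow₀ hr1 two_ne_zero
                  _ = L := hr2
                  _ ≤ L ^ q := le_self_pow₀ hLge1 (by omega)
              calc (L ^ q)⁻¹ ≤ r⁻¹ := by gcongr
                _ ≤ l / r := by
                  rw [inv_eq_one_div]
                  gcongr
            _ = _ := by ring
        have h12 : 0 ≤ (2 * κ + b / κ) * (bandFunction (m + 1) k - E) := mul_nonneg hB0 hε0
        calc fiberCurrent u (m + 1) k ≤ C * ((k ^ 2) ^ q * Real.exp (-k ^ 2)) := h6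
          _ ≤ C * (2 ^ q * (δ * l / r)) := mul_le_mul_of_nonneg_left (h8.trans h10) hC.le
          _ ≤ _ := by linarith

end Family

/-! ### Slices of functions on the half-plane -/

theorem volume_restrict_halfPlane : (volume : Measure (ℝ × ℝ)).restrict halfPlane =
    (volume.restrict (Ioi (0 : ℝ))).prod (volume : Measure ℝ) := by
  have h : halfPlane = Ioi (0 : ℝ) ×ˢ (univ : Set ℝ) := by
    ext p
    simp [halfPlane]
  rw [h, Measure.volume_eq_prod, ← Measure.prod_restrict, Measure.restrict_univ]

theorem ae_slice {p : ℝ × ℝ → Prop}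
    (h : ∀ᵐ q ∂((volume : Measure (ℝ × ℝ)).restrict halfPlane), p q) :
    ∀ᵐ k : ℝ, ∀ᵐ x ∂(volume.restrict (Ioi (0 : ℝ))), p (x, k) := by
  rw [volume_restrict_halfPlane] at h
  have h2 := Measure.measurePreserving_swap
    (μ := (volume : Measure ℝ)) (ν := volume.restrict (Ioi (0 : ℝ)))
  exact Measure.ae_ae_of_ae_prod (h2.quasiMeasurePreserving.ae h)

open Classical in
/-- The slice `f(·, k)` of a function on the half-plane, set to zero for the exceptional `k` for
which it is not square integrable. -/
def slice (f : L2Plane) (k : ℝ) : L2HalfLine :=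
  if h : MemLp (fun x => f (x, k)) 2 (volume.restrict (Ioi 0)) then h.toLp _ else 0

theorem integrable_norm_sq_plane (f : L2Plane) :
    Integrable (fun p => ‖f p‖ ^ 2)
      ((volume.restrict (Ioi (0 : ℝ))).prod (volume : Measure ℝ)) := by
  rw [← volume_restrict_halfPlane]
  exact (Lp.memLp f).integrable_norm_pow (p := 2) (by norm_num)

theorem slice_ae (f : L2Plane) :
    ∀ᵐ k : ℝ, slice f k =ᵐ[volume.restrict (Ioi 0)] fun x => f (x, k) := by
  have h1 := (integrable_norm_sq_plane f).prod_left_ae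
  have hm : AEStronglyMeasurable (fun p : ℝ × ℝ => f p)
      ((volume.restrict (Ioi (0 : ℝ))).prod (volume : Measure ℝ)) := by
    rw [← volume_restrict_halfPlane]
    exact (Lp.memLp f).aestronglyMeasurable
  have h2 := hm.prod_swap.prodMk_left
  filter_upwards [h1, h2] with k hk hk2
  have h : MemLp (fun x => f (x, k)) 2 (volume.restrict (Ioi 0)) :=
    (memLp_two_iff_integrable_sq_norm hk2).2 hk
  rw [slice, dif_pos h]
  exact h.coeFn_toLp

theorem slice_ae_of_ae {f : L2Plane} {f' : ℝ × ℝ → ℂ}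
    (h : f =ᵐ[volume.restrict halfPlane] f') :
    ∀ᵐ k : ℝ, slice f k =ᵐ[volume.restrict (Ioi 0)] fun x => f' (x, k) := by
  filter_upwards [slice_ae f, ae_slice h] with k h1 h2
  exact h1.trans h2

theorem slice_sub_ae (f g : L2Plane) : ∀ᵐ k : ℝ, slice (f - g) k = slice f k - slice g k := by
  filter_upwards [slice_ae_of_ae (Lp.coeFn_sub f g), slice_ae f, slice_ae g] with k h1 h2 h3
  refine Lp.ext ?_
  filter_upwards [h1, h2, h3, Lp.coeFn_sub (slice f k) (slice g k)] with x e1 e2 e3 e4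
  rw [e1, e4, Pi.sub_apply, Pi.sub_apply, e2, e3]

theorem inner_plane_integrable (f g : L2Plane) :
    Integrable (fun p => ⟪f p, g p⟫_ℂ)
      ((volume.restrict (Ioi (0 : ℝ))).prod (volume : Measure ℝ)) := by
  rw [← volume_restrict_halfPlane]
  exact L2.integrable_inner f g

theorem inner_slice_ae (f g : L2Plane) :
    (fun k => ⟪slice f k, slice g k⟫_ℂ) =ᵐ[volume]
      fun k => ∫ x in Ioi (0 : ℝ), ⟪f (x, k), g (x, k)⟫_ℂ := by
  filter_upwards [slice_ae f, slice_ae g] with k h1 h2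
  rw [L2.inner_def]
  refine integral_congr_ae ?_
  filter_upwards [h1, h2] with x e1 e2
  rw [e1, e2]

theorem integrable_inner_slice (f g : L2Plane) :
    Integrable fun k => ⟪slice f k, slice g k⟫_ℂ :=
  (inner_plane_integrable f g).integral_prod_right.congr (inner_slice_ae f g).symm

/-- Fubini's theorem for the inner product of `L²(Ω)`. -/
theorem inner_eq_integral_slice (f g : L2Plane) :
    ⟪f, g⟫_ℂ = ∫ k, ⟪slice f k, slice g k⟫_ℂ := by
  rw [integral_congr_ae (inner_slice_ae f g), L2.inner_def,
    ← integral_prod_symm _ (inner_plane_integrable f g)]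
  exact congrArg (fun ν => ∫ p, ⟪f p, g p⟫_ℂ ∂ν) volume_restrict_halfPlane

theorem integrable_norm_sq_slice (f : L2Plane) : Integrable fun k => ‖slice f k‖ ^ 2 := by
  refine (integrable_inner_slice f f).re.congr (Filter.Eventually.of_forall fun k => ?_)
  simp only [inner_self_eq_norm_sq_to_K]
  norm_cast

theorem norm_sq_eq_integral_slice (f : L2Plane) : ‖f‖ ^ 2 = ∫ k, ‖slice f k‖ ^ 2 := by
  have h := inner_eq_integral_slice f f
  have h2 : ∀ k, ⟪slice f k, slice f k⟫_ℂ = ((‖slice f k‖ ^ 2 : ℝ) : ℂ) := fun k => by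
    rw [inner_self_eq_norm_sq_to_K]; norm_cast
  simp_rw [h2] at h
  rw [integral_complex_ofReal, inner_self_eq_norm_sq_to_K] at h
  apply Complex.ofReal_injective
  push_cast at h ⊢
  exact h

/-- Convergence in `L²(Ω)` implies convergence of almost all slices along a subsequence. -/
theorem exists_tendsto_slice {ι : Type*} [Fintype ι] {F : ι → ℕ → L2Plane} {f : ι → L2Plane}
    (h : ∀ i, Filter.Tendsto (F i) Filter.atTop (nhds (f i))) :
    ∃ ns : ℕ → ℕ, StrictMono ns ∧ ∀ᵐ k : ℝ, ∀ i,
      Filter.Tendsto (fun j => slice (F i (ns j)) k) Filter.atTop (nhds (slice (f i) k)) := by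
  let H : ℕ → ℝ → ℝ := fun j k => ∑ i, ‖slice (F i j - f i) k‖ ^ 2
  have hH : ∀ j, Integrable (H j) := fun j =>
    integrable_finsetSum _ fun i _ => integrable_norm_sq_slice _
  have hint : ∀ j, ∫ k, H j k = ∑ i, ‖F i j - f i‖ ^ 2 := fun j => by
    rw [integral_finsetSum _ fun i _ => integrable_norm_sq_slice _]
    exact Finset.sum_congr rfl fun i _ => (norm_sq_eq_integral_slice _).symm
  have hlim : Filter.Tendsto (fun j => ∫ k, H j k) Filter.atTop (nhds 0) := by
    simp_rw [hint]
    have := tendsto_finsetSum Finset.univ fun (i : ι) _ =>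
      (tendsto_iff_norm_sub_tendsto_zero.1 (h i)).pow 2
    simpa using this
  have hmeas : TendstoInMeasure volume H Filter.atTop (fun _ => (0 : ℝ)) := by
    refine tendstoInMeasure_of_tendsto_eLpNorm one_ne_zero
      (fun j => (hH j).aestronglyMeasurable) aestronglyMeasurable_const ?_
    have e : ∀ j, eLpNorm (H j - fun _ => (0 : ℝ)) 1 volume = ENNReal.ofReal (∫ k, H j k) := by
      intro j
      have e1 : (H j - fun _ => (0 : ℝ)) = H j := by
        funext k
        simp
      rw [e1, eLpNorm_one_eq_lintegral_enorm, ofReal_integral_eq_lintegral_ofReal (hH j)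
        (Filter.Eventually.of_forall fun k => Finset.sum_nonneg fun i _ => by positivity)]
      refine lintegral_congr fun k => ?_
      rw [Real.enorm_of_nonneg (Finset.sum_nonneg fun i _ => by positivity)]
    simp_rw [e]
    have := (ENNReal.continuous_ofReal.tendsto 0).comp hlim
    rw [ENNReal.ofReal_zero] at this
    exact this
  obtain ⟨ns, hns, hae⟩ := hmeas.exists_seq_tendsto_ae
  refine ⟨ns, hns, ?_⟩
  have hsub : ∀ᵐ k : ℝ, ∀ i, ∀ j, slice (F i j - f i) k = slice (F i j) k - slice (f i) k := by
    rw [ae_all_iff]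
    intro i
    rw [ae_all_iff]
    intro j
    exact slice_sub_ae _ _
  filter_upwards [hae, hsub] with k hk hks i
  rw [tendsto_iff_norm_sub_tendsto_zero]
  have h1 : Filter.Tendsto (fun j => ‖slice (F i (ns j)) k - slice (f i) k‖ ^ 2) Filter.atTop
      (nhds 0) := by
    refine squeeze_zero (fun j => by positivity) (fun j => ?_) hk
    rw [← hks]
    exact Finset.single_le_sum (f := fun i => ‖slice (F i (ns j) - f i) k‖ ^ 2)
      (fun i _ => by positivity) (Finset.mem_univ i)
  have h2 := (Real.continuous_sqrt.tendsto 0).comp h1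
  rw [Real.sqrt_zero] at h2
  refine h2.congr fun j => ?_
  simp only [Function.comp_apply]
  exact Real.sqrt_sq (norm_nonneg _)

/-! ### Energy and current of a state in the bulk space -/

/-- A state with energy in `(a, b)` lies in the form domain of the Hamiltonian, and the form is at
most `b ‖φ‖²` there. -/
theorem exists_lift_of_energyConcentrated {a b : ℝ} (ha : 0 ≤ a) {φ : L2Plane}
    (h : EnergyConcentrated hamiltonian (Ioo a b) φ) :
    ∃ g, (φ, g) ∈ planeCore.topologicalClosure ∧ ‖g‖ ^ 2 ≤ b * ‖φ‖ ^ 2 := by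
  obtain ⟨S, hS⟩ := h
  have h0 : S.proj ∅ φ = 0 := by
    have h1 := S.measure_apply φ ∅ MeasurableSet.empty
    rw [measure_empty] at h1
    have h2 := ENNReal.ofReal_eq_zero.1 h1.symm
    have h3 : ‖S.proj ∅ φ‖ ^ 2 = 0 := le_antisymm h2 (by positivity)
    simpa using h3
  have hcompl : S.measure φ (Ioo a b)ᶜ = 0 := by
    rw [S.measure_apply φ _ measurableSet_Ioo.compl]
    have h1 := S.proj_inter _ _ (measurableSet_Ioo (a := a) (b := b)).compl
      (measurableSet_Ioo (a := a) (b := b))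
    rw [compl_inter_self] at h1
    have h2 : S.proj (Ioo a b)ᶜ φ = S.proj ∅ φ := by
      rw [h1, mul_apply_eq_comp, hS]
    rw [h2, h0]
    simp
  have hae : ∀ᵐ t ∂(S.measure φ), t ∈ Ioo a b := hcompl
  have huniv : S.measure φ univ = ENNReal.ofReal (‖φ‖ ^ 2) := by
    rw [S.measure_apply φ _ MeasurableSet.univ, S.proj_univ, one_apply_eq_self]
  have hfin : IsFiniteMeasure (S.measure φ) := ⟨by rw [huniv]; exact ENNReal.ofReal_lt_top⟩
  have hdom : φ ∈ hamiltonian.domain := by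
    rw [S.mem_domain_iff]
    calc ∫⁻ t, ENNReal.ofReal (t ^ 2) ∂(S.measure φ)
        ≤ ∫⁻ _, ENNReal.ofReal (b ^ 2) ∂(S.measure φ) := by
          refine lintegral_mono_ae ?_
          filter_upwards [hae] with t ht
          refine ENNReal.ofReal_le_ofReal (pow_le_pow_left₀ (ha.trans ht.1.le) ht.2.le 2)
      _ < ⊤ := by
        rw [lintegral_const]
        exact ENNReal.mul_lt_top ENNReal.ofReal_lt_top (measure_lt_top _ _)
  have hint : ∫ t, t ∂(S.measure φ) ≤ b * ‖φ‖ ^ 2 := by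
    have hi : Integrable (fun t : ℝ => t) (S.measure φ) := by
      refine Integrable.of_bound (C := b) (by fun_prop) ?_
      filter_upwards [hae] with t ht
      rw [Real.norm_of_nonneg (ha.trans ht.1.le)]
      exact ht.2.le
    calc ∫ t, t ∂(S.measure φ) ≤ ∫ _, b ∂(S.measure φ) := by
          refine integral_mono_ae hi (integrable_const b) ?_
          filter_upwards [hae] with t ht
          exact ht.2.le
      _ = b * ‖φ‖ ^ 2 := by
        rw [integral_const, measureReal_def, huniv, ENNReal.toReal_ofReal (by positivity),
          smul_eq_mul, mul_comm]
  have hgraph : (φ, hamiltonian ⟨φ, hdom⟩) ∈ formGraph planeCore := by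
    rw [← hamiltonian_graph]
    exact hamiltonian.mem_graph ⟨φ, hdom⟩
  obtain ⟨g, hg, hgi⟩ := hgraph
  refine ⟨g, hg, ?_⟩
  have h1 := inner_eq_of_mem_topologicalClosure hgi hg
  simp only at h1
  have h2 := S.inner_apply ⟨φ, hdom⟩
  simp only at h2
  rw [h2, inner_self_eq_norm_sq_to_K] at h1
  have h3 : ‖g‖ ^ 2 = ∫ t, t ∂(S.measure φ) := by
    apply Complex.ofReal_injective
    rw [← h1]
    push_cast
    rfl
  rw [h3]
  exact hint

theorem IsTest.dx {U : Set (ℝ × ℝ)} {ψ : ℝ × ℝ → ℂ} (h : IsTest U ψ) : IsTest U (dx ψ) :=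
  ⟨(h.contDiff.fderiv_right (m := ∞) (by simp)).clm_apply contDiff_const,
    h.hasCompactSupport.fderiv_apply ℝ (1, 0),
    (tsupport_fderiv_apply_subset ℝ (1, 0)).trans h.tsupport_subset⟩

theorem IsTest.dy {U : Set (ℝ × ℝ)} {ψ : ℝ × ℝ → ℂ} (h : IsTest U ψ) :
    IsTest U (fun p => fderiv ℝ ψ p (0, 1)) :=
  ⟨(h.contDiff.fderiv_right (m := ∞) (by simp)).clm_apply contDiff_const,
    h.hasCompactSupport.fderiv_apply ℝ (0, 1),
    (tsupport_fderiv_apply_subset ℝ (0, 1)).trans h.tsupport_subset⟩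

theorem IsTest.kin {U : Set (ℝ × ℝ)} {ψ : ℝ × ℝ → ℂ} (h : IsTest U ψ) : IsTest U (kin ψ) := by
  have h1 := h.dy.const_smul (-I)
  have h2 : IsTest U fun p : ℝ × ℝ => (p.1 : ℂ) * ψ p :=
    h.mul_left (ofRealCLM.contDiff.comp contDiff_fst)
  have h3 := h1.add (h2.const_smul (-1))
  refine (funext fun p => ?_ : _ = HalfPlaneHall.kin ψ) ▸ h3
  simp only [Pi.add_apply, Pi.smul_apply, smul_eq_mul, HalfPlaneHall.kin]
  ring

/-- The operator `-i ∂_y - x` is symmetric on test functions. -/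
theorem integral_conj_mul_kin {ψ χ : ℝ × ℝ → ℂ} (hψ : IsTest halfPlane ψ)
    (hχ : IsTest halfPlane χ) :
    ∫ p in halfPlane, (starRingEnd ℂ) (ψ p) * kin χ p
      = ∫ p in halfPlane, (starRingEnd ℂ) (kin ψ p) * χ p := by
  have hcψ := hψ.conj
  rw [hχ.kin.setIntegral_eq (fun p => (starRingEnd ℂ) (ψ p) * kin χ p) fun p hp => by
      rw [hp, mul_zero],
    hχ.setIntegral_eq (fun p => (starRingEnd ℂ) (kin ψ p) * χ p) fun p hp => by rw [hp, mul_zero]]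
  have hfd : ∀ p, fderiv ℝ (fun p => (starRingEnd ℂ) (ψ p)) p (0, 1)
      = (starRingEnd ℂ) (fderiv ℝ ψ p (0, 1)) := fun p => by
    have h := (conjCLE.toContinuousLinearMap.hasFDerivAt (x := ψ p)).comp p
      (hψ.differentiable p).hasFDerivAt
    have h2 := h.fderiv
    change fderiv ℝ (fun p => (starRingEnd ℂ) (ψ p)) p = _ at h2
    rw [h2]
    rfl
  have hcont : ∀ {f g : ℝ × ℝ → ℂ}, Continuous f → IsTest halfPlane g →
      Integrable fun p => f p * g p := fun hf hg =>
    (hf.mul hg.continuous).integrable_of_hasCompactSupport (hg.hasCompactSupport.mul_left)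
  have hibp := integral_mul_fderiv_eq_neg_fderiv_mul_of_integrable (𝕜 := ℂ) (μ := volume)
    (f := fun p => (starRingEnd ℂ) (ψ p)) (g := χ) (v := ((0 : ℝ), (1 : ℝ)))
    (hcont hcψ.dy.continuous hχ) (hcont hcψ.continuous hχ.dy) (hcont hcψ.continuous hχ)
    (fun p _ => hcψ.differentiable p) (fun p _ => hχ.differentiable p)
  have i1 : Integrable fun p => -I * ((starRingEnd ℂ) (ψ p) * fderiv ℝ χ p (0, 1)) :=
    (hcont hcψ.continuous hχ.dy).const_mul _
  have i2 : Integrable fun p : ℝ × ℝ => (starRingEnd ℂ) (ψ p) * ((p.1 : ℂ) * χ p) :=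
    hcont hcψ.continuous (hχ.mul_left (ofRealCLM.contDiff.comp contDiff_fst))
  have i3 : Integrable fun p => I * (fderiv ℝ (fun p => (starRingEnd ℂ) (ψ p)) p (0, 1) * χ p) :=
    (hcont hcψ.dy.continuous hχ).const_mul _
  have e1 : ∀ p : ℝ × ℝ, (starRingEnd ℂ) (ψ p) * kin χ p
      = -I * ((starRingEnd ℂ) (ψ p) * fderiv ℝ χ p (0, 1))
        - (starRingEnd ℂ) (ψ p) * ((p.1 : ℂ) * χ p) := fun p => by
    rw [kin]; ring
  have e2 : ∀ p : ℝ × ℝ, (starRingEnd ℂ) (kin ψ p) * χ p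
      = I * (fderiv ℝ (fun p => (starRingEnd ℂ) (ψ p)) p (0, 1) * χ p)
        - (starRingEnd ℂ) (ψ p) * ((p.1 : ℂ) * χ p) := fun p => by
    rw [kin, hfd, map_sub, map_mul, map_mul, map_neg, conj_I, Complex.conj_ofReal]
    ring
  simp_rw [e1, e2]
  rw [integral_sub i1 i2, integral_sub i3 i2, integral_const_mul, integral_const_mul, hibp]
  ring

/-- Vectors in the domain of the closed form lie in the domain of the current. -/
theorem mem_kinGraph_of_mem_closure {φ : L2Plane} {g : WithLp 2 (L2Plane × L2Plane)}
    (h : (φ, g) ∈ planeCore.topologicalClosure) : (φ, g.snd) ∈ kinGraph := by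
  intro ψ hψ a b ha hb
  have hclosed : IsClosed {q : L2Plane × WithLp 2 (L2Plane × L2Plane) |
      ⟪a, q.2.snd⟫_ℂ = ⟪b, q.1⟫_ℂ} := by
    have : Continuous fun q : L2Plane × WithLp 2 (L2Plane × L2Plane) => q.2.snd :=
      (WithLp.sndL 2 ℂ L2Plane L2Plane).continuous.comp continuous_snd
    exact isClosed_eq (by fun_prop) (by fun_prop)
  refine closure_minimal ?_ hclosed h
  rintro q ⟨χ, hχ, h1, -, h3⟩
  change ⟪a, q.2.snd⟫_ℂ = ⟪b, q.1⟫_ℂ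
  rw [L2_inner_eq_of_ae ha h3, L2_inner_eq_of_ae hb h1]
  exact integral_conj_mul_kin hψ hχ

theorem exists_currentOperator_eq {φ g : L2Plane} (h : (φ, g) ∈ kinGraph) :
    ∃ hφ : φ ∈ currentOperator.domain, currentOperator ⟨φ, hφ⟩ = (-2 : ℂ) • g := by
  rw [← kinGraph_toLinearPMap_graph, LinearPMap.mem_graph_iff] at h
  obtain ⟨y, hy1, hy2⟩ := h
  simp only at hy1 hy2
  subst hy1
  refine ⟨y.2, ?_⟩
  rw [← hy2]
  rfl

/-! ### The partial Fourier transform -/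

/-- The partial Fourier transform in `y` of a function on the plane, as an integral. -/
def fourierY (ψ : ℝ × ℝ → ℂ) (q : ℝ × ℝ) : ℂ :=
  ((Real.sqrt (2 * Real.pi))⁻¹ : ℂ) * ∫ y : ℝ, exp (-I * (q.2 : ℂ) * (y : ℂ)) * ψ (q.1, y)

theorem norm_exp_neg_I_mul (k y : ℝ) : ‖exp (-I * (k : ℂ) * (y : ℂ))‖ = 1 := by
  have : -I * (k : ℂ) * (y : ℂ) = ((-(k * y) : ℝ) : ℂ) * I := by push_cast; ring
  rw [this, norm_exp_ofReal_mul_I]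

theorem IsTest.slice_snd {U : Set (ℝ × ℝ)} {ψ : ℝ × ℝ → ℂ} (h : IsTest U ψ) (x : ℝ) :
    IsTest univ fun y => ψ (x, y) := by
  refine ⟨h.contDiff.comp (contDiff_const.prodMk contDiff_id), ?_, subset_univ _⟩
  refine HasCompactSupport.intro (IsCompact.image h.hasCompactSupport continuous_snd)
    fun y hy => ?_
  by_contra h0
  exact hy ⟨(x, y), subset_tsupport ψ h0, rfl⟩

/-- The integrand of the partial Fourier transform is dominated by a function of `y`. -/
theorem IsTest.exists_bound {U : Set (ℝ × ℝ)} {ψ : ℝ × ℝ → ℂ} (h : IsTest U ψ) :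
    ∃ b : ℝ → ℝ, Integrable b ∧ ∀ x y, ‖ψ (x, y)‖ ≤ b y := by
  have hK : IsCompact (Prod.snd '' tsupport ψ) := IsCompact.image h.hasCompactSupport continuous_snd
  obtain ⟨C, hC⟩ := h.continuous.bounded_above_of_compact_support h.hasCompactSupport
  refine ⟨(Prod.snd '' tsupport ψ).indicator fun _ => C, ?_, fun x y => ?_⟩
  · exact (integrable_indicator_iff hK.measurableSet).2
      (integrableOn_const hK.measure_lt_top.ne)
  · by_cases hy : y ∈ Prod.snd '' tsupport ψ
    · rw [indicator_of_mem hy]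
      exact hC _
    · rw [indicator_of_notMem hy]
      have : ψ (x, y) = 0 := by
        by_contra h0
        exact hy ⟨(x, y), subset_tsupport ψ h0, rfl⟩
      rw [this, norm_zero]

theorem IsTest.continuous_fourierY {U : Set (ℝ × ℝ)} {ψ : ℝ × ℝ → ℂ} (h : IsTest U ψ) :
    Continuous (fourierY ψ) := by
  obtain ⟨b, hb, hψb⟩ := h.exists_bound
  have hc := h.continuous
  refine continuous_const.mul (continuous_of_dominated (bound := b) (fun q => ?_) (fun q => ?_) hb
    (Filter.Eventually.of_forall fun y => by fun_prop))
  · exact Continuous.aestronglyMeasurable (by fun_prop)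
  · exact Filter.Eventually.of_forall fun y => by
      rw [norm_mul, norm_exp_neg_I_mul, one_mul]
      exact hψb _ _

theorem IsTest.hasDerivAt_fourierY {U : Set (ℝ × ℝ)} {ψ : ℝ × ℝ → ℂ} (h : IsTest U ψ) (x k : ℝ) :
    HasDerivAt (fun x => fourierY ψ (x, k)) (fourierY (HalfPlaneHall.dx ψ) (x, k)) x := by
  obtain ⟨b, hb, hψb⟩ := h.dx.exists_bound
  have hc := h.continuous
  have hc' := h.dx.continuous
  have hs : Continuous fun y => exp (-I * (k : ℂ) * (y : ℂ)) := by fun_prop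
  refine (hasDerivAt_integral_of_dominated_loc_of_deriv_le (bound := b)
    (F := fun x y => exp (-I * (k : ℂ) * (y : ℂ)) * ψ (x, y))
    (F' := fun x y => exp (-I * (k : ℂ) * (y : ℂ)) * HalfPlaneHall.dx ψ (x, y))
    Filter.univ_mem (Filter.Eventually.of_forall fun x => ?_) ?_ ?_ ?_ hb ?_).2.const_mul _
  · exact Continuous.aestronglyMeasurable (by fun_prop)
  · exact (Continuous.mul (by fun_prop) (by fun_prop)).integrable_of_hasCompactSupport
      ((h.slice_snd x).hasCompactSupport.mul_left)
  · exact Continuous.aestronglyMeasurable (by fun_prop)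
  · refine Filter.Eventually.of_forall fun y x _ => ?_
    rw [norm_mul, norm_exp_neg_I_mul, one_mul]
    exact hψb _ _
  · refine Filter.Eventually.of_forall fun y x _ => HasDerivAt.const_mul _ ?_
    exact (h.differentiable (x, y)).hasFDerivAt.comp_hasDerivAt x
      ((hasDerivAt_id' x).prodMk (hasDerivAt_const x y))

/-- Smoothness in `x`, by induction over all test functions simultaneously. -/
theorem IsTest.contDiff_fourierY {U : Set (ℝ × ℝ)} (k : ℝ) (n : ℕ) :
    ∀ ψ : ℝ × ℝ → ℂ, IsTest U ψ → ContDiff ℝ n fun x => fourierY ψ (x, k) := by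
  induction n with
  | zero =>
    intro ψ h
    exact contDiff_zero.2 (h.continuous_fourierY.comp (by fun_prop))
  | succ n ih =>
    intro ψ h
    have e : _root_.deriv (fun x => HalfPlaneHall.fourierY ψ (x, k))
        = fun x => HalfPlaneHall.fourierY (HalfPlaneHall.dx ψ) (x, k) :=
      funext fun x => (h.hasDerivAt_fourierY x k).deriv
    push_cast
    refine contDiff_succ_iff_deriv.2
      ⟨fun x => (h.hasDerivAt_fourierY x k).differentiableAt, by simp, ?_⟩
    rw [e]
    exact ih _ h.dx

theorem fourierY_eq_zero {ψ : ℝ × ℝ → ℂ} {x k : ℝ} (hx : x ∉ Prod.fst '' tsupport ψ) :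
    fourierY ψ (x, k) = 0 := by
  have h0 : ∀ y, ψ (x, y) = 0 := fun y => by
    by_contra h0
    exact hx ⟨(x, y), subset_tsupport ψ h0, rfl⟩
  simp [fourierY, h0]

theorem IsTest.fourierY {ψ : ℝ × ℝ → ℂ} (h : IsTest halfPlane ψ) (k : ℝ) :
    IsTest (Ioi 0) fun x => fourierY ψ (x, k) := by
  have hK : IsCompact (Prod.fst '' tsupport ψ) := IsCompact.image h.hasCompactSupport continuous_fst
  have hsub : tsupport (fun x => HalfPlaneHall.fourierY ψ (x, k)) ⊆ Prod.fst '' tsupport ψ := by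
    refine closure_minimal (fun x hx => ?_) hK.isClosed
    by_contra h0
    exact hx (fourierY_eq_zero h0)
  refine ⟨contDiff_infty.2 fun n => IsTest.contDiff_fourierY k n ψ h,
    HasCompactSupport.intro hK fun x hx => fourierY_eq_zero hx, hsub.trans ?_⟩
  rintro _ ⟨p, hp, rfl⟩
  exact h.tsupport_subset hp

/-- The partial Fourier transform turns `-i ∂_y` into multiplication by `k`. -/
theorem IsTest.fourierY_kin {U : Set (ℝ × ℝ)} {ψ : ℝ × ℝ → ℂ} (h : IsTest U ψ) (x k : ℝ) :
    HalfPlaneHall.fourierY (HalfPlaneHall.kin ψ) (x, k)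
      = -(((x - k : ℝ) : ℂ) * HalfPlaneHall.fourierY ψ (x, k)) := by
  have hc := h.continuous
  have hd : ∀ y, HasDerivAt (fun y => ψ (x, y)) (fderiv ℝ ψ (x, y) (0, 1)) y := fun y =>
    (h.differentiable (x, y)).hasFDerivAt.comp_hasDerivAt y
      ((hasDerivAt_const y x).prodMk (hasDerivAt_id' y))
  have he : ∀ y : ℝ, HasDerivAt (fun y : ℝ => exp (-I * (k : ℂ) * (y : ℂ)))
      (exp (-I * (k : ℂ) * (y : ℂ)) * (-I * k)) y := fun y => by
    have := ((hasDerivAt_id' y).ofReal_comp.const_mul (-I * (k : ℂ))).cexp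
    simpa using this
  have hs : Continuous fun y : ℝ => exp (-I * (k : ℂ) * (y : ℂ)) := by fun_prop
  have hdc := (h.dy.slice_snd x)
  have hsl := h.slice_snd x
  have i1 : Integrable fun y : ℝ => exp (-I * (k : ℂ) * (y : ℂ)) * fderiv ℝ ψ (x, y) (0, 1) :=
    (hs.mul hdc.continuous).integrable_of_hasCompactSupport hdc.hasCompactSupport.mul_left
  have i0 : Integrable fun y : ℝ => exp (-I * (k : ℂ) * (y : ℂ)) * ψ (x, y) :=
    (hs.mul hsl.continuous).integrable_of_hasCompactSupport hsl.hasCompactSupport.mul_left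
  have hibp : ∫ y : ℝ, (exp (-I * (k : ℂ) * (y : ℂ)) * (-I * k) * ψ (x, y)
      + exp (-I * (k : ℂ) * (y : ℂ)) * fderiv ℝ ψ (x, y) (0, 1)) = 0 := by
    refine integral_eq_zero_of_hasDerivAt_of_hasCompactSupport
      (fun y => (he y).mul (hd y)) ?_ hsl.hasCompactSupport.mul_left
    exact (((hs.mul continuous_const).mul hsl.continuous).add (hs.mul hdc.continuous))
  have e1 : ∀ y : ℝ, exp (-I * (k : ℂ) * (y : ℂ)) * (-I * k) * ψ (x, y)
      = (-I * k) * (exp (-I * (k : ℂ) * (y : ℂ)) * ψ (x, y)) := fun y => by ring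
  simp_rw [e1] at hibp
  rw [integral_add (i0.const_mul _) i1, integral_const_mul] at hibp
  have e2 : ∀ y : ℝ, exp (-I * (k : ℂ) * (y : ℂ)) * HalfPlaneHall.kin ψ (x, y)
      = -I * (exp (-I * (k : ℂ) * (y : ℂ)) * fderiv ℝ ψ (x, y) (0, 1))
        - (x : ℂ) * (exp (-I * (k : ℂ) * (y : ℂ)) * ψ (x, y)) := fun y => by
    rw [HalfPlaneHall.kin]; ring
  unfold HalfPlaneHall.fourierY
  simp only
  simp_rw [e2]
  rw [integral_sub (i1.const_mul _) (i0.const_mul _), integral_const_mul, integral_const_mul,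
    eq_neg_of_add_eq_zero_right hibp]
  push_cast
  linear_combination (((Real.sqrt (2 * Real.pi))⁻¹ : ℂ) * (-(k : ℂ))
    * ∫ y : ℝ, exp (-I * (k : ℂ) * (y : ℂ)) * ψ (x, y)) * I_mul_I

open scoped FourierTransform in
/-- Plancherel's theorem on the lines on which `x` is constant. -/
theorem IsTest.integral_norm_sq_fourierY {U : Set (ℝ × ℝ)} {ψ : ℝ × ℝ → ℂ} (h : IsTest U ψ)
    (x : ℝ) : Integrable (fun k => ‖HalfPlaneHall.fourierY ψ (x, k)‖ ^ 2) ∧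
      ∫ k, ‖HalfPlaneHall.fourierY ψ (x, k)‖ ^ 2 = ∫ y, ‖ψ (x, y)‖ ^ 2 := by
  have hsl := h.slice_snd x
  let f : SchwartzMap ℝ ℂ := hsl.hasCompactSupport.toSchwartzMap hsl.contDiff
  have hf : ∀ y, f y = ψ (x, y) := fun y => rfl
  have hpi : (0 : ℝ) < 2 * Real.pi := by positivity
  have key : ∀ k : ℝ, ‖HalfPlaneHall.fourierY ψ (x, k)‖ ^ 2
      = (2 * Real.pi)⁻¹ * ‖(𝓕 f) (k / (2 * Real.pi))‖ ^ 2 := by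
    intro k
    have e : (𝓕 f) (k / (2 * Real.pi)) = ∫ y : ℝ, exp (-I * (k : ℂ) * (y : ℂ)) * ψ (x, y) := by
      rw [SchwartzMap.fourier_coe, Real.fourier_real_eq_integral_exp_smul]
      refine integral_congr_ae (Filter.Eventually.of_forall fun y => ?_)
      simp only [smul_eq_mul, hf]
      congr 2
      push_cast
      field_simp
    rw [e, HalfPlaneHall.fourierY, norm_mul, mul_pow, norm_inv, norm_real,
      Real.norm_of_nonneg (Real.sqrt_nonneg _), inv_pow, Real.sq_sqrt hpi.le]
  simp_rw [key]
  have hi : Integrable fun w => ‖(𝓕 f) w‖ ^ 2 :=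
    ((𝓕 f).memLp 2).integrable_norm_pow (p := 2) (by norm_num)
  refine ⟨(hi.comp_div hpi.ne').const_mul _, ?_⟩
  have e := Measure.integral_comp_div (fun w => ‖(𝓕 f) w‖ ^ 2) (2 * Real.pi)
  rw [integral_const_mul, e, smul_eq_mul,
    SchwartzMap.integral_norm_sq_fourier, abs_of_pos hpi, ← mul_assoc, inv_mul_cancel₀ hpi.ne',
    one_mul]
  rfl

/-- Plancherel's theorem for the partial Fourier transform of a test function. -/
theorem IsTest.plancherel {ψ : ℝ × ℝ → ℂ} (h : IsTest halfPlane ψ) :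
    MemLp (HalfPlaneHall.fourierY ψ) 2 (volume.restrict halfPlane) ∧
      ∫ q in halfPlane, ‖HalfPlaneHall.fourierY ψ q‖ ^ 2 = ∫ q in halfPlane, ‖ψ q‖ ^ 2 := by
  have hψ : Integrable (fun q => ‖ψ q‖ ^ 2)
      ((volume.restrict (Ioi (0 : ℝ))).prod (volume : Measure ℝ)) := by
    rw [← volume_restrict_halfPlane]
    exact (h.memLp _).integrable_norm_pow (p := 2) (by norm_num)
  have hF : Integrable (fun q => ‖HalfPlaneHall.fourierY ψ q‖ ^ 2)
      ((volume.restrict (Ioi (0 : ℝ))).prod (volume : Measure ℝ)) := by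
    have hm : Continuous fun q => ‖HalfPlaneHall.fourierY ψ q‖ ^ 2 :=
      h.continuous_fourierY.norm.pow 2
    refine (integrable_prod_iff hm.aestronglyMeasurable).2
      ⟨Filter.Eventually.of_forall fun x => (h.integral_norm_sq_fourierY x).1, ?_⟩
    refine hψ.integral_prod_left.congr (Filter.Eventually.of_forall fun x => ?_)
    simp only [norm_pow, norm_norm]
    exact (h.integral_norm_sq_fourierY x).2.symm
  rw [volume_restrict_halfPlane]
  refine ⟨(memLp_two_iff_integrable_sq_norm h.continuous_fourierY.aestronglyMeasurable).2 hF, ?_⟩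
  rw [integral_prod _ hF, integral_prod _ hψ]
  exact integral_congr_ae (Filter.Eventually.of_forall fun x => (h.integral_norm_sq_fourierY x).2)

/-! ### The partial Fourier transform as an isometry and the fiber decomposition of the form -/

theorem IsTest.exists_mem_partialFourierCore {ψ : ℝ × ℝ → ℂ} (h : IsTest halfPlane ψ)
    {a : L2Plane} (ha : a =ᵐ[volume.restrict halfPlane] ψ) :
    ∃ b, (a, b) ∈ partialFourierCore ∧
      b =ᵐ[volume.restrict halfPlane] HalfPlaneHall.fourierY ψ :=
  ⟨h.plancherel.1.toLp _, ⟨ψ, h, ha, h.plancherel.1.coeFn_toLp⟩, h.plancherel.1.coeFn_toLp⟩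

theorem IsTest.integrable_fourierY {U : Set (ℝ × ℝ)} {ψ : ℝ × ℝ → ℂ} (h : IsTest U ψ)
    (q : ℝ × ℝ) : Integrable fun y : ℝ => exp (-I * (q.2 : ℂ) * (y : ℂ)) * ψ (q.1, y) :=
  (Continuous.mul (by fun_prop) (h.slice_snd q.1).continuous).integrable_of_hasCompactSupport
    (h.slice_snd q.1).hasCompactSupport.mul_left

/-- The graph of the partial Fourier transform on test functions, as a subspace. -/
def partialFourierGraph : Submodule ℂ (L2Plane × L2Plane) where
  carrier := partialFourierCore
  add_mem' := by
    rintro p p' ⟨ψ, hψ, h1, h2⟩ ⟨ψ', hψ', h1', h2'⟩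
    refine ⟨ψ + ψ', hψ.add hψ', (Lp.coeFn_add _ _).trans (h1.add h1'), ?_⟩
    filter_upwards [Lp.coeFn_add p.2 p'.2, h2, h2'] with q e e1 e2
    rw [Prod.snd_add, e, Pi.add_apply, e1, e2, ← mul_add,
      ← integral_add (hψ.integrable_fourierY q) (hψ'.integrable_fourierY q)]
    simp only [Pi.add_apply, mul_add]
  zero_mem' := by
    refine ⟨0, IsTest.zero, Lp.coeFn_zero _ _ _, (Lp.coeFn_zero _ _ _).trans ?_⟩
    exact Filter.Eventually.of_forall fun q => by simp
  smul_mem' := by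
    rintro c p ⟨ψ, hψ, h1, h2⟩
    refine ⟨c • ψ, hψ.const_smul c, (Lp.coeFn_smul _ _).trans (h1.const_smul c), ?_⟩
    filter_upwards [Lp.coeFn_smul c p.2, h2] with q e e1
    have e2 : ∀ y : ℝ, exp (-I * (q.2 : ℂ) * (y : ℂ)) * (c • ψ) (q.1, y)
        = c * (exp (-I * (q.2 : ℂ) * (y : ℂ)) * ψ (q.1, y)) := fun y => by
      rw [Pi.smul_apply, smul_eq_mul]; ring
    simp_rw [e2]
    rw [Prod.smul_snd, e, Pi.smul_apply, e1, integral_const_mul, smul_eq_mul]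
    ring

/-- Plancherel's theorem for the partial Fourier transform on `L²(Ω)`. -/
theorem norm_eq_of_mem_closure_partialFourierGraph {p : L2Plane × L2Plane}
    (hp : p ∈ partialFourierGraph.topologicalClosure) : ‖p.2‖ = ‖p.1‖ := by
  have hclosed : IsClosed {p : L2Plane × L2Plane | ‖p.2‖ = ‖p.1‖} :=
    isClosed_eq (by fun_prop) (by fun_prop)
  refine closure_minimal ?_ hclosed hp
  rintro q ⟨ψ, hψ, h1, h2⟩
  change ‖q.2‖ = ‖q.1‖
  have h2' : q.2 =ᵐ[volume.restrict halfPlane] fourierY ψ := h2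
  have := hψ.plancherel.2
  rw [← L2_norm_sq_eq_of_ae h1, ← L2_norm_sq_eq_of_ae h2'] at this
  exact (pow_left_inj₀ (norm_nonneg _) (norm_nonneg _) two_ne_zero).1 this

theorem inner_eq_of_mem_closure_partialFourierGraph {p q : L2Plane × L2Plane}
    (hp : p ∈ partialFourierGraph.topologicalClosure)
    (hq : q ∈ partialFourierGraph.topologicalClosure) : ⟪p.2, q.2⟫_ℂ = ⟪p.1, q.1⟫_ℂ := by
  have hI : (RCLike.I : ℂ) • q ∈ partialFourierGraph.topologicalClosure :=
    Submodule.smul_mem _ _ hq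
  have h1 := norm_eq_of_mem_closure_partialFourierGraph (Submodule.add_mem _ hp hq)
  have h2 := norm_eq_of_mem_closure_partialFourierGraph (Submodule.sub_mem _ hp hq)
  have h3 := norm_eq_of_mem_closure_partialFourierGraph (Submodule.add_mem _ hp hI)
  have h4 := norm_eq_of_mem_closure_partialFourierGraph (Submodule.sub_mem _ hp hI)
  simp only [Prod.fst_add, Prod.snd_add, Prod.fst_sub, Prod.snd_sub, Prod.smul_fst,
    Prod.smul_snd] at h1 h2 h3 h4
  rw [inner_eq_sum_norm_sq_div_four, inner_eq_sum_norm_sq_div_four, h1, h2, h3, h4]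

/-- The partial Fourier transforms of a sequence of test functions which converges in `L²`
converge to the partial Fourier transform of the limit. -/
theorem exists_tendsto_fourierY {ψ : ℕ → ℝ × ℝ → ℂ} (hψ : ∀ j, IsTest halfPlane (ψ j))
    {a : ℕ → L2Plane} (ha : ∀ j, a j =ᵐ[volume.restrict halfPlane] ψ j) {a' : L2Plane}
    (hlim : Filter.Tendsto a Filter.atTop (nhds a')) :
    ∃ (b : ℕ → L2Plane) (b' : L2Plane),
      (∀ j, b j =ᵐ[volume.restrict halfPlane] fourierY (ψ j)) ∧
      (a', b') ∈ partialFourierGraph.topologicalClosure ∧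
      Filter.Tendsto b Filter.atTop (nhds b') := by
  choose b hb e using fun j => (hψ j).exists_mem_partialFourierCore (ha j)
  have h : ∀ j, (a j, b j) ∈ partialFourierGraph := hb
  have hc : CauchySeq b := by
    rw [Metric.cauchySeq_iff']
    intro ε hε
    obtain ⟨N, hN⟩ := Metric.cauchySeq_iff'.1 hlim.cauchySeq ε hε
    refine ⟨N, fun n hn => ?_⟩
    have h1 := norm_eq_of_mem_closure_partialFourierGraph (p := (a n, b n) - (a N, b N))
      (Submodule.le_topologicalClosure _ (Submodule.sub_mem _ (h n) (h N)))
    have h2 := hN n hn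
    rw [dist_eq_norm] at h2 ⊢
    exact h1.trans_lt h2
  obtain ⟨b', hb'⟩ := cauchySeq_tendsto_of_complete hc
  exact ⟨b, b', e, mem_closure_of_tendsto (hlim.prodMk_nhds hb')
    (Filter.Eventually.of_forall h), hb'⟩

theorem eq_of_mem_closure_partialFourierGraph {a b b' : L2Plane}
    (h : (a, b) ∈ partialFourierGraph.topologicalClosure)
    (h' : (a, b') ∈ partialFourierGraph.topologicalClosure) : b = b' := by
  have h1 := norm_eq_of_mem_closure_partialFourierGraph (Submodule.sub_mem _ h h')
  simp only [Prod.mk_sub_mk, sub_self, norm_zero] at h1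
  exact sub_eq_zero.1 (norm_eq_zero.1 h1)

/-- The partial Fourier transform decomposes the closed form of the Hamiltonian into the closed
forms of the fiber operators. Here `G₁` and `G₂` are the transforms of `∂ₓ φ` and `(-i ∂_y - x) φ`;
the sign in front of `G₂` comes from `k - x = -(x - k)`. -/
theorem exists_fiber_decomposition {φ φhat : L2Plane} {g : WithLp 2 (L2Plane × L2Plane)}
    (h : (φ, g) ∈ planeCore.topologicalClosure) (hF : IsPartialFourierTransform φ φhat) :
    ∃ G₁ G₂ : L2Plane, ‖φhat‖ = ‖φ‖ ∧ ‖G₁‖ = ‖g.fst‖ ∧ ‖G₂‖ = ‖g.snd‖ ∧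
      ⟪φhat, G₂⟫_ℂ = ⟪φ, g.snd⟫_ℂ ∧
      ∀ᵐ k : ℝ, (slice φhat k, WithLp.toLp 2 (slice G₁ k, -slice G₂ k))
        ∈ (fiberCore k).topologicalClosure := by
  have hF' : (φ, φhat) ∈ partialFourierGraph.topologicalClosure := hF
  obtain ⟨q, hq, hlim⟩ := mem_closure_iff_seq_limit.1 h
  choose ψ hψ h0 h1 h2 using hq
  have l0 : Filter.Tendsto (fun j => (q j).1) Filter.atTop (nhds φ) :=
    (continuous_fst.tendsto _).comp hlim
  have l1 : Filter.Tendsto (fun j => (q j).2.fst) Filter.atTop (nhds g.fst) :=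
    (((WithLp.fstL 2 ℂ L2Plane L2Plane).continuous.comp continuous_snd).tendsto _).comp hlim
  have l2 : Filter.Tendsto (fun j => (q j).2.snd) Filter.atTop (nhds g.snd) :=
    (((WithLp.sndL 2 ℂ L2Plane L2Plane).continuous.comp continuous_snd).tendsto _).comp hlim
  obtain ⟨F0, G0, e0, hG0, m0⟩ := exists_tendsto_fourierY hψ h0 l0
  obtain ⟨F1, G1, e1, hG1, m1⟩ := exists_tendsto_fourierY (fun j => (hψ j).dx) h1 l1
  obtain ⟨F2, G2, e2, hG2, m2⟩ := exists_tendsto_fourierY (fun j => (hψ j).kin) h2 l2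
  obtain rfl : G0 = φhat := eq_of_mem_closure_partialFourierGraph hG0 hF'
  have n0 := norm_eq_of_mem_closure_partialFourierGraph hG0
  have n1 := norm_eq_of_mem_closure_partialFourierGraph hG1
  have n2 := norm_eq_of_mem_closure_partialFourierGraph hG2
  have n3 := inner_eq_of_mem_closure_partialFourierGraph hG0 hG2
  refine ⟨G1, G2, n0, n1, n2, n3, ?_⟩
  obtain ⟨ns, -, hns⟩ := exists_tendsto_slice (F := ![F0, F1, F2]) (f := ![G0, G1, G2])
    (Fin.forall_fin_succ.2 ⟨m0, Fin.forall_fin_two.2 ⟨m1, m2⟩⟩)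
  filter_upwards [hns, ae_all_iff.2 fun j => slice_ae_of_ae (e0 j),
    ae_all_iff.2 fun j => slice_ae_of_ae (e1 j),
    ae_all_iff.2 fun j => slice_ae_of_ae (e2 j)] with k hk s0 s1 s2
  have k0 : Filter.Tendsto (fun j => slice (F0 (ns j)) k) Filter.atTop (nhds (slice G0 k)) := hk 0
  have k1 : Filter.Tendsto (fun j => slice (F1 (ns j)) k) Filter.atTop (nhds (slice G1 k)) := hk 1
  have k2 : Filter.Tendsto (fun j => slice (F2 (ns j)) k) Filter.atTop (nhds (slice G2 k)) := hk 2
  refine mem_closure_of_tendsto (k0.prodMk_nhds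
    (((WithLp.prod_continuous_toLp 2 _ _).tendsto _).comp (k1.prodMk_nhds k2.neg)))
    (Filter.Eventually.of_forall fun j => ?_)
  refine ⟨fun x => fourierY (ψ (ns j)) (x, k), (hψ _).fourierY k, s0 _, ?_, ?_⟩
  · refine (s1 (ns j)).trans (Filter.Eventually.of_forall fun x => ?_)
    exact ((hψ _).hasDerivAt_fourierY x k).deriv.symm
  · refine (Lp.coeFn_neg _).trans ?_
    filter_upwards [s2 (ns j)] with x hx
    rw [Pi.neg_apply, hx, (hψ _).fourierY_kin, neg_neg]

/-! ### The current of a bulk state -/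

theorem fourierCoeff_eq_inner_slice (f : L2Plane) :
    ∀ᵐ k : ℝ, ∀ v : L2HalfLine, fourierCoeff f v k = ⟪v, slice f k⟫_ℂ := by
  filter_upwards [slice_ae f] with k hk v
  rw [L2_inner_eq_of_ae (Filter.EventuallyEq.refl _ (v : ℝ → ℂ)) hk, fourierCoeff]
  exact integral_congr_ae (Filter.Eventually.of_forall fun x => mul_comm _ _)

/-- On the line spanned by an eigenfunction `u`, the form of `h(k)` at `c u` is at least
`λ |c|²`. -/
theorem eigenvalue_mul_norm_sq_le {k t : ℝ} (ht : 0 < t) {e : L2HalfLine} (he1 : ‖e‖ = 1)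
    (he : (e, (t : ℂ) • e) ∈ formGraph (fiberCore k)) {c : ℂ}
    {g : WithLp 2 (L2HalfLine × L2HalfLine)}
    (h : (c • e, g) ∈ (fiberCore k).topologicalClosure) : t * ‖c‖ ^ 2 ≤ ‖g‖ ^ 2 := by
  obtain ⟨γ, hγ, hq⟩ := he
  simp only at hγ hq
  have h1 := inner_eq_of_mem_topologicalClosure hq hγ
  have h2 := inner_eq_of_mem_topologicalClosure hq h
  simp only at h1 h2
  have h3 : ‖γ‖ ^ 2 = t := by
    rw [inner_self_eq_norm_sq_to_K, inner_smul_right, inner_self_eq_norm_sq_to_K, he1] at h1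
    apply Complex.ofReal_injective
    push_cast at h1 ⊢
    simpa using h1
  have h4 : ‖⟪g, γ⟫_ℂ‖ = t * ‖c‖ := by
    rw [h2, inner_smul_right, inner_smul_left, norm_mul, norm_mul, inner_self_eq_norm_sq_to_K, he1,
      RCLike.norm_conj, norm_real, Real.norm_of_nonneg ht.le]
    simp
  have h5 := norm_inner_le_norm (𝕜 := ℂ) g γ
  rw [h4] at h5
  have h6 : (t * ‖c‖) ^ 2 ≤ ‖g‖ ^ 2 * t := by
    rw [← h3, ← mul_pow, h3]
    exact pow_le_pow_left₀ (by positivity) h5 2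
  have h7 : t * (t * ‖c‖ ^ 2) ≤ t * ‖g‖ ^ 2 := by linarith [h6, mul_pow t ‖c‖ 2]
  exact le_of_mul_le_mul_left h7 ht

variable {u : ℕ → ℝ → L2HalfLine}

/-- A bound on the current of the eigenfunction `u_{m+1}(·, k)` in terms of its energy carries over
to the vectors in the span of this eigenfunction. -/
theorem IsEigenfunctionFamily.two_mul_norm_inner_le (hu : IsEigenfunctionFamily u) (m : ℕ) {k : ℝ}
    {f : L2HalfLine} {g : WithLp 2 (L2HalfLine × L2HalfLine)}
    (h : (f, g) ∈ (fiberCore k).topologicalClosure)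
    (hf : ∀ j, 1 ≤ j → j ≠ m + 1 → ⟪u j k, f⟫_ℂ = 0) {A B : ℝ} (hB : 0 ≤ B)
    (hAB : fiberCurrent u (m + 1) k
      ≤ A + B * (bandFunction (m + 1) k - landauLevel (m + 1))) :
    2 * ‖⟪f, g.snd⟫_ℂ‖ ≤ A * ‖f‖ ^ 2 + B * (‖g‖ ^ 2 - landauLevel (m + 1) * ‖f‖ ^ 2) := by
  have hm : 1 ≤ m + 1 := Nat.le_add_left 1 m
  obtain ⟨c, rfl⟩ := hu.eq_smul_of_inner hm hf
  obtain ⟨hu1, hue⟩ := isNormalizedEigenvector_fiber_iff.1 (hu (m + 1) hm k)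
  have hpos : 0 < bandFunction (m + 1) k := by
    linarith [one_le_landauLevel hm, hu.landauLevel_le hm k]
  have hen := eigenvalue_mul_norm_sq_le hpos hu1 hue h
  have hcur := (hu.fiberCurrent_bounds m k).1
  have hin : ⟪c • u (m + 1) k, g.snd⟫_ℂ
      = ((‖c‖ ^ 2 * (fiberCurrent u (m + 1) k / 2) : ℝ) : ℂ) := by
    rw [L2_inner_eq_of_ae (Filter.EventuallyEq.refl _ _) (fiber_closure_ae h).1, fiberCurrent,
      mul_div_cancel_left₀ _ (two_ne_zero' ℝ), ← integral_const_mul, ← integral_complex_ofReal]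
    refine integral_congr_ae ?_
    filter_upwards [Lp.coeFn_smul c (u (m + 1) k)] with x hx
    have e1 := Complex.conj_mul' (u (m + 1) k x)
    have e2 := Complex.conj_mul' c
    rw [hx, Pi.smul_apply, smul_eq_mul, map_mul]
    push_cast
    linear_combination ((x : ℂ) - k) * ((starRingEnd ℂ) (u (m + 1) k x) * u (m + 1) k x) * e2
      + ((x : ℂ) - k) * (‖c‖ : ℂ) ^ 2 * e1
  have hnorm : ‖c • u (m + 1) k‖ ^ 2 = ‖c‖ ^ 2 := by rw [norm_smul, hu1, mul_one]
  rw [hin, norm_real, Real.norm_of_nonneg (by positivity), hnorm]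
  have h1 := mul_le_mul_of_nonneg_left hAB (sq_nonneg ‖c‖)
  have h2 := mul_le_mul_of_nonneg_left hen hB
  linarith

/-- Integration over the fibers: if the current of `u_{m+1}(·, k)` is bounded by `A + B (λ - E)`,
then so is the current of a state with energy in `(E, E + δ)` all of whose other Fourier
coefficients vanish. -/
theorem IsEigenfunctionFamily.exists_norm_inner_currentOperator_le (hu : IsEigenfunctionFamily u)
    (m : ℕ) {A B δ : ℝ} (hB : 0 ≤ B)
    (hAB : ∀ k, fiberCurrent u (m + 1) k
      ≤ A + B * (bandFunction (m + 1) k - landauLevel (m + 1)))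
    {φ : L2Plane} (hφ : φ ∈ bulkSpace u (m + 1) δ) :
    ∃ h : φ ∈ currentOperator.domain,
      ‖⟪φ, currentOperator ⟨φ, h⟩⟫_ℂ‖ ≤ (A + B * δ) * ‖φ‖ ^ 2 := by
  have hE : 0 ≤ landauLevel (m + 1) := by
    linarith [one_le_landauLevel (Nat.le_add_left 1 m)]
  obtain ⟨hconc, φhat, hF, hcoef⟩ := hφ
  obtain ⟨g, hg, hgn⟩ := exists_lift_of_energyConcentrated hE hconc
  obtain ⟨hdom, hJ⟩ := exists_currentOperator_eq (mem_kinGraph_of_mem_closure hg)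
  refine ⟨hdom, ?_⟩
  obtain ⟨G₁, G₂, n0, n1, n2, hin, hfib⟩ := exists_fiber_decomposition hg hF
  have hcoef' : ∀ᵐ k : ℝ, ∀ j, 1 ≤ j → j ≠ m + 1 → fourierCoeff φhat (u j k) k = 0 := by
    rw [ae_all_iff]
    intro j
    by_cases hj : 1 ≤ j ∧ j ≠ m + 1
    · filter_upwards [hcoef j hj.1 hj.2] with k hk _ _
      exact hk
    · exact Filter.Eventually.of_forall fun k h1 h2 => absurd ⟨h1, h2⟩ hj
  have hbound : ∀ᵐ k : ℝ, ‖⟪slice φhat k, slice G₂ k⟫_ℂ‖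
      ≤ (A * ‖slice φhat k‖ ^ 2 + B * ((‖slice G₁ k‖ ^ 2 + ‖slice G₂ k‖ ^ 2)
        - landauLevel (m + 1) * ‖slice φhat k‖ ^ 2)) / 2 := by
    filter_upwards [hfib, hcoef', fourierCoeff_eq_inner_slice φhat] with k h1 h2 h3
    have h4 := hu.two_mul_norm_inner_le m h1 (fun j hj1 hj2 => (h3 _).symm.trans (h2 j hj1 hj2))
      hB (hAB k)
    rw [norm_sq_pair] at h4
    change 2 * ‖⟪slice φhat k, -slice G₂ k⟫_ℂ‖ ≤ A * ‖slice φhat k‖ ^ 2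
      + B * (‖slice G₁ k‖ ^ 2 + ‖-slice G₂ k‖ ^ 2 - landauLevel (m + 1) * ‖slice φhat k‖ ^ 2) at h4
    rw [inner_neg_right, norm_neg, norm_neg] at h4
    linarith
  have i0 := integrable_norm_sq_slice φhat
  have i1 := integrable_norm_sq_slice G₁
  have i2 := integrable_norm_sq_slice G₂
  have i12 : Integrable fun k => ‖slice G₁ k‖ ^ 2 + ‖slice G₂ k‖ ^ 2 := i1.add i2
  have i3 : Integrable fun k => B * ((‖slice G₁ k‖ ^ 2 + ‖slice G₂ k‖ ^ 2)
      - landauLevel (m + 1) * ‖slice φhat k‖ ^ 2) := (i12.sub (i0.const_mul _)).const_mul B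
  have i4 : Integrable fun k => A * ‖slice φhat k‖ ^ 2 := i0.const_mul A
  have key : ‖⟪φhat, G₂⟫_ℂ‖ ≤ (A * ‖φ‖ ^ 2
      + B * (‖g‖ ^ 2 - landauLevel (m + 1) * ‖φ‖ ^ 2)) / 2 := by
    rw [inner_eq_integral_slice]
    refine (norm_integral_le_of_norm_le ((i4.add i3).div_const 2) hbound).trans (le_of_eq ?_)
    simp only [Pi.add_apply]
    rw [integral_div, integral_add i4 i3, integral_const_mul, integral_const_mul,
      integral_sub i12 (i0.const_mul _), integral_add i1 i2, integral_const_mul,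
      ← norm_sq_eq_integral_slice, ← norm_sq_eq_integral_slice, ← norm_sq_eq_integral_slice,
      n0, n1, n2, norm_sq_pair]
  rw [hJ, inner_smul_right, norm_mul, norm_neg, Complex.norm_two, ← hin]
  have h5 := mul_le_mul_of_nonneg_left hgn hB
  linarith

end HalfPlaneHall

end

theorem mainTheorem2 (n : ℕ) (hn : 1 ≤ n) :
    ∃ μ δ₀ : ℝ, 0 < μ ∧ 0 < δ₀ ∧
      ∀ u : ℕ → ℝ → HalfPlaneHall.L2HalfLine, HalfPlaneHall.IsEigenfunctionFamily u →
      ∀ δ : ℝ, 0 < δ → δ < δ₀ → ∀ φ ∈ HalfPlaneHall.bulkSpace u n δ,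
        ∃ hφ : φ ∈ HalfPlaneHall.currentOperator.domain,
          ‖⟪φ, HalfPlaneHall.currentOperator ⟨φ, hφ⟩⟫_ℂ‖ ≤
            (2 * δ * Real.sqrt |Real.log δ|
              + μ * (δ * Real.log |Real.log δ| / Real.sqrt |Real.log δ|)) * ‖φ‖ ^ 2 := by
  obtain ⟨m, rfl⟩ : ∃ m, n = m + 1 := ⟨n - 1, by omega⟩
  by_cases hne : ∃ u₀, HalfPlaneHall.IsEigenfunctionFamily u₀
  swap
  -- the constants are read off from some eigenfunction family; without one, the claim is vacuous
  · exact ⟨1, 1, one_pos, one_pos, fun u hu => absurd ⟨u, hu⟩ hne⟩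
  obtain ⟨u₀, hu₀⟩ := hne
  obtain ⟨μ, δ₀, hμ, hδ₀, h⟩ := hu₀.exists_fiberCurrent_le_add m
  refine ⟨μ, δ₀, hμ, hδ₀, fun u hu δ h0 h1 φ hφ => ?_⟩
  obtain ⟨A, B, hB, hAB, hcur⟩ := h δ h0 h1
  obtain ⟨hdom, hle⟩ := hu.exists_norm_inner_currentOperator_le m hB (hcur u hu) hφ
  exact ⟨hdom, hle.trans (mul_le_mul_of_nonneg_right hAB (sq_nonneg _))⟩
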